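/- Let $\mathcal{M}$ be a factor of type $\mathrm{II}_1$ (a von Neumann algebra on a Hilbert space which is a finite factor without minimal projections) with faithful normal unital trace $\tau$, let $\mathcal{A}$ be a MASA (maximal abelian self-adjoint subalgebra) of $\mathcal{M}$, and let $E_{\mathcal{A}} : \mathcal{M} \to \mathcal{A}$ denote the normal conditional expectation onto $\mathcal{A}$. For a self-adjoint $T \in \mathcal{M}$, let $m_T$ be its spectral distribution, i.e. the unique Borel probability measure on $\mathbb{R}$ with $\int_{\mathbb{R}} s^n \, dm_T(s) = \tau(T^n)$ for all integers $n \ge 0$, and for $s \in [0,1)$ put $\lambda_s(T) = \inf\{ t \in \mathbb{R} \mid m_T((t,\infty)) \le s \}$. For arbitrary $T \in \mathcal{M}$ and $s \in [0,1)$, put $\mu_s(T) = \lambda_s(|T|)$, where $|T| = (T^*T)^{1/2}$. Let $A \in \mathcal{A}$ and $T \in \mathcal{M}$ be positive elements and suppose that there is a constant $\delta > 0$ such that $\mu_s(A) + \delta \le \mu_s(T)$ for all $s \in [0,1)$. Then there are unitaries $U, V \in \mathcal{M}$ such that $E_{\mathcal{A}}(UTV) = A$. -/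

import Mathlib

open scoped ComplexOrder

noncomputable section

namespace Thompson

open MeasureTheory

variable {H : Type*} [NormedAddCommGroup H] [InnerProductSpace ℂ H] [CompleteSpace H]

/-- A von Neumann algebra is norm closed; this makes its type of elements a C⋆-algebra, so that
the continuous functional calculus is available inside it. -/
instance isClosed_coe (M : VonNeumannAlgebra H) :
    IsClosed (M.toStarSubalgebra : Set (H →L[ℂ] H)) := by
  have h := Set.isClosed_centralizer (Set.centralizer (M : Set (H →L[ℂ] H)))
  rwa [M.centralizer_centralizer] at h

/-- `M` is a factor: `M ≠ 0` and the centre of `M` consists of the scalars. -/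
structure IsFactor (M : VonNeumannAlgebra H) : Prop where
  nontrivial : Nontrivial M.toStarSubalgebra
  center_eq_scalars : ∀ z : M.toStarSubalgebra, (∀ x : M.toStarSubalgebra, z * x = x * z) →
    ∃ c : ℂ, z = algebraMap ℂ M.toStarSubalgebra c

/-- `p` is a minimal projection of `M`: a non-zero projection of `M` whose only subprojections
in `M` are `0` and `p`. -/
structure IsMinimalProjection (M : VonNeumannAlgebra H) (p : M.toStarSubalgebra) : Prop where
  isStarProjection : IsStarProjection p
  ne_zero : p ≠ 0
  eq_zero_or_eq : ∀ q : M.toStarSubalgebra, IsStarProjection q → q * p = q → q = 0 ∨ q = p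

/-- `M` is a factor of type II₁: a finite factor (every isometry of `M` is unitary) without
minimal projections. -/
structure IsTypeIIOneFactor (M : VonNeumannAlgebra H) : Prop extends IsFactor M where
  finite : ∀ v : M.toStarSubalgebra, star v * v = 1 → v * star v = 1
  diffuse : ∀ p : M.toStarSubalgebra, ¬ IsMinimalProjection M p

/-- `τ` is a faithful normal unital trace on `M`. Normality is preservation of suprema of
upward directed families, i.e. `ScottContinuous` for the operator order on `M`. -/
structure IsFaithfulNormalTrace (M : VonNeumannAlgebra H)
    (τ : M.toStarSubalgebra →ₗ[ℂ] ℂ) : Prop where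
  map_one : τ 1 = 1
  nonneg : ∀ x, 0 ≤ τ (star x * x)
  mul_comm : ∀ x y, τ (x * y) = τ (y * x)
  faithful : ∀ x, τ (star x * x) = 0 → x = 0
  normal : ScottContinuous τ

/-- `𝒜` is a MASA of `M`: a maximal abelian self-adjoint subalgebra. -/
def IsMASA (M : VonNeumannAlgebra H) (𝒜 : StarSubalgebra ℂ M.toStarSubalgebra) : Prop :=
  Maximal (fun B : StarSubalgebra ℂ M.toStarSubalgebra ↦ ∀ x ∈ B, ∀ y ∈ B, x * y = y * x) 𝒜

/-- `E` is a normal conditional expectation of `M` onto the subalgebra `𝒜`: a positive normal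
linear projection onto `𝒜` which is an `𝒜`-bimodule map. -/
structure IsNormalCondExp (M : VonNeumannAlgebra H) (𝒜 : StarSubalgebra ℂ M.toStarSubalgebra)
    (E : M.toStarSubalgebra →ₗ[ℂ] 𝒜) : Prop where
  apply_coe : ∀ a : 𝒜, E (a : M.toStarSubalgebra) = a
  nonneg : ∀ x : M.toStarSubalgebra, 0 ≤ x → 0 ≤ E x
  bimodule : ∀ (a b : 𝒜) (x : M.toStarSubalgebra),
    E ((a : M.toStarSubalgebra) * x * (b : M.toStarSubalgebra)) = a * E x * b
  normal : ScottContinuous E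

/-- The measure `m` on `ℝ` is a Borel probability measure whose moments are the moments `τ (T ^ n)`
of `T`. -/
structure HasMoments {M : VonNeumannAlgebra H} (τ : M.toStarSubalgebra →ₗ[ℂ] ℂ)
    (T : M.toStarSubalgebra) (m : Measure ℝ) : Prop where
  isProbabilityMeasure : IsProbabilityMeasure m
  integrable : ∀ n : ℕ, Integrable (fun s : ℝ ↦ s ^ n) m
  integral_eq : ∀ n : ℕ, ((∫ s : ℝ, s ^ n ∂m : ℝ) : ℂ) = τ (T ^ n)

theorem ae_abs_le_of_moments_le {m : Measure ℝ} [IsProbabilityMeasure m] {R : ℝ} (hR : 0 ≤ R)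
    (hint : ∀ n : ℕ, Integrable (fun s : ℝ ↦ s ^ n) m)
    (hle : ∀ n : ℕ, ∫ s : ℝ, s ^ (2 * n) ∂m ≤ R ^ (2 * n)) :
    ∀ᵐ s ∂m, |s| ≤ R + 1 := by
  have key : ∀ n : ℕ, m.real {s : ℝ | R + 1 < |s|} ≤ ((R / (R + 1)) ^ 2) ^ n := by
    intro n
    have h1 := mul_meas_ge_le_integral_of_nonneg (μ := m) (f := fun s : ℝ ↦ s ^ (2 * n))
      (Filter.Eventually.of_forall fun s ↦ by
        simpa using Even.pow_nonneg (even_two_mul n) s) (hint (2 * n)) ((R + 1) ^ (2 * n))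
    have h2 : m.real {s : ℝ | R + 1 < |s|} ≤ m.real {s : ℝ | (R + 1) ^ (2 * n) ≤ s ^ (2 * n)} := by
      refine measureReal_mono fun s hs ↦ ?_
      have hs' : R + 1 < |s| := hs
      have : (R + 1) ^ (2 * n) ≤ |s| ^ (2 * n) := pow_le_pow_left₀ (by linarith) hs'.le _
      rwa [Even.pow_abs (even_two_mul n)] at this
    rw [← pow_mul, div_pow, le_div_iff₀ (by positivity), mul_comm]
    calc _ ≤ (R + 1) ^ (2 * n) * m.real {s : ℝ | (R + 1) ^ (2 * n) ≤ s ^ (2 * n)} := by gcongr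
      _ ≤ _ := h1
      _ ≤ _ := hle n
  have hlt : (R / (R + 1)) ^ 2 < 1 := by
    have : R / (R + 1) < 1 := by rw [div_lt_one (by linarith)]; linarith
    have h0 : 0 ≤ R / (R + 1) := by positivity
    nlinarith
  have h0 : m.real {s : ℝ | R + 1 < |s|} ≤ 0 :=
    ge_of_tendsto' (tendsto_pow_atTop_nhds_zero_of_lt_one (by positivity) hlt) key
  have h3 : m {s : ℝ | R + 1 < |s|} = 0 := by
    have := le_antisymm h0 measureReal_nonneg
    rwa [measureReal_eq_zero_iff] at this
  rw [ae_iff]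
  simpa using h3

theorem measure_eq_of_moments {m m' : Measure ℝ} [IsProbabilityMeasure m] [IsProbabilityMeasure m']
    {R : ℝ} (hR : 0 ≤ R)
    (hint : ∀ n : ℕ, Integrable (fun s : ℝ ↦ s ^ n) m)
    (hint' : ∀ n : ℕ, Integrable (fun s : ℝ ↦ s ^ n) m')
    (heq : ∀ n : ℕ, ∫ s : ℝ, s ^ n ∂m = ∫ s : ℝ, s ^ n ∂m')
    (hle : ∀ n : ℕ, ∫ s : ℝ, s ^ (2 * n) ∂m ≤ R ^ (2 * n)) : m = m' := by
  have hs := ae_abs_le_of_moments_le hR hint hle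
  have hs' := ae_abs_le_of_moments_le hR hint' (fun n ↦ heq (2 * n) ▸ hle n)
  have hpint : ∀ (ν : Measure ℝ), (∀ n : ℕ, Integrable (fun s : ℝ ↦ s ^ n) ν) →
      ∀ p : Polynomial ℝ, Integrable (fun s ↦ p.eval s) ν := by
    intro ν hν p
    simp only [Polynomial.eval_eq_sum_range]
    exact integrable_finsetSum _ fun i _ ↦ (hν i).const_mul _
  have hp : ∀ p : Polynomial ℝ, ∫ s, p.eval s ∂m = ∫ s, p.eval s ∂m' := by
    intro p
    simp only [Polynomial.eval_eq_sum_range]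
    rw [integral_finsetSum _ fun i _ ↦ (hint i).const_mul _,
      integral_finsetSum _ fun i _ ↦ (hint' i).const_mul _]
    simp only [integral_const_mul, heq]
  refine ext_of_forall_integral_eq_of_IsFiniteMeasure fun f ↦ ?_
  have hbound : ∀ (ν : Measure ℝ) [IsProbabilityMeasure ν],
      (∀ n : ℕ, Integrable (fun s : ℝ ↦ s ^ n) ν) → (∀ᵐ s ∂ν, |s| ≤ R + 1) →
      ∀ (p : Polynomial ℝ) (ε : ℝ), (∀ x ∈ Set.Icc (-(R + 1)) (R + 1), |p.eval x - f x| < ε) →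
        |∫ s, p.eval s ∂ν - ∫ s, f s ∂ν| ≤ ε := by
    intro ν _ hν hsν p ε hpε
    rw [← integral_sub (hpint ν hν p) (f.integrable ν)]
    have := norm_integral_le_of_norm_le_const (μ := ν) (f := fun s ↦ p.eval s - f s) (C := ε)
      (by
        filter_upwards [hsν] with s hs
        exact (hpε s (abs_le.mp hs)).le)
    simpa using this
  refine eq_of_abs_sub_le_all fun ε hε ↦ ?_
  obtain ⟨p, hpε⟩ := exists_polynomial_near_of_continuousOn (-(R + 1)) (R + 1) f
    f.continuous.continuousOn (ε / 2) (by positivity)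
  have h1 := hbound m hint hs p _ hpε
  have h2 := hbound m' hint' hs' p _ hpε
  rw [hp p] at h1
  rw [abs_le] at h1 h2 ⊢
  constructor <;> linarith [h1.1, h1.2, h2.1, h2.2]

theorem apply_cfcHom_nonneg {M : VonNeumannAlgebra H} {τ : M.toStarSubalgebra →ₗ[ℂ] ℂ}
    (hpos : ∀ x, 0 ≤ τ (star x * x)) {T : M.toStarSubalgebra} (hT : IsSelfAdjoint T)
    (f : C(spectrum ℝ T, ℝ)) (hf : 0 ≤ f) : 0 ≤ τ (cfcHom hT f) := by
  let g : C(spectrum ℝ T, ℝ) := ⟨fun x ↦ Real.sqrt (f x), by fun_prop⟩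
  have hg : f = star g * g := by
    ext x
    simpa [g] using (Real.mul_self_sqrt (hf x)).symm
  rw [hg, map_mul, map_star]
  exact hpos _

/-- The moments of a self-adjoint element are those of exactly one Borel probability measure. -/
theorem existsUnique_hasMoments {M : VonNeumannAlgebra H} {τ : M.toStarSubalgebra →ₗ[ℂ] ℂ}
    (hone : τ 1 = 1) (hpos : ∀ x, 0 ≤ τ (star x * x)) {T : M.toStarSubalgebra}
    (hT : IsSelfAdjoint T) : ∃! m : Measure ℝ, HasMoments τ T m := by
  let X := spectrum ℝ T
  have : CompactSpace X := isCompact_iff_compactSpace.mp (spectrum.isCompact T)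
  have hnn := apply_cfcHom_nonneg hpos hT
  let Λ₀ : CompactlySupportedContinuousMap X ℝ →ₗ[ℝ] ℝ :=
    { toFun := fun f ↦ (τ (cfcHom hT (f : C(X, ℝ)))).re
      map_add' := fun f g ↦ by
        have : ((f + g : CompactlySupportedContinuousMap X ℝ) : C(X, ℝ)) = (f : C(X, ℝ)) + g := rfl
        rw [this]; simp
      map_smul' := fun r f ↦ by
        have : ((r • f : CompactlySupportedContinuousMap X ℝ) : C(X, ℝ)) = r • (f : C(X, ℝ)) := rfl
        rw [this, map_smul, LinearMap.map_smul_of_tower]; simp }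
  let Λ : CompactlySupportedContinuousMap X ℝ →ₚ[ℝ] ℝ :=
    PositiveLinearMap.mk₀ Λ₀ fun f hf ↦
      (Complex.nonneg_iff.mp (hnn (f : C(X, ℝ)) fun x ↦ hf x)).1
  let m₀ := RealRMK.rieszMeasure Λ
  have hint₀ : ∀ f : C(X, ℝ), ∫ x, f x ∂m₀ = (τ (cfcHom hT f)).re := fun f ↦
    RealRMK.integral_rieszMeasure Λ (CompactlySupportedContinuousMap.continuousMapEquiv f)
  have : IsFiniteMeasure m₀ := inferInstance
  have hprob : IsProbabilityMeasure m₀ := by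
    have h1 := hint₀ 1
    rw [map_one, hone] at h1
    simp only [ContinuousMap.one_apply, integral_const, smul_eq_mul, mul_one, Complex.one_re] at h1
    exact ⟨(ENNReal.toReal_eq_one_iff _).mp h1⟩
  let P : ℕ → C(X, ℝ) := fun n ↦ ((ContinuousMap.id ℝ).restrict X) ^ n
  have hP : ∀ n, cfcHom hT (P n) = T ^ n := fun n ↦ by
    simp only [P, map_pow]; rw [cfcHom_id hT]
  have him : ∀ f : C(X, ℝ), (τ (cfcHom hT f)).im = 0 := by
    intro f
    have hle : 0 ≤ f + ContinuousMap.const X ‖f‖ := fun x ↦ by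
      have := f.norm_coe_le_norm x
      rw [Real.norm_eq_abs, abs_le] at this
      change 0 ≤ f x + ‖f‖
      linarith [this.1]
    have h1 := (Complex.nonneg_iff.mp (hnn _ hle)).2
    have h2 := (Complex.nonneg_iff.mp (hnn (ContinuousMap.const X ‖f‖) fun x ↦ norm_nonneg f)).2
    rw [map_add, map_add, Complex.add_im, ← h2] at h1
    linarith
  have hX : ∀ x : X, |(x : ℝ)| ≤ ‖P 1‖ := fun x ↦ by simpa [P] using (P 1).norm_coe_le_norm x
  have hemb : MeasurableEmbedding (Subtype.val : X → ℝ) :=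
    MeasurableEmbedding.subtype_coe (spectrum.isCompact T).measurableSet
  have hmom : HasMoments τ T (m₀.map Subtype.val) := by
    refine ⟨Measure.isProbabilityMeasure_map hemb.measurable.aemeasurable, fun n ↦ ?_, fun n ↦ ?_⟩
    · rw [hemb.integrable_map_iff]
      exact (P n).continuous.integrable_of_hasCompactSupport (HasCompactSupport.of_compactSpace _)
    · rw [hemb.integral_map]
      have := hint₀ (P n)
      rw [hP] at this
      apply Complex.ext
      · rw [← this]; simp [P]
      · rw [← hP n, him]; simp
  refine ⟨_, hmom, fun m hm ↦ ?_⟩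
  have := hm.isProbabilityMeasure
  have := hmom.isProbabilityMeasure
  refine (measure_eq_of_moments (norm_nonneg (P 1)) hmom.integrable hm.integrable
    (fun n ↦ ?_) fun n ↦ ?_).symm
  · exact_mod_cast (hmom.integral_eq n).trans (hm.integral_eq n).symm
  · rw [hemb.integral_map]
    have := norm_integral_le_of_norm_le_const (μ := m₀) (f := fun x : X ↦ (x : ℝ) ^ (2 * n))
      (C := ‖P 1‖ ^ (2 * n)) (Filter.Eventually.of_forall fun x ↦ by
        rw [norm_pow]; exact pow_le_pow_left₀ (norm_nonneg _) (hX x) _)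
    simpa using (le_abs_self _).trans this

open Classical in
/-- The spectral distribution `m_T` of a self-adjoint `T`: the Borel probability measure on `ℝ`
whose `n`-th moment is `τ (T ^ n)` for all `n`. (For self-adjoint `T` it exists and is unique, see
`existsUnique_hasMoments`.) -/
def spectralDistribution {M : VonNeumannAlgebra H} (τ : M.toStarSubalgebra →ₗ[ℂ] ℂ)
    (T : M.toStarSubalgebra) : Measure ℝ :=
  if h : ∃ m : Measure ℝ, HasMoments τ T m then h.choose else 0

theorem hasMoments_spectralDistribution {M : VonNeumannAlgebra H}
    {τ : M.toStarSubalgebra →ₗ[ℂ] ℂ} (hτ : IsFaithfulNormalTrace M τ) {T : M.toStarSubalgebra}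
    (hT : IsSelfAdjoint T) : HasMoments τ T (spectralDistribution τ T) := by
  have h := (existsUnique_hasMoments hτ.map_one hτ.nonneg hT).exists
  rw [spectralDistribution, dif_pos h]
  exact h.choose_spec

/-- The eigenvalue function `λ_s(T)` of a self-adjoint `T`, for `s ∈ [0,1)`. -/
def eigenvalueFunction {M : VonNeumannAlgebra H} (τ : M.toStarSubalgebra →ₗ[ℂ] ℂ)
    (T : M.toStarSubalgebra) (s : ℝ) : ℝ :=
  sInf {t : ℝ | (spectralDistribution τ T).real (Set.Ioi t) ≤ s}

/-- The absolute value `|T| = (T* T)^{1/2}`. -/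
def absValue {M : VonNeumannAlgebra H} (T : M.toStarSubalgebra) : M.toStarSubalgebra :=
  cfc Real.sqrt (star T * T)

/-- The singular value function `μ_s(T) = λ_s(|T|)`, for `s ∈ [0,1)`. -/
def singularValueFunction {M : VonNeumannAlgebra H} (τ : M.toStarSubalgebra →ₗ[ℂ] ℂ)
    (T : M.toStarSubalgebra) (s : ℝ) : ℝ :=
  eigenvalueFunction τ (absValue T) s

end Thompson

end

/-! The plan is to find elements `C`, `S` of `𝒜` such that a unitary conjugate of `T` is close to
`S` and `A` is close to `C * S`. One then needs a unitary whose expectation is almost `C`, and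
finally a perturbation argument that turns "close to `A`" into "equal to `A`".

Discretization: spectral projections of `A` at multiples of a mesh form a chain in `𝒜`. Because the
factor is diffuse, `𝒜` has no minimal projections, so the chain extends to a flag indexed by the
trace (`IsMASA.exists_flag`). Projections of equal trace are equivalent in a factor
(`exists_equiv_of_trace_eq`), so the spectral projections of `T` can be conjugated into the same
flag. The gap `δ` says that on every joint spectral cell the level of `T` exceeds that of `A` by at
least `δ / 2`. Hence the quotient `C` of the levels has norm at most some `c < 1`, and `S` is
bounded below.

Prescribing the diagonal: let `σ` be a unitary commuting with `C` that permutes `N + 2` orthogonal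
projections of `𝒜` cyclically. Elements of `𝒜` have degree `0`, `σ` has degree `1`, and `E` kills
every nonzero degree modulo `N + 2`. The Möbius unitary `U = (C + σ)(1 + Cσ)⁻¹ = C + (1 - C²)σ - ⋯`
therefore has expectation nearly `C`, and `E (U * T)` is near `C * S`, hence near `A`
(`exists_unitary_apply_mul_eq_of_shift`).

Removing the error: the derivative of `h ↦ E (exp (i h) * U * T)` at `0` is almost onto the
self-adjoint and non-self-adjoint parts of `𝒜` alike. The degree `1` coefficient `(1 - C²)` of `U`
is invertible, and a correction built from `B * D * star σ`, with `D` inverse to `(1 - C²) S`, moves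
the expectation by nearly `B`. The bound on this approximate right inverse depends only on `δ`,
`‖A‖`, `‖T‖`, not on the mesh or on `N`. These can thus be chosen afterwards so that the Newton
iteration `exists_unitary_apply_mul_eq` converges. -/

open scoped ComplexOrder InnerProductSpace

noncomputable section

namespace Thompson

/-! ### Newton iteration over the unitary group. -/

section Newton

variable {R : Type*} [CStarAlgebra R]

/-- For every small self-adjoint `h` there is a unitary which agrees with `1 + i h` up to second
order. -/
theorem exists_unitary_norm_sub_le {h : R} (hh : IsSelfAdjoint h) (h1 : ‖h‖ ≤ 1) :
    ∃ u ∈ unitary R, ‖u - 1 - Complex.I • h‖ ≤ ‖h‖ ^ 2 := by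
  rcases subsingleton_or_nontrivial R with hR | hR
  · exact ⟨1, one_mem _, by simp [Subsingleton.elim h 0]⟩
  have hn : IsStarNormal h := hh.isStarNormal
  have hreal : ∀ z ∈ spectrum ℂ h, star z = z := fun z hz ↦ by
    have := hh.mem_spectrum_eq_re hz
    rw [this]; simp
  refine ⟨cfc (fun z : ℂ ↦ Complex.exp (Complex.I * z)) h, ?_, ?_⟩
  · rw [cfc_unitary_iff _ h]
    intro z hz
    have := hreal z hz
    change (starRingEnd ℂ) _ * _ = 1
    rw [← Complex.exp_conj, ← Complex.exp_add, map_mul, Complex.conj_I,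
      show (starRingEnd ℂ) z = z from this]
    simp
  · have e1 : (1 : R) = cfc (fun _ : ℂ ↦ (1 : ℂ)) h := (cfc_const_one ℂ h).symm
    have e2 : Complex.I • h = cfc (fun z : ℂ ↦ Complex.I * z) h := by
      rw [cfc_const_mul_id Complex.I h]
    rw [e2]
    nth_rewrite 1 [e1]
    rw [← cfc_sub _ _ h, ← cfc_sub _ _ h]
    refine norm_cfc_le (by positivity) fun z hz ↦ ?_
    have hz' : ‖z‖ ≤ ‖h‖ := spectrum.norm_le_norm_of_mem hz
    have hI : ‖Complex.I * z‖ = ‖z‖ := by simp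
    refine (Complex.norm_exp_sub_one_sub_id_le (by rw [hI]; linarith)).trans ?_
    rw [hI]; gcongr

theorem norm_le_one_of_mem_unitary {u : R} (hu : u ∈ unitary R) : ‖u‖ ≤ 1 := by
  rcases subsingleton_or_nontrivial R with hR | hR
  · simp [Subsingleton.elim u 0]
  · exact (CStarRing.norm_of_mem_unitary hu).le

/-- One step of the Newton iteration. -/
theorem newton_step {𝒜 : Set R} {E : R →ₗ[ℂ] R} (hE : ∀ x, ‖E x‖ ≤ 2 * ‖x‖)
    {G : R} {K L : ℝ} (hL : 1 ≤ L) (hK : 1 ≤ K) (hG : ‖G‖ ≤ L)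
    (hsolve : ∀ B ∈ 𝒜, ∃ h : R, IsSelfAdjoint h ∧ ‖h‖ ≤ K * ‖B‖ ∧
      ‖E (Complex.I • h * G) - B‖ ≤ 1 / 2 * ‖B‖)
    {A : R} {ρ : ℝ} (hρ : ρ * (128 * K ^ 2 * L) ≤ 1) {W : R} (hW : W ∈ unitary R)
    (hB : A - E (W * G) ∈ 𝒜) (hBρ : ‖A - E (W * G)‖ ≤ ρ) (hW1 : ‖W - 1‖ ≤ 8 * K * ρ) :
    ∃ W' ∈ unitary R, ‖A - E (W' * G)‖ ≤ 3 / 4 * ‖A - E (W * G)‖ ∧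
      ‖W' - W‖ ≤ 2 * K * ‖A - E (W * G)‖ := by
  obtain ⟨h, hh, hhK, hhE⟩ := hsolve _ hB
  set B := A - E (W * G) with hBdef
  have hρ0 : 0 ≤ ρ := (norm_nonneg _).trans hBρ
  have hKL : 1 ≤ K * L := by nlinarith
  have hKρ : K * ρ ≤ 1 / 128 := by
    have : 0 ≤ K * ρ := by positivity
    nlinarith
  have hh0 := norm_nonneg h
  have hh1 : ‖h‖ ≤ 1 := by
    have : K * ‖B‖ ≤ K * ρ := by gcongr
    linarith
  obtain ⟨u, hu, hu2⟩ := exists_unitary_norm_sub_le hh hh1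
  have hWn := norm_le_one_of_mem_unitary hW
  -- This is a simplified Newton step: the linear equation is solved at `G`, not at the current
  -- point `W * G`. The new error has three sources: the approximate solution (`1/2`), the
  -- replacement of `W * G` by `G` (`1/8`, using `‖W - 1‖ ≤ 8Kρ`), and the second-order term of the
  -- exponential (`1/64`). Together they stay below `3/4`.
  refine ⟨u * W, mul_mem hu hW, ?_, ?_⟩
  · have key : A - E (u * W * G) = -(E (Complex.I • h * G) - B)
        - (E (Complex.I • h * ((W - 1) * G)) + E ((u - 1 - Complex.I • h) * (W * G))) := by
      have : u * W * G = W * G + Complex.I • h * G + Complex.I • h * ((W - 1) * G)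
          + (u - 1 - Complex.I • h) * (W * G) := by
        simp only [sub_mul, mul_sub, one_mul, mul_assoc]; abel
      rw [this, map_add, map_add, map_add, hBdef]; abel
    have n1 : ‖E (Complex.I • h * ((W - 1) * G))‖ ≤ 1 / 8 * ‖B‖ := by
      refine (hE _).trans ?_
      have : ‖Complex.I • h * ((W - 1) * G)‖ ≤ (K * ‖B‖) * ((8 * K * ρ) * L) := by
        refine (norm_mul_le _ _).trans ?_
        gcongr
        · simpa [norm_smul] using hhK
        · exact (norm_mul_le _ _).trans (by gcongr)
      have h2 : 16 * K ^ 2 * L * ρ ≤ 1 / 8 := by linarith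
      nlinarith [norm_nonneg B]
    have n2 : ‖E ((u - 1 - Complex.I • h) * (W * G))‖ ≤ 1 / 64 * ‖B‖ := by
      refine (hE _).trans ?_
      have : ‖(u - 1 - Complex.I • h) * (W * G)‖ ≤ (K * ‖B‖) ^ 2 * (1 * L) := by
        refine (norm_mul_le _ _).trans ?_
        gcongr
        · exact hu2.trans (by gcongr)
        · exact (norm_mul_le _ _).trans (by gcongr)
      have h3 : K ^ 2 * L * ‖B‖ ≤ K ^ 2 * L * ρ := by gcongr
      have h2 : K ^ 2 * L * ρ ≤ 1 / 128 := by linarith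
      nlinarith [norm_nonneg B]
    rw [key]
    calc _ ≤ ‖-(E (Complex.I • h * G) - B)‖ + ‖E (Complex.I • h * ((W - 1) * G))
          + E ((u - 1 - Complex.I • h) * (W * G))‖ := norm_sub_le _ _
      _ ≤ ‖E (Complex.I • h * G) - B‖ + (‖E (Complex.I • h * ((W - 1) * G))‖
          + ‖E ((u - 1 - Complex.I • h) * (W * G))‖) := by
        rw [norm_neg]; gcongr; exact norm_add_le _ _
      _ ≤ 3 / 4 * ‖B‖ := by linarith [norm_nonneg B]
  · have : u * W - W = ((u - 1 - Complex.I • h) + Complex.I • h) * W := by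
      simp [sub_mul]
    rw [this]
    calc _ ≤ (‖h‖ ^ 2 + ‖h‖) * 1 := by
          refine (norm_mul_le _ _).trans ?_
          gcongr
          refine (norm_add_le _ _).trans ?_
          gcongr
          simp [norm_smul]
      _ ≤ 2 * K * ‖B‖ := by nlinarith

/-- If the derivative of `h ↦ E (exp (i h) G)` at `0` has an approximate right inverse, and `E G`
is close to `A`, then `E (W G) = A` for some unitary `W`. -/
theorem exists_unitary_apply_mul_eq {𝒜 : StarSubalgebra ℂ R} {E : R →ₗ[ℂ] R}
    (hE : ∀ x, ‖E x‖ ≤ 2 * ‖x‖) (hE𝒜 : ∀ x, E x ∈ 𝒜)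
    {G : R} {K L : ℝ} (hL : 1 ≤ L) (hK : 1 ≤ K) (hG : ‖G‖ ≤ L)
    (hsolve : ∀ B ∈ 𝒜, ∃ h : R, IsSelfAdjoint h ∧ ‖h‖ ≤ K * ‖B‖ ∧
      ‖E (Complex.I • h * G) - B‖ ≤ 1 / 2 * ‖B‖)
    {A : R} (hA : A ∈ 𝒜) (hAE : ‖A - E G‖ * (128 * K ^ 2 * L) ≤ 1) :
    ∃ W ∈ unitary R, E (W * G) = A := by
  set ρ := ‖A - E G‖ with hρ
  have hρ0 : 0 ≤ ρ := norm_nonneg _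
  -- The distance bound is the partial geometric sum of the steps `2Kρ (3/4)^k`; it never exceeds
  -- the `8Kρ` required by `newton_step`.
  let P : ℕ → R → Prop := fun n W ↦ W ∈ unitary R ∧ ‖A - E (W * G)‖ ≤ (3 / 4) ^ n * ρ ∧
    ‖W - 1‖ ≤ 8 * K * ρ * (1 - (3 / 4) ^ n)
  have hstep : ∀ n W, P n W → ∃ W', P (n + 1) W' ∧ ‖W' - W‖ ≤ 2 * K * ρ * (3 / 4) ^ n := by
    rintro n W ⟨h1, h2, h3⟩
    have hpow : (3 / 4 : ℝ) ^ n ≤ 1 := pow_le_one₀ (by norm_num) (by norm_num)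
    have hpow0 : 0 < (3 / 4 : ℝ) ^ n := by positivity
    obtain ⟨W', hW', h4, h5⟩ := newton_step (𝒜 := 𝒜) hE hL hK hG hsolve hAE h1
      (sub_mem hA (hE𝒜 _)) (h2.trans (by nlinarith)) (h3.trans (by
        have : 0 ≤ 8 * K * ρ := by positivity
        nlinarith))
    have h6 : ‖W' - W‖ ≤ 2 * K * ρ * (3 / 4) ^ n := by
      refine h5.trans ?_
      have : 2 * K * ‖A - E (W * G)‖ ≤ 2 * K * ((3 / 4) ^ n * ρ) := by gcongr
      linarith
    refine ⟨W', ⟨hW', ?_, ?_⟩, h6⟩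
    · rw [pow_succ]; linarith
    · have : W' - 1 = (W' - W) + (W - 1) := by abel
      rw [this]
      refine (norm_add_le _ _).trans ?_
      rw [pow_succ]; linarith
  have h0 : P 0 1 := ⟨one_mem _, by simp [hρ], by simp⟩
  choose! nxt hnxt using hstep
  let Ws : ℕ → R := fun n ↦ Nat.rec 1 (fun n W ↦ nxt n W) n
  have hP : ∀ n, P n (Ws n) := fun n ↦ by
    induction n with
    | zero => exact h0
    | succ n ih => exact (hnxt n _ ih).1
  have hd : ∀ n, dist (Ws n) (Ws (n + 1)) ≤ 2 * K * ρ * (3 / 4) ^ n := fun n ↦ by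
    rw [dist_comm, dist_eq_norm]; exact (hnxt n _ (hP n)).2
  obtain ⟨W, hW⟩ := cauchySeq_tendsto_of_complete (cauchySeq_of_le_geometric _ _ (by norm_num) hd)
  refine ⟨W, isClosed_unitary.mem_of_tendsto hW (Filter.Eventually.of_forall fun n ↦ (hP n).1), ?_⟩
  have hEc : Continuous E := E.mkContinuous 2 hE |>.continuous
  have hl : Filter.Tendsto (fun n ↦ ‖A - E (Ws n * G)‖) Filter.atTop
      (nhds ‖A - E (W * G)‖) :=
    (tendsto_const_nhds.sub ((hEc.tendsto _).comp (hW.mul_const G))).norm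
  have hz : Filter.Tendsto (fun n : ℕ ↦ (3 / 4 : ℝ) ^ n * ρ) Filter.atTop (nhds 0) := by
    simpa using (tendsto_pow_atTop_nhds_zero_of_lt_one (r := (3 / 4 : ℝ)) (by norm_num)
      (by norm_num)).mul_const ρ
  have := le_of_tendsto_of_tendsto' hl hz fun n ↦ (hP n).2.1
  exact (sub_eq_zero.mp (norm_le_zero_iff.mp this)).symm

end Newton

/-! ### Cyclic shifts and unitaries with prescribed diagonal. -/

section Shift

variable {R : Type*} [CStarAlgebra R]

/-- The properties of a conditional expectation onto an abelian subalgebra that the construction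
uses; `E` is regarded as a map into the ambient algebra. -/
structure IsAbelianExpectation (𝒜 : StarSubalgebra ℂ R) (E : R →ₗ[ℂ] R) : Prop where
  mem : ∀ x, E x ∈ 𝒜
  bimodule : ∀ a ∈ 𝒜, ∀ b ∈ 𝒜, ∀ x, E (a * x * b) = a * E x * b
  apply_of_mem : ∀ a ∈ 𝒜, E a = a
  norm_le : ∀ x, ‖E x‖ ≤ 2 * ‖x‖
  comm : ∀ a ∈ 𝒜, ∀ b ∈ 𝒜, a * b = b * a

namespace IsAbelianExpectation

variable {𝒜 : StarSubalgebra ℂ R} {E : R →ₗ[ℂ] R} (hE : IsAbelianExpectation 𝒜 E)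

include hE

theorem mul_left {a : R} (ha : a ∈ 𝒜) (x : R) : E (a * x) = a * E x := by
  simpa using hE.bimodule a ha 1 (one_mem _) x

theorem mul_right {a : R} (ha : a ∈ 𝒜) (x : R) : E (x * a) = E x * a := by
  simpa using hE.bimodule 1 (one_mem _) a ha x

end IsAbelianExpectation

/-- `x` moves each `e i` to `e (i + j)`. -/
def Shifts {n : ℕ} (e : ZMod n → R) (j : ZMod n) (x : R) : Prop := ∀ i, x * e i = e (i + j) * x

variable {n : ℕ} {e : ZMod n → R}

/-- `Shifts` acts as a `ZMod n`-grading: degrees add under products and change sign under `star`.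
All later computations of expectations are bookkeeping of degrees. -/
theorem Shifts.mul {j k : ZMod n} {x y : R} (hx : Shifts e j x) (hy : Shifts e k y) :
    Shifts e (j + k) (x * y) := fun i ↦ by
  rw [mul_assoc, hy i, ← mul_assoc, hx, mul_assoc, add_assoc, add_comm k j]

theorem Shifts.pow {j : ZMod n} {x : R} (hx : Shifts e j x) (k : ℕ) :
    Shifts e (k * j) (x ^ k) := by
  induction k with
  | zero => intro i; simp
  | succ k ih =>
    rw [pow_succ]
    have := ih.mul hx
    rwa [show (k : ZMod n) * j + j = ((k + 1 : ℕ) : ZMod n) * j by push_cast; ring] at this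

theorem Shifts.star {j : ZMod n} {x : R} (he : ∀ i, star (e i) = e i) (hx : Shifts e j x) :
    Shifts e (-j) (star x) := fun i ↦ by
  have := congrArg Star.star (hx (i + -j))
  simp only [star_mul, he] at this
  rw [neg_add_cancel_right] at this
  exact this.symm

theorem shifts_zero {𝒜 : StarSubalgebra ℂ R} {E : R →ₗ[ℂ] R} (hE : IsAbelianExpectation 𝒜 E)
    (hemem : ∀ i, e i ∈ 𝒜) {a : R} (ha : a ∈ 𝒜) : Shifts e 0 a := fun i ↦ by
  rw [add_zero, hE.comm _ ha _ (hemem i)]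

variable {𝒜 : StarSubalgebra ℂ R} {E : R →ₗ[ℂ] R}

/-- The expectation of an element which moves the `e i` without fixed points vanishes. -/
theorem Shifts.apply_eq_zero [NeZero n] (hE : IsAbelianExpectation 𝒜 E) (hemem : ∀ i, e i ∈ 𝒜)
    (heorth : ∀ i j, i ≠ j → e i * e j = 0) (heidem : ∀ i, e i * e i = e i)
    (hesum : ∑ i, e i = 1) {j : ZMod n} (hj : j ≠ 0) {x : R} (hx : Shifts e j x) : E x = 0 := by
  have : ∀ i, E x * e i = 0 := fun i ↦ by
    calc E x * e i = e i * E x * e i := by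
          rw [hE.comm _ (hemem i) _ (hE.mem x), mul_assoc, heidem]
      _ = E (e i * x * e i) := (hE.bimodule _ (hemem i) _ (hemem i) x).symm
      _ = E (e i * e (i + j) * x) := by rw [mul_assoc, hx i, mul_assoc]
      _ = 0 := by rw [heorth i (i + j) (by simpa using hj)]; simp
  calc E x = E x * ∑ i, e i := by rw [hesum, mul_one]
    _ = 0 := by rw [Finset.mul_sum]; simp [this]

/-- A unitary of Möbius type: close to a polynomial in `σ` with constant term `C`. -/
theorem exists_unitary_near_polynomial {C σ : R} (hC : IsSelfAdjoint C) (hσ : σ ∈ unitary R)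
    (hCσ : Commute C σ) {c : ℝ} (hc : ‖C‖ ≤ c) (hc1 : c < 1) (N : ℕ) :
    ∃ U ∈ unitary R, ‖U - (C + (1 - C ^ 2) * σ * ∑ j ∈ Finset.range N, (-(C * σ)) ^ j)‖
      ≤ 2 * c ^ N / (1 - c) := by
  set x := -(C * σ) with hx
  have hσn := norm_le_one_of_mem_unitary hσ
  have hc0 : 0 ≤ c := (norm_nonneg _).trans hc
  have hxn : ‖x‖ ≤ c := by
    rw [hx, norm_neg]
    refine (norm_mul_le _ _).trans ?_
    nlinarith [norm_nonneg C, norm_nonneg σ]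
  have hxlt : ‖x‖ < 1 := hxn.trans_lt hc1
  obtain ⟨Z, hZ⟩ : IsUnit (1 - x) := isUnit_one_sub_of_norm_lt_one hxlt
  have hσ1 : star σ * σ = 1 := (Unitary.mem_iff.mp hσ).1
  have hσ2 : σ * star σ = 1 := (Unitary.mem_iff.mp hσ).2
  have hCσ' : Commute C (star σ) := by
    have := hCσ.star_star; rwa [hC.star_eq] at this
  -- Since `σ` is unitary and `C` is self-adjoint, `C + σ = σ (1 + Cσ)*`, so numerator and
  -- denominator of the Möbius quotient are invertible together.
  have hunit : IsUnit (C + σ) := by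
    have h1 : C + σ = σ * star (1 - x) := by
      simp only [hx, sub_neg_eq_add, star_add, star_one, star_mul, hC.star_eq]
      rw [mul_add, mul_one, ← mul_assoc, hσ2, one_mul, add_comm]
    rw [h1, ← hZ]
    exact (Units.mk σ (star σ) hσ2 hσ1).isUnit.mul Z.isUnit.star
  obtain ⟨Y, hY⟩ := hunit
  -- Equality of these two squares is what makes the quotient `(C + σ)(1 + Cσ)⁻¹` unitary.
  have hYZ : star (Y : R) * Y = star (Z : R) * Z := by
    rw [hY, hZ, hx]
    simp only [sub_neg_eq_add, star_add, star_one, star_mul, hC.star_eq]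
    simp only [add_mul, mul_add, mul_one, one_mul, hσ1]
    have : star σ * C * (C * σ) = C * C := by
      rw [← hCσ'.eq, mul_assoc, ← mul_assoc (star σ) C σ, ← hCσ'.eq, mul_assoc, hσ1, mul_one]
    rw [this]; abel
  set U : R := Y * (Z⁻¹ : Rˣ) with hU
  have hUZ : U * (1 - x) = C + σ := by rw [← hZ, hU, mul_assoc, Units.inv_mul, mul_one, hY]
  have hUu : star U * U = 1 := by
    rw [hU, star_mul, mul_assoc, ← mul_assoc (star (Y : R)), hYZ]
    have : star ((Z⁻¹ : Rˣ) : R) * star (Z : R) = 1 := by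
      rw [← star_mul, Units.mul_inv, star_one]
    calc _ = (star ((Z⁻¹ : Rˣ) : R) * star (Z : R)) * (Z * (Z⁻¹ : Rˣ)) := by
            simp only [mul_assoc]
      _ = 1 := by rw [this, Units.mul_inv, one_mul]
  have hUU : U * star U = 1 := by
    have h1 : star U = ((Y * Z⁻¹)⁻¹ : Rˣ) :=
      Units.eq_inv_of_mul_eq_one_right (by rw [Units.val_mul]; exact hUu)
    rw [h1, hU, ← Units.val_mul, Units.mul_inv]
  refine ⟨U, Unitary.mem_iff.mpr ⟨hUu, hUU⟩, ?_⟩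
  set P := C + (1 - C ^ 2) * σ * ∑ j ∈ Finset.range N, x ^ j with hP
  -- `P` truncates the geometric series of `(1 - x)⁻¹` in `U = C + (1 - C²)σ(1 - x)⁻¹`, so `P * (1 -
  -- x)` misses `C + σ` by one tail term.
  have hPZ : P * (1 - x) = C + σ - (1 - C ^ 2) * σ * x ^ N := by
    have h1 : (∑ j ∈ Finset.range N, x ^ j) * (1 - x) = 1 - x ^ N := geom_sum_mul_neg x N
    rw [hP, add_mul, mul_assoc, h1]
    have h2 : C * (1 - x) = C + C ^ 2 * σ := by
      rw [hx, sub_neg_eq_add, mul_add, mul_one, ← mul_assoc, sq]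
    rw [h2]
    noncomm_ring
  have hdiff : U - P = (1 - C ^ 2) * σ * x ^ N + (U - P) * x := by
    have : (U - P) * (1 - x) = (1 - C ^ 2) * σ * x ^ N := by
      rw [sub_mul, hUZ, hPZ]; abel
    rw [← this]; noncomm_ring
  have hn : ‖U - P‖ ≤ 2 * c ^ N + ‖U - P‖ * c := by
    conv_lhs => rw [hdiff]
    refine (norm_add_le _ _).trans ?_
    gcongr
    · rcases subsingleton_or_nontrivial R with hR | hR
      · rw [Subsingleton.elim ((1 - C ^ 2) * σ * x ^ N) 0]; simp; positivity
      have h1 : ‖(1 : R) - C ^ 2‖ ≤ 2 := by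
        refine (norm_sub_le _ _).trans ?_
        have : ‖C ^ 2‖ ≤ 1 := (norm_pow_le _ 2).trans (by nlinarith [norm_nonneg C])
        rw [norm_one]; linarith
      calc _ ≤ ‖(1 - C ^ 2) * σ‖ * ‖x ^ N‖ := norm_mul_le _ _
        _ ≤ (2 * 1) * c ^ N := by
          gcongr
          · exact (norm_mul_le _ _).trans (by gcongr)
          · exact (norm_pow_le _ N).trans (by gcongr)
        _ = _ := by ring
    · exact (norm_mul_le _ _).trans (by gcongr)
  rw [le_div_iff₀ (by linarith)]
  linarith

/-- The main construction inside an abstract C⋆-algebra: the diagonal of a suitable left unitary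
multiple of `T`, which is close to the diagonal element `S`, is `A`, which is close to `C * S`. -/
theorem exists_unitary_apply_mul_eq_of_shift {N : ℕ} {e : ZMod (N + 2) → R}
    (hE : IsAbelianExpectation 𝒜 E) (hemem : ∀ i, e i ∈ 𝒜)
    (heorth : ∀ i j, i ≠ j → e i * e j = 0) (heidem : ∀ i, e i * e i = e i)
    (hestar : ∀ i, star (e i) = e i) (hesum : ∑ i, e i = 1)
    {σ : R} (hσ : σ ∈ unitary R) (hσe : ∀ i, σ * e i = e (i + 1) * σ)
    {C S D : R} (hC : IsSelfAdjoint C) (hCm : C ∈ 𝒜) (hSm : S ∈ 𝒜) (hDm : D ∈ 𝒜)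
    (hCσ : Commute C σ)
    (hD : D * (1 - C ^ 2) * S = 1) {c κ L η : ℝ} (hc : ‖C‖ ≤ c) (hc1 : c < 1)
    (hκ : 1 ≤ κ) (hDκ : ‖D‖ ≤ κ) (hL : 1 ≤ L) (hSL : ‖S‖ ≤ L)
    {T A : R} (hTL : ‖T‖ ≤ L) (hTS : ‖T - S‖ ≤ η) (hA : A ∈ 𝒜)
    (hsmall : (‖A - C * S‖ + 2 * (η + 2 * c ^ N / (1 - c) * L)) * (512 * κ ^ 2 * L) ≤ 1) :
    ∃ W ∈ unitary R, E (W * T) = A := by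
  have hσ1 : star σ * σ = 1 := (Unitary.mem_iff.mp hσ).1
  have hσ2 : σ * star σ = 1 := (Unitary.mem_iff.mp hσ).2
  obtain ⟨U, hU, hUP⟩ := exists_unitary_near_polynomial hC hσ hCσ hc hc1 N
  set x := -(C * σ) with hx
  set P := C + (1 - C ^ 2) * σ * ∑ j ∈ Finset.range N, x ^ j with hP
  set δ := 2 * c ^ N / (1 - c) with hδ
  have hc0 : 0 ≤ c := (norm_nonneg _).trans hc
  have hδ0 : 0 ≤ δ := div_nonneg (by positivity) (by linarith)
  have hη0 : 0 ≤ η := (norm_nonneg _).trans hTS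
  have s0 : ∀ {a}, a ∈ 𝒜 → Shifts e 0 a := fun ha ↦ shifts_zero hE hemem ha
  have s1 : Shifts e 1 σ := hσe
  have sx : Shifts e 1 x := by
    have h := (s0 (neg_mem hCm)).mul s1
    rwa [zero_add, neg_mul] at h
  have sx' : ∀ j : ℕ, Shifts e j (x ^ j) := fun j ↦ by simpa using sx.pow j
  have sσ' : Shifts e (-1) (star σ) := s1.star hestar
  have hcast : ∀ k : ℕ, k ≠ 0 → k < N + 2 → (k : ZMod (N + 2)) ≠ 0 := fun k h0 hk h ↦ by
    rw [ZMod.natCast_eq_zero_iff] at h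
    exact h0 (Nat.eq_zero_of_dvd_of_lt h hk)
  have zero : ∀ {j : ZMod (N + 2)}, j ≠ 0 → ∀ {y}, Shifts e j y → E y = 0 := fun hj _ hy ↦
    hy.apply_eq_zero hE hemem heorth heidem hesum hj
  have hC2 : 1 - C ^ 2 ∈ 𝒜 := sub_mem (one_mem _) (pow_mem hCm 2)
  have hC2σ : Commute (1 - C ^ 2) σ := (Commute.one_left σ).sub_left (hCσ.pow_left 2)
  -- Apart from `C`, the terms of `P` have degrees `1, …, N`, none divisible by `N + 2`.
  have hPE : E P = C := by
    rw [hP, map_add, hE.apply_of_mem _ hCm, Finset.mul_sum, map_sum, Finset.sum_eq_zero, add_zero]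
    intro j hj
    rw [mul_assoc, hE.mul_left hC2, zero (j := ((1 + j : ℕ) : ZMod (N + 2))), mul_zero]
    · exact hcast _ (by omega) (by have := Finset.mem_range.mp hj; omega)
    · simpa using s1.mul (sx' j)
  have hneg1 : (-1 : ZMod (N + 2)) ≠ 0 := by
    have := hcast 1 one_ne_zero (by omega)
    simpa using this
  -- Multiplication by `star σ` lowers degrees by one, so only the degree `1` term of `P` survives.
  -- `C` itself lands in degree `-1`.
  have hσP : E (star σ * P) = 1 - C ^ 2 := by
    have h0 : E (star σ * C) = 0 := by
      rw [hE.mul_right hCm, zero hneg1 sσ', zero_mul]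
    have h1 : star σ * ((1 - C ^ 2) * σ * ∑ j ∈ Finset.range N, x ^ j) =
        (1 - C ^ 2) * ∑ j ∈ Finset.range N, x ^ j := by
      rw [hC2σ.eq, ← mul_assoc, ← mul_assoc, hσ1, one_mul]
    rw [hP, mul_add, map_add, h0, zero_add, h1, hE.mul_left hC2, map_sum]
    rcases Nat.eq_zero_or_pos N with rfl | hN
    · -- here the two shifts `1` and `-1` agree and the sum is empty
      exfalso
      -- With `N = 0` the tail bound `δ` is at least `2`, which violates `hsmall`.
      have h2 : c ^ 0 = 1 := pow_zero c
      have h3 : 1 ≤ 1 / (1 - c) := by rw [le_div_iff₀ (by linarith)]; linarith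
      have h4 : 2 ≤ δ := by rw [hδ, h2, mul_one, le_div_iff₀ (by linarith)]; linarith
      have h5 : 1 ≤ κ ^ 2 * L := by nlinarith
      have h6 : 2 ≤ δ * L := by nlinarith
      have h7 : 4 ≤ ‖A - C * S‖ + 2 * (η + δ * L) := by linarith [norm_nonneg (A - C * S)]
      nlinarith
    rw [Finset.sum_eq_single_of_mem 0 (Finset.mem_range.mpr hN)]
    · rw [pow_zero, hE.apply_of_mem 1 (one_mem _), mul_one]
    · intro j hj hj0
      exact zero (hcast j hj0 (by have := Finset.mem_range.mp hj; omega)) (sx' j)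
  -- Here the degrees are `1, …, N + 1`. Avoiding wrap-around to degree `0` is the reason for using
  -- `N + 2` projections.
  have hσP' : ∀ b ∈ 𝒜, E (σ * b * P) = 0 := by
    intro b hb
    have h0 : E (σ * b * C) = 0 := by
      rw [mul_assoc, hE.mul_right (mul_mem hb hCm),
        zero (by simpa using hcast 1 one_ne_zero (by omega)) s1, zero_mul]
    rw [hP, mul_add, map_add, h0, zero_add, Finset.mul_sum, Finset.mul_sum, map_sum,
      Finset.sum_eq_zero]
    intro j hj
    refine zero (j := ((2 + j : ℕ) : ZMod (N + 2)))
      (hcast _ (by omega) (by have := Finset.mem_range.mp hj; omega)) ?_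
    have h := (s1.mul (s0 hb)).mul (((s0 hC2).mul s1).mul (sx' j))
    have hj2 : (1 + 0 + (0 + 1 + (j : ZMod (N + 2)))) = ((2 + j : ℕ) : ZMod (N + 2)) := by
      push_cast; ring
    rwa [hj2] at h
  have hPS : E (P * S) = C * S := by rw [hE.mul_right hSm, hPE]
  have hnear : ‖U * T - P * S‖ ≤ η + δ * L := by
    have : U * T - P * S = U * (T - S) + (U - P) * S := by noncomm_ring
    rw [this]
    refine (norm_add_le _ _).trans (add_le_add ?_ ?_)
    · refine (norm_mul_le _ _).trans ?_
      have := norm_le_one_of_mem_unitary hU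
      nlinarith [norm_nonneg (T - S)]
    · exact (norm_mul_le _ _).trans (by gcongr)
  have hκL : 1 ≤ κ * L := by nlinarith
  have hsm : 8 * κ * (η + δ * L) ≤ 1 := by
    have h1 : 0 ≤ η + δ * L := by positivity
    have h2 : 2 * (η + δ * L) * (512 * κ ^ 2 * L) ≤ 1 := by
      refine le_trans ?_ hsmall
      gcongr
      linarith [norm_nonneg (A - C * S)]
    have h3 : 8 * κ * (η + δ * L) * 1 ≤ 8 * κ * (η + δ * L) * (κ * L) := by gcongr
    have h4 : 0 ≤ κ * κ * L * (η + δ * L) := by positivity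
    nlinarith
  have hsolve : ∀ B ∈ 𝒜, ∃ h : R, IsSelfAdjoint h ∧ ‖h‖ ≤ 2 * κ * ‖B‖ ∧
      ‖E (Complex.I • h * (U * T)) - B‖ ≤ 1 / 2 * ‖B‖ := by
    intro B hB
    -- `D` inverts the factor `(1 - C²) S` produced by `hσP`. The correction has to be `i` times a
    -- self-adjoint element, hence the antisymmetrization `y - star y`; by `hσP'` the added term
    -- `star y` contributes nothing against `P * S`.
    set b := B * D with hb
    have hbm : b ∈ 𝒜 := mul_mem hB hDm
    set y := b * star σ with hy
    have hyn : ‖y‖ ≤ κ * ‖B‖ := by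
      have h1 := norm_le_one_of_mem_unitary (Unitary.star_mem hσ)
      calc ‖y‖ ≤ ‖B‖ * ‖D‖ * ‖star σ‖ := (norm_mul_le _ _).trans (by gcongr; exact norm_mul_le _ _)
        _ ≤ ‖B‖ * κ * 1 := by gcongr
        _ = _ := by ring
    have hIh : Complex.I • (-Complex.I • (y - star y)) = y - star y := by
      rw [smul_smul]; simp
    refine ⟨-Complex.I • (y - star y), ?_, ?_, ?_⟩
    · rw [isSelfAdjoint_iff]
      simp [star_smul, star_sub]
      rw [← neg_sub, smul_neg, ← sub_eq_zero]
      simp [smul_sub]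
    · rw [norm_smul]
      have := norm_sub_le y (star y)
      rw [norm_star] at this
      simp only [norm_neg, Complex.norm_I, one_mul]
      linarith
    · rw [hIh]
      have e1 : E (y * (P * S)) = B := by
        have : y * (P * S) = b * (star σ * P) * S := by rw [hy]; simp only [mul_assoc]
        rw [this, hE.bimodule _ hbm _ hSm, hσP, hb]
        calc B * D * (1 - C ^ 2) * S = B * (D * (1 - C ^ 2) * S) := by simp only [mul_assoc]
          _ = B := by rw [hD, mul_one]
      have e2 : E (star y * (P * S)) = 0 := by
        have : star y * (P * S) = σ * star b * P * S := by
          rw [hy, star_mul, star_star]; simp only [mul_assoc]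
        rw [this, hE.mul_right hSm, hσP' _ (star_mem hbm), zero_mul]
      have e3 : E ((y - star y) * (U * T)) - B = E ((y - star y) * (U * T - P * S)) := by
        rw [mul_sub, map_sub, sub_mul y (star y) (P * S), map_sub, e1, e2, sub_zero]
      rw [e3]
      refine (hE.norm_le _).trans ?_
      have h1 : ‖y - star y‖ ≤ 2 * κ * ‖B‖ := by
        have := norm_sub_le y (star y)
        rw [norm_star] at this
        linarith
      have h2 : ‖(y - star y) * (U * T - P * S)‖ ≤ 2 * κ * ‖B‖ * (η + δ * L) :=
        (norm_mul_le _ _).trans (by gcongr)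
      nlinarith [norm_nonneg B]
  have hUT : ‖U * T‖ ≤ L := by
    refine (norm_mul_le _ _).trans ?_
    have := norm_le_one_of_mem_unitary hU
    nlinarith [norm_nonneg T]
  -- With `K = 2κ` the Newton constant `128 K² L` becomes the `512 κ² L` of `hsmall`.
  obtain ⟨W, hW, hWE⟩ := exists_unitary_apply_mul_eq (G := U * T) (K := 2 * κ) hE.norm_le hE.mem hL
    (by linarith) hUT hsolve hA (by
      have h1 : ‖A - E (U * T)‖ ≤ ‖A - C * S‖ + 2 * (η + δ * L) := by
        have : A - E (U * T) = (A - C * S) - E (U * T - P * S) := by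
          rw [map_sub, hPS]; abel
        rw [this]
        refine (norm_sub_le _ _).trans ?_
        gcongr
        exact (hE.norm_le _).trans (by gcongr)
      refine le_trans ?_ hsmall
      rw [show (128 : ℝ) * (2 * κ) ^ 2 * L = 512 * κ ^ 2 * L by ring]
      gcongr)
  exact ⟨W * U, mul_mem hW hU, by rw [mul_assoc]; exact hWE⟩

end Shift

/-! ### Order, range projections and strong limits in a von Neumann algebra. -/

section VonNeumann

variable {H : Type*} [NormedAddCommGroup H] [InnerProductSpace ℂ H] [CompleteSpace H]
variable {M : VonNeumannAlgebra H}

/-- The order on `M` is inherited from the bounded operators, so a square root inside `M` needs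
nonnegativity of the spectrum taken in `M`. For self-adjoint elements this is a norm condition, and
the norm is the same in both algebras. -/
theorem exists_selfAdjoint_mul_self_eq {x : M.toStarSubalgebra} (hx : 0 ≤ x) :
    ∃ y : M.toStarSubalgebra, IsSelfAdjoint y ∧ y * y = x := by
  have hx' : (0 : H →L[ℂ] H) ≤ x := hx
  have hsa' : IsSelfAdjoint (x : H →L[ℂ] H) := IsSelfAdjoint.of_nonneg hx'
  have hsa : IsSelfAdjoint x := Subtype.ext hsa'
  have hr' : SpectrumRestricts (x : H →L[ℂ] H) ContinuousMap.realToNNReal :=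
    SpectrumRestricts.nnreal_of_nonneg hx'
  have hr : SpectrumRestricts x ContinuousMap.realToNNReal := by
    rw [SpectrumRestricts.nnreal_iff_nnnorm (t := ‖x‖₊) hsa le_rfl]
    exact (SpectrumRestricts.nnreal_iff_nnnorm (t := ‖x‖₊) hsa' le_rfl).mp hr'
  obtain ⟨y, h1, -, h3⟩ := CFC.exists_sqrt_of_isSelfAdjoint_of_quasispectrumRestricts hsa hr
  exact ⟨y, h1, h3⟩

/-- The square root inside `M` identifies the inherited positive cone with the elements `star s * s`
of `M`; this gives access to the order theory of C⋆-algebras. -/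
instance starOrderedRing (M : VonNeumannAlgebra H) : StarOrderedRing M.toStarSubalgebra := by
  refine StarOrderedRing.of_nonneg_iff' (fun {x y} h z ↦ ?_) fun x ↦ ⟨fun h ↦ ?_, ?_⟩
  · exact add_le_add_right (α := H →L[ℂ] H) h z
  · obtain ⟨y, h1, h2⟩ := exists_selfAdjoint_mul_self_eq h
    exact ⟨y, by rw [h1.star_eq, h2]⟩
  · rintro ⟨s, rfl⟩
    exact star_mul_self_nonneg (s : H →L[ℂ] H)

theorem le_iff_inner {x y : M.toStarSubalgebra} (hx : IsSelfAdjoint x) (hy : IsSelfAdjoint y) :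
    x ≤ y ↔ ∀ ξ : H, RCLike.re ⟪(x : H →L[ℂ] H) ξ, ξ⟫_ℂ ≤ RCLike.re ⟪(y : H →L[ℂ] H) ξ, ξ⟫_ℂ := by
  change (x : H →L[ℂ] H) ≤ y ↔ _
  have h : ((y : H →L[ℂ] H) - x).toLinearMap.IsSymmetric := by
    have : IsSelfAdjoint ((y : H →L[ℂ] H) - x) :=
      (show IsSelfAdjoint (y : H →L[ℂ] H) from congrArg Subtype.val hy).sub
        (show IsSelfAdjoint (x : H →L[ℂ] H) from congrArg Subtype.val hx)
    exact this.isSymmetric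
  rw [ContinuousLinearMap.le_def, ContinuousLinearMap.isPositive_def]
  simp only [h, true_and, ContinuousLinearMap.reApplyInnerSelf_apply,
    sub_apply, inner_sub_left, map_sub, sub_nonneg]

/-- The range projection of an element of a von Neumann algebra lies in the algebra. -/
theorem exists_range_projection (y : M.toStarSubalgebra) :
    ∃ q : M.toStarSubalgebra, IsStarProjection q ∧ q * y = y ∧
      ∀ z : M.toStarSubalgebra, z * y = 0 → z * q = 0 := by
  let K : Submodule ℂ H := (y : H →L[ℂ] H).range.topologicalClosure
  have hK : IsClosed (K : Set H) := Submodule.isClosed_topologicalClosure _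
  have : CompleteSpace K := hK.completeSpace_coe
  have hp : IsStarProjection K.starProjection := isStarProjection_starProjection
  -- Bicommutant criterion: a projection lies in `M` when its range is invariant under the
  -- commutant. Here the range is the closure of the range of `y`, which commutes with the
  -- commutant.
  have hmem : K.starProjection ∈ M := by
    rw [VonNeumannAlgebra.IsStarProjection.mem_iff hp]
    intro z hz
    rw [Submodule.range_starProjection, Module.End.mem_invtSubmodule]
    refine Submodule.topologicalClosure_minimal _ ?_ (hK.preimage z.continuous)
    rintro _ ⟨ξ, rfl⟩
    have hc := VonNeumannAlgebra.mem_commutant_iff.mp hz y y.2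
    change z ((y : H →L[ℂ] H) ξ) ∈ K
    have : z ((y : H →L[ℂ] H) ξ) = (y : H →L[ℂ] H) (z ξ) := congrArg (fun f : H →L[ℂ] H ↦ f ξ) hc.symm
    rw [this]
    exact Submodule.le_topologicalClosure _ ⟨_, rfl⟩
  refine ⟨⟨K.starProjection, hmem⟩, ⟨Subtype.ext hp.1, Subtype.ext hp.2⟩, ?_, fun z hz ↦ ?_⟩
  · ext ξ
    exact Submodule.starProjection_eq_self_iff.mpr (Submodule.le_topologicalClosure _ ⟨ξ, rfl⟩)
  · have hK0 : K ≤ (z : H →L[ℂ] H).ker := by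
      refine Submodule.topologicalClosure_minimal _ ?_ (z : H →L[ℂ] H).isClosed_ker
      rintro _ ⟨ξ, rfl⟩
      exact congrArg (fun f : M.toStarSubalgebra ↦ (f : H →L[ℂ] H) ξ) hz
    ext ξ
    exact hK0 (Submodule.starProjection_apply_mem K ξ)

/-- In a factor, two projections `p`, `q` with `q M p = 0` are not both non-zero. -/
theorem IsFactor.eq_zero_or_eq_zero (hM : IsFactor M) {p q : M.toStarSubalgebra}
    (h : ∀ x : M.toStarSubalgebra, q * x * p = 0) : p = 0 ∨ q = 0 := by
  let S : Submodule ℂ H := Submodule.span ℂ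
    {ζ : H | ∃ (x : M.toStarSubalgebra) (ξ : H), ζ = (x : H →L[ℂ] H) ((p : H →L[ℂ] H) ξ)}
  let K := S.topologicalClosure
  have hK : IsClosed (K : Set H) := Submodule.isClosed_topologicalClosure _
  have : CompleteSpace K := hK.completeSpace_coe
  have hp : IsStarProjection K.starProjection := isStarProjection_starProjection
  -- The closed span of `M p H` is invariant under both `M` and its commutant, so its projection is
  -- central, hence scalar. If `p ≠ 0` the scalar is `1`, and `q` vanishes on the whole space.
  have hinv : ∀ z : H →L[ℂ] H, (z ∈ M ∨ z ∈ M.commutant) →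
      K.starProjection.range ∈ Module.End.invtSubmodule z := by
    intro z hz
    rw [Submodule.range_starProjection, Module.End.mem_invtSubmodule]
    refine Submodule.topologicalClosure_minimal _ ?_ (hK.preimage z.continuous)
    rw [Submodule.span_le]
    rintro _ ⟨x, ξ, rfl⟩
    refine Submodule.le_topologicalClosure _ (Submodule.subset_span ?_)
    rcases hz with hz | hz
    · exact ⟨⟨z, hz⟩ * x, ξ, rfl⟩
    · refine ⟨x, z ξ, ?_⟩
      have h1 := congrArg (fun f : H →L[ℂ] H ↦ f ((p : H →L[ℂ] H) ξ))
        (VonNeumannAlgebra.mem_commutant_iff.mp hz x x.2)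
      have h2 := congrArg (fun f : H →L[ℂ] H ↦ f ξ)
        (VonNeumannAlgebra.mem_commutant_iff.mp hz p p.2)
      simp only [mul_apply_eq_comp] at h1 h2
      change z _ = _
      rw [← h1, h2]
  have hmem : K.starProjection ∈ M := by
    rw [VonNeumannAlgebra.IsStarProjection.mem_iff hp]
    exact fun z hz ↦ hinv z (Or.inr hz)
  have hmem' : K.starProjection ∈ M.commutant := by
    rw [VonNeumannAlgebra.IsStarProjection.mem_iff hp, M.commutant_commutant]
    exact fun z hz ↦ hinv z (Or.inl hz)
  have hpK : ∀ ξ, (p : H →L[ℂ] H) ξ ∈ K := fun ξ ↦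
    Submodule.le_topologicalClosure _ (Submodule.subset_span ⟨1, ξ, rfl⟩)
  obtain ⟨c, hc⟩ := hM.center_eq_scalars ⟨K.starProjection, hmem⟩ fun x ↦ Subtype.ext
    (VonNeumannAlgebra.mem_commutant_iff.mp hmem' x x.2).symm
  have hc' : ∀ ξ, K.starProjection ξ = c • ξ := fun ξ ↦
    congrArg (fun f : M.toStarSubalgebra ↦ (f : H →L[ℂ] H) ξ) hc
  by_cases hp0 : p = 0
  · exact Or.inl hp0
  right
  have : ∃ ξ, (p : H →L[ℂ] H) ξ ≠ 0 := by
    by_contra! hcon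
    exact hp0 (by ext ξ; exact hcon ξ)
  obtain ⟨ξ, hξ⟩ := this
  have hc1 : c = 1 := by
    have h1 := hc' ((p : H →L[ℂ] H) ξ)
    rw [Submodule.starProjection_eq_self_iff.mpr (hpK ξ)] at h1
    have h2 : (c - 1) • (p : H →L[ℂ] H) ξ = 0 := by rw [sub_smul, one_smul, ← h1, sub_self]
    rcases smul_eq_zero.mp h2 with h3 | h3
    · exact sub_eq_zero.mp h3
    · exact absurd h3 hξ
  have hKq : K ≤ (q : H →L[ℂ] H).ker := by
    refine Submodule.topologicalClosure_minimal _ ?_ (q : H →L[ℂ] H).isClosed_ker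
    rw [Submodule.span_le]
    rintro _ ⟨x, η, rfl⟩
    exact congrArg (fun f : M.toStarSubalgebra ↦ (f : H →L[ℂ] H) η) (h x)
  ext η
  refine hKq ?_
  have h1 := hc' η
  rw [hc1, one_smul] at h1
  exact Submodule.starProjection_eq_self_iff.mp h1

/-- A net of contractions in a von Neumann algebra which is monotone in a suitable sense converges
strongly to an element of the algebra. -/
theorem exists_strong_limit {ι : Type*} [Preorder ι] [IsDirectedOrder ι] [Nonempty ι]
    (x : ι → M.toStarSubalgebra) (hx : ∀ i ξ, ‖(x i : H →L[ℂ] H) ξ‖ ≤ ‖ξ‖)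
    (hmono : ∀ i j, i ≤ j → ∀ ξ, ‖(x j : H →L[ℂ] H) ξ - (x i : H →L[ℂ] H) ξ‖ ^ 2 ≤
      ‖(x j : H →L[ℂ] H) ξ‖ ^ 2 - ‖(x i : H →L[ℂ] H) ξ‖ ^ 2) :
    ∃ y : M.toStarSubalgebra, ∀ ξ, Filter.Tendsto (fun i ↦ (x i : H →L[ℂ] H) ξ) Filter.atTop
      (nhds ((y : H →L[ℂ] H) ξ)) := by
  have hlim : ∀ ξ, ∃ η, Filter.Tendsto (fun i ↦ (x i : H →L[ℂ] H) ξ) Filter.atTop (nhds η) := by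
    intro ξ
    have hm : Monotone fun i ↦ ‖(x i : H →L[ℂ] H) ξ‖ ^ 2 := fun i j hij ↦ by
      have := hmono i j hij ξ
      nlinarith [sq_nonneg ‖(x j : H →L[ℂ] H) ξ - (x i : H →L[ℂ] H) ξ‖]
    have hb : BddAbove (Set.range fun i ↦ ‖(x i : H →L[ℂ] H) ξ‖ ^ 2) := by
      refine ⟨‖ξ‖ ^ 2, ?_⟩
      rintro _ ⟨i, rfl⟩
      have := hx i ξ
      simp only
      gcongr
    have ht := tendsto_atTop_ciSup hm hb
    set s := ⨆ i, ‖(x i : H →L[ℂ] H) ξ‖ ^ 2 with hs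
    -- The squared norms increase to `s`, and `hmono` bounds squared distances by increments of
    -- these norms, so the net is Cauchy.
    refine cauchy_map_iff_exists_tendsto.mp ?_
    rw [Metric.cauchy_iff]
    refine ⟨inferInstance, fun ε hε ↦ ?_⟩
    have hε' : 0 < (ε / 3) ^ 2 := by positivity
    obtain ⟨i, hi⟩ := (ht.eventually (lt_mem_nhds (show s - (ε / 3) ^ 2 < s by linarith))).exists
    have hball : ∀ j, i ≤ j → dist ((x j : H →L[ℂ] H) ξ) ((x i : H →L[ℂ] H) ξ) < ε / 2 := by
      intro j hj
      have h1 := hmono i j hj ξ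
      have h2 : ‖(x j : H →L[ℂ] H) ξ‖ ^ 2 ≤ s := le_ciSup hb j
      rw [dist_eq_norm]
      have h3 : ‖(x j : H →L[ℂ] H) ξ - (x i : H →L[ℂ] H) ξ‖ ^ 2 ≤ (ε / 3) ^ 2 := by linarith
      have := (sq_le_sq₀ (norm_nonneg _) (by positivity)).mp h3
      linarith
    refine ⟨(fun j ↦ (x j : H →L[ℂ] H) ξ) '' Set.Ici i,
      Filter.image_mem_map (Filter.mem_atTop i), ?_⟩
    rintro _ ⟨j, hj, rfl⟩ _ ⟨k, hk, rfl⟩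
    have h1 := hball j hj
    have h2 := hball k hk
    rw [dist_comm] at h2
    exact (dist_triangle _ ((x i : H →L[ℂ] H) ξ) _).trans_lt (by linarith)
  choose f hf using hlim
  let F : H →ₗ[ℂ] H :=
    { toFun := f
      map_add' := fun ξ η ↦ tendsto_nhds_unique (hf (ξ + η)) (by
        simpa only [map_add] using (hf ξ).add (hf η))
      map_smul' := fun c ξ ↦ tendsto_nhds_unique (hf (c • ξ)) (by
        simpa only [map_smul, RingHom.id_apply] using (hf ξ).const_smul c) }
  let y : H →L[ℂ] H := F.mkContinuous 1 fun ξ ↦ by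
    rw [one_mul]
    exact le_of_tendsto (hf ξ).norm (Filter.Eventually.of_forall fun i ↦ hx i ξ)
  -- Commutation with the commutant passes to strong limits.
  have hy : y ∈ M := by
    rw [← M.commutant_commutant, VonNeumannAlgebra.mem_commutant_iff]
    intro z hz
    ext ξ
    have h1 : Filter.Tendsto (fun i ↦ z ((x i : H →L[ℂ] H) ξ)) Filter.atTop (nhds (z (f ξ))) :=
      (z.continuous.tendsto _).comp (hf ξ)
    have h2 : (fun i ↦ z ((x i : H →L[ℂ] H) ξ)) = fun i ↦ (x i : H →L[ℂ] H) (z ξ) := by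
      funext i
      exact congrArg (fun g : H →L[ℂ] H ↦ g ξ)
        (VonNeumannAlgebra.mem_commutant_iff.mp hz (x i) (x i).2).symm
    rw [h2] at h1
    exact tendsto_nhds_unique h1 (hf (z ξ))
  exact ⟨⟨y, hy⟩, hf⟩

end VonNeumann

/-! ### Partial isometries ordered by extension. -/

section Equivalence

variable {H : Type*} [NormedAddCommGroup H] [InnerProductSpace ℂ H] [CompleteSpace H]
variable {M : VonNeumannAlgebra H}

/-- `v` is a partial isometry. -/
def IsPartialIsometry (v : M.toStarSubalgebra) : Prop := v * star v * v = v

theorem isStarProjection_of_star_mul_self {v : M.toStarSubalgebra} (hv : IsPartialIsometry v) :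
    IsStarProjection (star v * v) :=
  ⟨by
    have h : v * star v * v = v := hv
    change star v * v * (star v * v) = star v * v
    rw [mul_assoc, ← mul_assoc v, h], .star_mul_self v⟩

theorem isStarProjection_of_mul_star_self {v : M.toStarSubalgebra} (hv : IsPartialIsometry v) :
    IsStarProjection (v * star v) :=
  ⟨by
    have h : v * star v * v = v := hv
    change v * star v * (v * star v) = v * star v
    rw [← mul_assoc, h], .mul_star_self v⟩

theorem norm_apply_le_of_isPartialIsometry {v : M.toStarSubalgebra} (hv : IsPartialIsometry v)
    (ξ : H) : ‖(v : H →L[ℂ] H) ξ‖ ≤ ‖ξ‖ := by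
  have hn : ‖v‖ ≤ 1 := by
    have h1 := (isStarProjection_of_star_mul_self hv).norm_le
    rw [CStarRing.norm_star_mul_self] at h1
    nlinarith [norm_nonneg v]
  have h2 := (v : H →L[ℂ] H).le_of_opNorm_le (show ‖(v : H →L[ℂ] H)‖ ≤ 1 from hn) ξ
  simpa using h2

theorem eq_zero_of_star_mul_self {x : M.toStarSubalgebra} (h : star x * x = 0) : x = 0 :=
  CStarRing.star_mul_self_eq_zero_iff x |>.mp h

/-- The initial projections of partial isometries increase along extension. -/
theorem star_mul_eq_of_extends {v w : M.toStarSubalgebra} (hv : IsPartialIsometry v)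
    (hw : IsPartialIsometry w) (h : w * (star v * v) = v) : star v * w = star v * v := by
  have he := isStarProjection_of_star_mul_self hv
  have hf := isStarProjection_of_star_mul_self hw
  set e := star v * v with hedef
  set f := star w * w with hfdef
  -- Together with idempotency this gives `(e - f e)* (e - f e) = 0`: the initial projection of `v`
  -- lies below that of `w`.
  have h1 : e * f * e = e := by
    calc e * f * e = star (w * e) * (w * e) := by
          rw [star_mul, he.isSelfAdjoint.star_eq]; simp only [hfdef, mul_assoc]
      _ = e := by rw [h]
  have hee : e * e = e := he.isIdempotentElem
  have hff : f * f = f := hf.isIdempotentElem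
  have h2 : e - f * e = 0 := by
    apply eq_zero_of_star_mul_self
    rw [star_sub, he.isSelfAdjoint.star_eq, star_mul, he.isSelfAdjoint.star_eq,
      hf.isSelfAdjoint.star_eq]
    have : (e - e * f) * (e - f * e) = e * e - e * f * e - e * f * e + e * (f * f) * e := by
      noncomm_ring
    rw [this, hff, h1, hee]; abel
  have h3 : f * e = e := (sub_eq_zero.mp h2).symm
  have h4 : star v * w = e * f := by
    conv_lhs => rw [← h]
    rw [star_mul, he.isSelfAdjoint.star_eq, mul_assoc]
  have h5 := congrArg star h3
  rw [star_mul, he.isSelfAdjoint.star_eq, hf.isSelfAdjoint.star_eq] at h5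
  rw [h4, h5]

/-- Pythagoras: `star v * w = star v * v` makes `wξ - vξ` orthogonal to `vξ`. This is the
monotonicity that `exists_strong_limit` asks for. -/
theorem norm_sub_sq_le_of_extends {v w : M.toStarSubalgebra} (hv : IsPartialIsometry v)
    (hw : IsPartialIsometry w) (h : w * (star v * v) = v) (ξ : H) :
    ‖(w : H →L[ℂ] H) ξ - (v : H →L[ℂ] H) ξ‖ ^ 2 ≤
      ‖(w : H →L[ℂ] H) ξ‖ ^ 2 - ‖(v : H →L[ℂ] H) ξ‖ ^ 2 := by
  have h1 := star_mul_eq_of_extends hv hw h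
  have h2 : ⟪(v : H →L[ℂ] H) ξ, (w : H →L[ℂ] H) ξ⟫_ℂ = ⟪(v : H →L[ℂ] H) ξ, (v : H →L[ℂ] H) ξ⟫_ℂ := by
    rw [← ContinuousLinearMap.adjoint_inner_right, ← ContinuousLinearMap.adjoint_inner_right]
    exact congrArg (fun f : M.toStarSubalgebra ↦ ⟪ξ, (f : H →L[ℂ] H) ξ⟫_ℂ) h1
  rw [← norm_neg, neg_sub, @norm_sub_sq ℂ, h2, inner_self_eq_norm_sq]
  linarith

theorem extends_trans {u v w : M.toStarSubalgebra} (hu : IsPartialIsometry u)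
    (hv : IsPartialIsometry v) (huv : v * (star u * u) = u) (hvw : w * (star v * v) = v) :
    w * (star u * u) = u := by
  have h1 := congrArg star (star_mul_eq_of_extends hu hv huv)
  simp only [star_mul, star_star] at h1
  calc w * (star u * u) = w * (star v * (v * (star u * u))) := by rw [huv, h1]
    _ = (w * (star v * v)) * (star u * u) := by simp only [mul_assoc]
    _ = u := by rw [hvw, huv]

theorem apply_congr {x y : M.toStarSubalgebra} (h : x = y) (ξ : H) :
    (x : H →L[ℂ] H) ξ = (y : H →L[ℂ] H) ξ := by rw [h]

/-- Partial isometries of `M` from a subprojection of `p` to a subprojection of `q`. -/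
structure PartialIsometryBetween (p q : M.toStarSubalgebra) where
  val : M.toStarSubalgebra
  isPartialIsometry : IsPartialIsometry val
  mul_left : q * val = val
  mul_right : val * p = val

/-- Partial isometries are ordered by extension. -/
instance (p q : M.toStarSubalgebra) : Preorder (PartialIsometryBetween p q) where
  le v w := w.val * (star v.val * v.val) = v.val
  le_refl v := by
    have h : v.val * star v.val * v.val = v.val := v.isPartialIsometry
    rw [← mul_assoc, h]
  le_trans u v _ := extends_trans u.isPartialIsometry v.isPartialIsometry

/-- The upper bound is the strong limit `y` of the chain. The initial projections converge strongly
to some `z`; comparing inner products gives `star y * y = z`, and `y * z = y` then makes `y` a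
partial isometry. This is the input for Zorn's lemma. -/
theorem bddAbove_of_isChain {p q : M.toStarSubalgebra} (c : Set (PartialIsometryBetween p q))
    (hchain : IsChain (· ≤ ·) c) (hne : c.Nonempty) : BddAbove c := by
  have : Nonempty c := hne.to_subtype
  have : IsDirectedOrder c := ⟨fun v w ↦ by
    rcases hchain.total v.2 w.2 with h | h
    · exact ⟨w, h, le_rfl⟩
    · exact ⟨v, le_rfl, h⟩⟩
  have hle : ∀ {v w : c}, v ≤ w → w.1.val * (star v.1.val * v.1.val) = v.1.val := fun h ↦ h
  have hc : ∀ v : c, IsPartialIsometry v.1.val := fun v ↦ v.1.isPartialIsometry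
  obtain ⟨y, hy⟩ := exists_strong_limit (fun v : c ↦ v.1.val)
    (fun v ξ ↦ norm_apply_le_of_isPartialIsometry (hc v) ξ)
    (fun v w h ξ ↦ norm_sub_sq_le_of_extends (hc v) (hc w) (hle h) ξ)
  have hpe : ∀ v : c, IsPartialIsometry (star v.1.val * v.1.val) := fun v ↦ by
    have h := isStarProjection_of_star_mul_self (hc v)
    change _ * star _ * _ = _
    rw [h.isSelfAdjoint.star_eq, h.isIdempotentElem.eq, h.isIdempotentElem.eq]
  obtain ⟨z, hz⟩ := exists_strong_limit
    (fun v : c ↦ star v.1.val * v.1.val)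
    (fun v ξ ↦ norm_apply_le_of_isPartialIsometry (hpe v) ξ)
    (fun v w h ξ ↦ norm_sub_sq_le_of_extends (hpe v) (hpe w) (by
      have h0 := isStarProjection_of_star_mul_self (hc v)
      rw [h0.isSelfAdjoint.star_eq, h0.isIdempotentElem.eq, mul_assoc, hle h]
      have h1 := congrArg star (star_mul_eq_of_extends (hc v) (hc w) (hle h))
      simpa only [star_mul, star_star] using h1) ξ)
  have hyv : ∀ v : c, y * (star v.1.val * v.1.val) = v.1.val := by
    intro v
    ext ξ
    refine tendsto_nhds_unique (hy (((star v.1.val * v.1.val : M.toStarSubalgebra) : H →L[ℂ] H) ξ)) ?_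
    refine tendsto_const_nhds.congr' ?_
    filter_upwards [Filter.eventually_ge_atTop v] with w hw
    exact (apply_congr (hle hw) ξ).symm
  have hyz : y * z = y := by
    ext ξ
    have h1 := ((y : H →L[ℂ] H).continuous.tendsto _).comp (hz ξ)
    refine tendsto_nhds_unique h1 ((hy ξ).congr fun v ↦ ?_)
    exact (apply_congr (hyv v) ξ).symm
  have hyy : star y * y = z := by
    ext ξ
    refine ext_inner_right ℂ fun η ↦ ?_
    have h1 : ⟪((star y * y : M.toStarSubalgebra) : H →L[ℂ] H) ξ, η⟫_ℂ =
        ⟪(y : H →L[ℂ] H) ξ, (y : H →L[ℂ] H) η⟫_ℂ :=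
      ContinuousLinearMap.adjoint_inner_left (y : H →L[ℂ] H) η ((y : H →L[ℂ] H) ξ)
    rw [h1]
    refine tendsto_nhds_unique ((hy ξ).inner (hy η)) (((hz ξ).inner tendsto_const_nhds).congr
      fun v ↦ ?_)
    exact ContinuousLinearMap.adjoint_inner_left (v.1.val : H →L[ℂ] H) η ((v.1.val : H →L[ℂ] H) ξ)
  refine ⟨⟨y, ?_, ?_, ?_⟩, fun v hv ↦ hyv ⟨v, hv⟩⟩
  · change y * star y * y = y
    rw [mul_assoc, hyy, hyz]
  · ext ξ
    have h1 := ((q : H →L[ℂ] H).continuous.tendsto _).comp (hy ξ)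
    exact tendsto_nhds_unique h1 ((hy ξ).congr fun v ↦ (apply_congr v.1.mul_left ξ).symm)
  · ext ξ
    exact tendsto_nhds_unique (hy ((p : H →L[ℂ] H) ξ))
      ((hy ξ).congr fun v ↦ (apply_congr v.1.mul_right ξ).symm)

/-- A non-zero element of a von Neumann algebra dominates a non-zero partial isometry. -/
theorem exists_partialIsometry {y : M.toStarSubalgebra} (hy : y ≠ 0) :
    ∃ v : M.toStarSubalgebra, IsPartialIsometry v ∧ v ≠ 0 ∧ (∀ q, q * y = y → q * v = v) ∧
      ∀ p, IsStarProjection p → y * p = y → v * p = v := by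
  set a := star y * y with ha
  have hsa : IsSelfAdjoint a := .star_mul_self y
  have ha0 : a ≠ 0 := fun h ↦ hy (eq_zero_of_star_mul_self h)
  -- A truncated polar decomposition: half the norm is a cutoff for which `h = (a - c)⁺` is nonzero.
  -- On the range projection `f` of `h`, `g = max(a, c)^(-1/2)` acts as `a^(-1/2)` and is continuous
  -- in `a`, so `v = y g f` satisfies `star v * v = f`.
  set c := ‖a‖ / 2 with hc
  have hc0 : 0 < c := by have := norm_pos_iff.mpr ha0; positivity
  have hnn : ∀ t ∈ spectrum ℝ a, 0 ≤ t := fun t ht ↦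
    spectrum_nonneg_of_nonneg (star_mul_self_nonneg y) ht
  have hmaxc : ∀ t : ℝ, max t c ≠ 0 := fun t ↦ (hc0.trans_le (le_max_right t c)).ne'
  have hgc : Continuous fun t : ℝ ↦ (Real.sqrt (max t c))⁻¹ := by
    refine Continuous.inv₀ (by fun_prop) fun t ↦ ?_
    exact (Real.sqrt_pos.mpr (hc0.trans_le (le_max_right t c))).ne'
  set h := cfc (fun t : ℝ ↦ max (t - c) 0) a with hh
  set g := cfc (fun t : ℝ ↦ (Real.sqrt (max t c))⁻¹) a with hg
  have hgsa : IsSelfAdjoint g := cfc_predicate _ a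
  have h0 : h ≠ 0 := by
    intro h0
    have h1 : ∀ t ∈ spectrum ℝ a, max (t - c) 0 = 0 := by
      intro t ht
      have hz : cfc (fun t : ℝ ↦ max (t - c) 0) a = cfc (fun _ : ℝ ↦ (0 : ℝ)) a := by
        rw [cfc_const_zero]; exact h0
      exact (cfc_eq_cfc_iff_eqOn (R := ℝ) (a := a) (f := fun t : ℝ ↦ max (t - c) 0)
        (g := fun _ ↦ 0)).mp hz ht
    have h2 : ‖a‖ ≤ c := by
      rw [← cfc_id ℝ a]
      refine norm_cfc_le hc0.le fun t ht ↦ ?_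
      have h3 := h1 t ht
      have h4 := le_max_left (t - c) 0
      rw [id, Real.norm_eq_abs, abs_of_nonneg (hnn t ht)]
      linarith
    linarith
  obtain ⟨f, hf, hfh, hfz⟩ := exists_range_projection h
  have hgag : (1 - g * a * g) * h = 0 := by
    have e1 : g * a * g = cfc (fun t : ℝ ↦ (Real.sqrt (max t c))⁻¹ * t * (Real.sqrt (max t c))⁻¹) a := by
      rw [cfc_mul (fun t : ℝ ↦ (Real.sqrt (max t c))⁻¹ * t) _ a
        (hgc.mul continuous_id).continuousOn hgc.continuousOn,
        cfc_mul _ (fun t : ℝ ↦ t) a hgc.continuousOn (by fun_prop), cfc_id' ℝ a]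
    have e2 : (1 : M.toStarSubalgebra) = cfc (fun _ : ℝ ↦ (1 : ℝ)) a := (cfc_const_one ℝ a).symm
    have hgc2 : Continuous fun t : ℝ ↦ (Real.sqrt (max t c))⁻¹ * t * (Real.sqrt (max t c))⁻¹ :=
      (hgc.mul continuous_id).mul hgc
    rw [e1, e2, ← cfc_sub _ _ a continuousOn_const hgc2.continuousOn, hh,
      ← cfc_mul (fun t : ℝ ↦ 1 - (Real.sqrt (max t c))⁻¹ * t * (Real.sqrt (max t c))⁻¹) _ a
        (continuousOn_const.sub hgc2.continuousOn) (by fun_prop), ← cfc_const_zero ℝ a]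
    congr 1
    funext t
    rcases le_total t c with ht | ht
    · rw [max_eq_right (by linarith : t - c ≤ 0), mul_zero]
    · have h1 : Real.sqrt t * Real.sqrt t = t := Real.mul_self_sqrt (by linarith)
      have h2 : Real.sqrt t ≠ 0 := (Real.sqrt_pos.mpr (by linarith)).ne'
      rw [max_eq_left ht]
      have h3 : (Real.sqrt t)⁻¹ * t * (Real.sqrt t)⁻¹ = 1 := by
        field_simp
        rw [sq, h1]
      rw [h3, sub_self, zero_mul]
  have hgf : g * a * g * f = f := by
    have := hfz _ hgag
    rw [sub_mul, one_mul, sub_eq_zero] at this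
    exact this.symm
  set v := y * g * f with hv
  have hvv : star v * v = f := by
    calc star v * v = f * (g * a * g * f) := by
          rw [hv, star_mul, star_mul, hf.isSelfAdjoint.star_eq, hgsa.star_eq, ha]
          simp only [mul_assoc]
      _ = f := by rw [hgf, hf.isIdempotentElem]
  have hff : f * f = f := hf.isIdempotentElem
  refine ⟨v, ?_, ?_, fun q hq ↦ ?_, fun p hp hyp ↦ ?_⟩
  · change v * star v * v = v
    rw [mul_assoc, hvv, hv, mul_assoc, hff]
  · intro hv0
    rw [hv0, mul_zero] at hvv
    rw [← hvv, zero_mul] at hfh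
    exact h0 hfh.symm
  · rw [hv, ← mul_assoc, ← mul_assoc, hq]
  · have hap : (1 - p) * a = 0 := by
      have h1 : a * p = a := by rw [ha, mul_assoc, hyp]
      have h2 := congrArg star h1
      rw [star_mul, hsa.star_eq, hp.isSelfAdjoint.star_eq] at h2
      rw [sub_mul, one_mul, h2, sub_self]
    -- `h` is a multiple of `a`, so a projection `p` supporting `a` also supports `h`, and with it
    -- the range projection `f`.
    have hk : h = a * cfc (fun t : ℝ ↦ max (t - c) 0 * (max t c)⁻¹) a := by
      have hcont : Continuous fun t : ℝ ↦ max (t - c) 0 * (max t c)⁻¹ :=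
        Continuous.mul (by fun_prop) (Continuous.inv₀ (by fun_prop) hmaxc)
      have h1 := cfc_mul (fun t : ℝ ↦ t) _ a (by fun_prop) hcont.continuousOn
      rw [cfc_id' ℝ a] at h1
      rw [← h1, hh]
      congr 1
      funext t
      rcases le_total t c with ht | ht
      · rw [max_eq_right (by linarith : t - c ≤ 0), zero_mul, mul_zero]
      · rw [max_eq_left ht]
        have : t ≠ 0 := by linarith
        field_simp
    have h1 : (1 - p) * f = 0 := hfz _ (by rw [hk, ← mul_assoc, hap, zero_mul])
    have h2 : p * f = f := by
      rw [sub_mul, one_mul, sub_eq_zero] at h1; exact h1.symm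
    have h3 := congrArg star h2
    rw [star_mul, hf.isSelfAdjoint.star_eq, hp.isSelfAdjoint.star_eq] at h3
    rw [hv, mul_assoc, h3]

end Equivalence

/-! ### Comparison of projections by the trace. -/

section Trace

variable {H : Type*} [NormedAddCommGroup H] [InnerProductSpace ℂ H] [CompleteSpace H]
variable {M : VonNeumannAlgebra H} {τ : M.toStarSubalgebra →ₗ[ℂ] ℂ}

namespace IsFaithfulNormalTrace

variable (hτ : IsFaithfulNormalTrace M τ)

include hτ

theorem nonneg_of_nonneg {x : M.toStarSubalgebra} (hx : 0 ≤ x) : 0 ≤ τ x := by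
  obtain ⟨y, h1, h2⟩ := exists_selfAdjoint_mul_self_eq hx
  rw [← h2]
  nth_rewrite 1 [← h1.star_eq]
  exact hτ.nonneg y

theorem re_nonneg {x : M.toStarSubalgebra} (hx : 0 ≤ x) : 0 ≤ (τ x).re :=
  (Complex.nonneg_iff.mp (hτ.nonneg_of_nonneg hx)).1

theorem re_mono {x y : M.toStarSubalgebra} (h : x ≤ y) : (τ x).re ≤ (τ y).re := by
  have := hτ.re_nonneg (sub_nonneg.mpr h)
  rw [map_sub, Complex.sub_re] at this
  linarith

theorem im_eq_zero {x : M.toStarSubalgebra} (hx : 0 ≤ x) : (τ x).im = 0 :=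
  (Complex.nonneg_iff.mp (hτ.nonneg_of_nonneg hx)).2.symm

theorem eq_zero_of_projection {p : M.toStarSubalgebra} (hp : IsStarProjection p)
    (h : (τ p).re = 0) : p = 0 := by
  refine hτ.faithful p ?_
  rw [hp.isSelfAdjoint.star_eq, hp.isIdempotentElem]
  exact Complex.ext h (hτ.im_eq_zero hp.nonneg)

theorem eq_of_le_of_re_eq {p q : M.toStarSubalgebra} (hp : IsStarProjection p)
    (hq : IsStarProjection q) (hpq : p ≤ q) (h : (τ p).re = (τ q).re) : p = q := by
  have h1 : IsStarProjection (q - p) := ((IsStarProjection.le_tfae hp hq).out 0 3).mp hpq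
  have h2 := hτ.eq_zero_of_projection h1 (by rw [map_sub, Complex.sub_re, h, sub_self])
  exact (sub_eq_zero.mp h2).symm

end IsFaithfulNormalTrace

/-- Projections of a factor with the same trace are Murray–von Neumann equivalent. -/
theorem exists_equiv_of_trace_eq (hM : IsFactor M) (hτ : IsFaithfulNormalTrace M τ)
    {p q : M.toStarSubalgebra} (hp : IsStarProjection p) (hq : IsStarProjection q)
    (hpq : (τ p).re = (τ q).re) :
    ∃ v : M.toStarSubalgebra, star v * v = p ∧ v * star v = q := by
  have : Nonempty (PartialIsometryBetween p q) := ⟨⟨0, by simp [IsPartialIsometry], by simp, by simp⟩⟩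
  -- Take a maximal partial isometry from below `p` to below `q`; the defects `p'` and `q'` have
  -- equal trace and must be shown to vanish.
  obtain ⟨v, hv⟩ := zorn_le_nonempty (α := PartialIsometryBetween p q) bddAbove_of_isChain
  set x := v.val with hx
  have hpi : x * star x * x = x := v.isPartialIsometry
  have hxp : x * p = x := v.mul_right
  have hqx : q * x = x := v.mul_left
  have hpx : p * star x = star x := by
    have := congrArg star hxp
    rwa [star_mul, hp.isSelfAdjoint.star_eq] at this
  have hxq : star x * q = star x := by
    have := congrArg star hqx
    rwa [star_mul, hq.isSelfAdjoint.star_eq] at this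
  have he := isStarProjection_of_star_mul_self v.isPartialIsometry
  have hf := isStarProjection_of_mul_star_self v.isPartialIsometry
  rw [← hx] at he hf
  have hp' : IsStarProjection (p - star x * x) := he.sub_of_mul_eq_right hp (by
    rw [← mul_assoc, hpx])
  have hq' : IsStarProjection (q - x * star x) := hf.sub_of_mul_eq_right hq (by
    rw [← mul_assoc, hqx])
  set p' := p - star x * x with hpdef
  set q' := q - x * star x with hqdef
  have htr : (τ p').re = (τ q').re := by
    rw [hpdef, hqdef, map_sub, map_sub, Complex.sub_re, Complex.sub_re, hpq, hτ.mul_comm]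
  have hxp' : x * p' = 0 := by rw [hpdef, mul_sub, hxp, ← mul_assoc, hpi, sub_self]
  have hq'x : q' * x = 0 := by rw [hqdef, sub_mul, hqx, hpi, sub_self]
  have hp'x : p' * star x = 0 := by
    have := congrArg star hxp'
    rwa [star_mul, hp'.isSelfAdjoint.star_eq, star_zero] at this
  have hxq' : star x * q' = 0 := by
    have := congrArg star hq'x
    rwa [star_mul, hq'.isSelfAdjoint.star_eq, star_zero] at this
  have hpp' : p' * p = p' := by
    rw [hpdef, sub_mul, hp.isIdempotentElem, mul_assoc, hxp]
  have hqq' : q * q' = q' := by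
    rw [hqdef, mul_sub, hq.isIdempotentElem, ← mul_assoc, hqx]
  -- If `q' M p' = 0`, factoriality kills one defect and faithfulness of the trace the other.
  -- Otherwise a nonzero partial isometry `u` between the defects extends `x` to `x + u`.
  by_cases hall : ∀ y : M.toStarSubalgebra, q' * y * p' = 0
  · have hz : p' = 0 ∧ q' = 0 := by
      rcases hM.eq_zero_or_eq_zero hall with h | h
      · exact ⟨h, hτ.eq_zero_of_projection hq' (by rw [← htr, h, map_zero, Complex.zero_re])⟩
      · exact ⟨hτ.eq_zero_of_projection hp' (by rw [htr, h, map_zero, Complex.zero_re]), h⟩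
    exact ⟨x, (sub_eq_zero.mp hz.1).symm, (sub_eq_zero.mp hz.2).symm⟩
  · exfalso
    push Not at hall
    obtain ⟨y, hy⟩ := hall
    obtain ⟨u, hu, hu0, hul, hur⟩ := exists_partialIsometry hy
    have hq'u : q' * u = u := hul q' (by
      rw [← mul_assoc, ← mul_assoc, hq'.isIdempotentElem])
    have hup' : u * p' = u := hur p' hp' (by rw [mul_assoc, hp'.isIdempotentElem])
    have hpu : p' * star u = star u := by
      have := congrArg star hup'
      rwa [star_mul, hp'.isSelfAdjoint.star_eq] at this
    have huq : star u * q' = star u := by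
      have := congrArg star hq'u
      rwa [star_mul, hq'.isSelfAdjoint.star_eq] at this
    have h1 : star x * u = 0 := by rw [← hq'u, ← mul_assoc, hxq', zero_mul]
    have h2 : star u * x = 0 := by rw [← huq, mul_assoc, hq'x, mul_zero]
    have h3 : u * star x = 0 := by rw [← hup', mul_assoc, hp'x, mul_zero]
    have h4 : x * star u = 0 := by rw [← hpu, ← mul_assoc, hxp', zero_mul]
    have hu' : u * star u * u = u := hu
    have hw1 : (x + u) * star (x + u) * (x + u) = x + u := by
      have : (x + u) * (star x + star u) * (x + u) = x * star x * x + x * (star x * u)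
          + (x * star u) * (x + u) + (u * star x) * (x + u) + u * (star u * x)
          + u * star u * u := by noncomm_ring
      rw [star_add, this, h1, h2, h3, h4, hpi, hu']
      simp
    obtain ⟨w, hw⟩ : ∃ w : PartialIsometryBetween p q, w.val = x + u :=
      ⟨⟨x + u, hw1, by rw [mul_add, hqx, ← hq'u, ← mul_assoc, hqq'],
        by rw [add_mul, hxp, ← hup', mul_assoc, hpp']⟩, rfl⟩
    have hvw : v ≤ w := by
      change w.val * (star x * x) = x
      rw [hw, add_mul, ← mul_assoc, hpi, ← mul_assoc, h3, zero_mul, add_zero]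
    -- Maximality in a preorder only gives that `v` extends `w`; by orthogonality this reads `x = x
    -- + u`, contradicting `u ≠ 0`.
    have hwv : x * (star w.val * w.val) = w.val := hv hvw
    rw [hw] at hwv
    have h5 : x * (star (x + u) * (x + u)) = x := by
      have : x * ((star x + star u) * (x + u)) = x * star x * x + x * (star x * u)
          + (x * star u) * (x + u) := by noncomm_ring
      rw [star_add, this, h1, h4, hpi]
      simp
    rw [h5] at hwv
    exact hu0 (by simpa using hwv)

/-- Two finite partitions of unity by projections with the same traces are unitarily conjugate. -/
theorem exists_unitary_intertwining (hM : IsFactor M) (hτ : IsFaithfulNormalTrace M τ)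
    {ι : Type*} [Fintype ι] {x y : ι → M.toStarSubalgebra}
    (hx : ∀ i, IsStarProjection (x i)) (hy : ∀ i, IsStarProjection (y i))
    (hxo : ∀ i j, i ≠ j → x i * x j = 0) (hyo : ∀ i j, i ≠ j → y i * y j = 0)
    (hxs : ∑ i, x i = 1) (hys : ∑ i, y i = 1) (hxy : ∀ i, (τ (x i)).re = (τ (y i)).re) :
    ∃ V ∈ unitary M.toStarSubalgebra, ∀ i, V * x i = y i * V := by
  classical
  choose v hv1 hv2 using fun i ↦ exists_equiv_of_trace_eq hM hτ (hx i) (hy i) (hxy i)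
  have hvx : ∀ i, v i * x i = v i := fun i ↦ by
    rw [← sub_eq_zero]
    refine eq_zero_of_star_mul_self ?_
    have : star (v i * x i - v i) * (v i * x i - v i) =
        x i * (star (v i) * v i) * x i - x i * (star (v i) * v i) - (star (v i) * v i) * x i
          + star (v i) * v i := by
      rw [star_sub, star_mul, (hx i).isSelfAdjoint.star_eq]; noncomm_ring
    rw [this, hv1, (hx i).isIdempotentElem, (hx i).isIdempotentElem]
    abel
  have hyv : ∀ i, y i * v i = v i := fun i ↦ by
    rw [← hv2, mul_assoc, hv1, hvx]
  have hxv : ∀ i, x i * star (v i) = star (v i) := fun i ↦ by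
    have := congrArg star (hvx i)
    rwa [star_mul, (hx i).isSelfAdjoint.star_eq] at this
  have hvy : ∀ i, star (v i) * y i = star (v i) := fun i ↦ by
    have := congrArg star (hyv i)
    rwa [star_mul, (hy i).isSelfAdjoint.star_eq] at this
  have o1 : ∀ i j, i ≠ j → star (v i) * v j = 0 := fun i j hij ↦ by
    rw [← hvy, ← hyv j, mul_assoc, ← mul_assoc (y i), hyo i j hij, zero_mul, mul_zero]
  have o2 : ∀ i j, i ≠ j → v i * star (v j) = 0 := fun i j hij ↦ by
    rw [← hvx, ← hxv j, mul_assoc, ← mul_assoc (x i), hxo i j hij, zero_mul, mul_zero]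
  refine ⟨∑ i, v i, Unitary.mem_iff.mpr ⟨?_, ?_⟩, fun i ↦ ?_⟩
  · rw [star_sum, Finset.sum_mul, ← hxs]
    refine Finset.sum_congr rfl fun i _ ↦ ?_
    rw [Finset.mul_sum, Finset.sum_eq_single i (fun j _ hj ↦ o1 i j hj.symm) (by simp), hv1]
  · rw [star_sum, Finset.sum_mul, ← hys]
    refine Finset.sum_congr rfl fun i _ ↦ ?_
    rw [Finset.mul_sum, Finset.sum_eq_single i (fun j _ hj ↦ o2 i j hj.symm) (by simp), hv2]
  · rw [Finset.sum_mul, Finset.mul_sum, Finset.sum_eq_single i, Finset.sum_eq_single i, hvx, hyv]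
    · intro j _ hj
      rw [← hyv j, ← mul_assoc, hyo i j hj.symm, zero_mul]
    · simp
    · intro j _ hj
      rw [← hvx j, mul_assoc, hxo j i hj, mul_zero]
    · simp

/-- A chain of projections of a von Neumann algebra has a supremum, which is again a projection. -/
theorem exists_isLUB_projections {c : Set M.toStarSubalgebra} (hc : ∀ p ∈ c, IsStarProjection p)
    (hchain : IsChain (· ≤ ·) c) (hne : c.Nonempty) :
    ∃ P : M.toStarSubalgebra, IsStarProjection P ∧ IsLUB c P ∧
      ∀ z : M.toStarSubalgebra, (∀ p ∈ c, z * p = p * z) → z * P = P * z := by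
  have : Nonempty c := hne.to_subtype
  have : IsDirectedOrder c := ⟨fun v w ↦ by
    rcases hchain.total v.2 w.2 with h | h
    · exact ⟨w, h, le_rfl⟩
    · exact ⟨v, le_rfl, h⟩⟩
  have hpi : ∀ p : c, IsPartialIsometry p.1 := fun p ↦ by
    have h := hc p p.2
    change _ * star _ * _ = _
    rw [h.isSelfAdjoint.star_eq, h.isIdempotentElem.eq, h.isIdempotentElem.eq]
  have hmul : ∀ p q : c, p ≤ q → q.1 * p.1 = p.1 := fun p q h ↦
    ((IsStarProjection.le_tfae (hc p p.2) (hc q q.2)).out 0 1).mp h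
  obtain ⟨P, hP⟩ := exists_strong_limit (fun p : c ↦ p.1)
    (fun p ξ ↦ norm_apply_le_of_isPartialIsometry (hpi p) ξ)
    (fun p q h ξ ↦ norm_sub_sq_le_of_extends (hpi p) (hpi q) (by
      rw [(hc p p.2).isSelfAdjoint.star_eq, (hc p p.2).isIdempotentElem.eq, hmul p q h]) ξ)
  have hPp : ∀ p : c, P * p.1 = p.1 := fun p ↦ by
    ext ξ
    refine tendsto_nhds_unique (hP ((p.1 : H →L[ℂ] H) ξ)) (tendsto_const_nhds.congr' ?_)
    filter_upwards [Filter.eventually_ge_atTop p] with q hq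
    exact (apply_congr (hmul p q hq) ξ).symm
  have hPP : P * P = P := by
    ext ξ
    have h1 := ((P : H →L[ℂ] H).continuous.tendsto _).comp (hP ξ)
    exact tendsto_nhds_unique h1 ((hP ξ).congr fun p ↦ (apply_congr (hPp p) ξ).symm)
  have hPs : star P = P := by
    ext ξ
    refine ext_inner_right ℂ fun η ↦ ?_
    have h1 : ⟪((star P : M.toStarSubalgebra) : H →L[ℂ] H) ξ, η⟫_ℂ = ⟪ξ, (P : H →L[ℂ] H) η⟫_ℂ :=
      ContinuousLinearMap.adjoint_inner_left (P : H →L[ℂ] H) η ξ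
    rw [h1]
    refine tendsto_nhds_unique (tendsto_const_nhds.inner (hP η))
      (((hP ξ).inner tendsto_const_nhds).congr fun p ↦ ?_)
    have h2 : ContinuousLinearMap.adjoint (p.1 : H →L[ℂ] H) = p.1 :=
      congrArg Subtype.val (hc p p.2).isSelfAdjoint
    rw [← ContinuousLinearMap.adjoint_inner_left, h2]
  have hproj : IsStarProjection P := ⟨hPP, hPs⟩
  refine ⟨P, hproj, ⟨fun p hp ↦ ?_, fun u hu ↦ ?_⟩, fun z hz ↦ ?_⟩
  · exact ((IsStarProjection.le_tfae (hc p hp) hproj).out 0 1).mpr (hPp ⟨p, hp⟩)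
  · obtain ⟨p₀, hp₀⟩ := hne
    have husa : IsSelfAdjoint u := .of_nonneg ((hc p₀ hp₀).nonneg.trans (hu hp₀))
    -- Order is tested on vectors, so an upper bound of the chain also bounds its strong limit.
    rw [le_iff_inner hproj.isSelfAdjoint husa]
    intro ξ
    have h1 : Filter.Tendsto (fun p : c ↦ RCLike.re ⟪(p.1 : H →L[ℂ] H) ξ, ξ⟫_ℂ) Filter.atTop
        (nhds (RCLike.re ⟪(P : H →L[ℂ] H) ξ, ξ⟫_ℂ)) :=
      (RCLike.continuous_re.tendsto _).comp ((hP ξ).inner tendsto_const_nhds)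
    exact le_of_tendsto' h1 fun p ↦
      (le_iff_inner (hc p p.2).isSelfAdjoint husa).mp (hu p.2) ξ
  · ext ξ
    have h1 := ((z : H →L[ℂ] H).continuous.tendsto _).comp (hP ξ)
    exact tendsto_nhds_unique h1 ((hP ((z : H →L[ℂ] H) ξ)).congr fun p ↦
      (apply_congr (hz p p.2) ξ).symm)

/-- This is where normality of the trace enters: it prevents the trace from jumping at the supremum
of a chain. -/
theorem trace_le_of_isLUB (hτ : IsFaithfulNormalTrace M τ) {c : Set M.toStarSubalgebra}
    (hc : ∀ p ∈ c, IsStarProjection p) (hchain : IsChain (· ≤ ·) c) (hne : c.Nonempty)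
    {P : M.toStarSubalgebra} (hP : IsLUB c P) {s : ℝ} (hs : ∀ p ∈ c, (τ p).re ≤ s) :
    (τ P).re ≤ s := by
  have h := hτ.normal hne hchain.directedOn hP
  have h1 : (τ P) ≤ (s : ℂ) := by
    refine h.2 ?_
    rintro _ ⟨p, hp, rfl⟩
    rw [Complex.le_def]
    exact ⟨hs p hp, hτ.im_eq_zero (hc p hp).nonneg⟩
  exact (Complex.le_def.mp h1).1

end Trace

/-! ### MASAs are diffuse; flags of projections indexed by the trace. -/

section Flag

variable {H : Type*} [NormedAddCommGroup H] [InnerProductSpace ℂ H] [CompleteSpace H]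
variable {M : VonNeumannAlgebra H} {τ : M.toStarSubalgebra →ₗ[ℂ] ℂ}
  {𝒜 : StarSubalgebra ℂ M.toStarSubalgebra}

/-- Adjoining a self-adjoint element of the relative commutant to `𝒜` generates a commutative
⋆-subalgebra, which maximality forces back into `𝒜`. `IsMASA` does not include topological
closedness, so range projections and suprema are put into `𝒜` through this lemma. -/
theorem IsMASA.mem_of_commute (h𝒜 : IsMASA M 𝒜) {x : M.toStarSubalgebra} (hx : IsSelfAdjoint x)
    (hcomm : ∀ a ∈ 𝒜, a * x = x * a) : x ∈ 𝒜 := by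
  have hc : ∀ a ∈ insert x (𝒜 : Set M.toStarSubalgebra), ∀ b ∈ insert x (𝒜 : Set M.toStarSubalgebra),
      a * b = b * a := by
    rintro a (rfl | ha) b (rfl | hb)
    · rfl
    · exact (hcomm b hb).symm
    · exact hcomm a ha
    · exact h𝒜.prop a ha b hb
  have hstar : ∀ b ∈ insert x (𝒜 : Set M.toStarSubalgebra),
      star b ∈ insert x (𝒜 : Set M.toStarSubalgebra) := by
    rintro b (rfl | hb)
    · exact Or.inl hx.star_eq
    · exact Or.inr (star_mem hb)
  let B := StarAlgebra.adjoin ℂ (insert x (𝒜 : Set M.toStarSubalgebra))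
  have : IsMulCommutative B :=
    StarAlgebra.isMulCommutative_adjoin ℂ hc fun a ha b hb ↦ hc a ha _ (hstar b hb)
  have hB : ∀ y ∈ B, ∀ z ∈ B, y * z = z * y := fun y hy z hz ↦
    congrArg Subtype.val (mul_comm' (⟨y, hy⟩ : B) ⟨z, hz⟩)
  have hle : 𝒜 ≤ B := fun a ha ↦ StarAlgebra.subset_adjoin ℂ _ (Or.inr ha)
  exact h𝒜.le_of_ge hB hle (StarAlgebra.subset_adjoin ℂ _ (Or.inl rfl))

/-- Range projections commute with everything that commutes with the element. -/
theorem commute_range_projection {y q z : M.toStarSubalgebra} (hq : IsStarProjection q)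
    (hqy : q * y = y) (hqz : ∀ w : M.toStarSubalgebra, w * y = 0 → w * q = 0)
    (h1 : z * y = y * z) (h2 : star z * y = y * star z) : z * q = q * z := by
  have key : ∀ w : M.toStarSubalgebra, w * y = y * w → w * q = q * w * q := fun w hw ↦ by
    have : (1 - q) * w * q = 0 := hqz _ (by
      rw [mul_assoc, hw, ← mul_assoc, sub_mul, one_mul, hqy, sub_self, zero_mul])
    rw [sub_mul, one_mul, sub_mul, sub_eq_zero] at this
    exact this
  have h3 := congrArg star (key _ h2)
  simp only [star_mul, star_star, hq.isSelfAdjoint.star_eq] at h3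
  exact (key z h1).trans (by rw [mul_assoc]; exact h3.symm)

theorem IsMASA.range_projection_mem (h𝒜 : IsMASA M 𝒜) {y q : M.toStarSubalgebra}
    (hq : IsStarProjection q) (hqy : q * y = y)
    (hqz : ∀ w : M.toStarSubalgebra, w * y = 0 → w * q = 0) (hy : ∀ a ∈ 𝒜, a * y = y * a) :
    q ∈ 𝒜 :=
  h𝒜.mem_of_commute hq.isSelfAdjoint fun a ha ↦
    commute_range_projection hq hqy hqz (hy a ha) (hy _ (star_mem ha))

theorem IsFaithfulNormalTrace.eq_zero_of_nonneg (hτ : IsFaithfulNormalTrace M τ)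
    {x : M.toStarSubalgebra} (hx : 0 ≤ x) (h : τ x = 0) : x = 0 := by
  obtain ⟨y, h1, h2⟩ := exists_selfAdjoint_mul_self_eq hx
  have h3 : star y * y = x := by rw [h1.star_eq, h2]
  rw [← h3] at h
  rw [← h3, hτ.faithful y h, mul_zero]

theorem exists_posPart_negPart {x : M.toStarSubalgebra} (hx : IsSelfAdjoint x) :
    ∃ u w : M.toStarSubalgebra, 0 ≤ u ∧ 0 ≤ w ∧ u * w = 0 ∧ w * u = 0 ∧ u - w = x ∧
      ∀ b, x * b = b * x → u * b = b * u := by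
  refine ⟨x⁺, x⁻, CFC.posPart_nonneg x, CFC.negPart_nonneg x, CFC.posPart_mul_negPart x,
    CFC.negPart_mul_posPart x, CFC.posPart_sub_negPart x hx, fun b hb ↦ ?_⟩
  have h1 : Commute x b := hb
  rw [CFC.posPart_def, cfcₙ_eq_cfc]
  exact (h1.cfc_real _).eq

/-- If a projection `p` of a MASA is minimal in the MASA, then self-adjoint elements of the MASA
below `p` with vanishing trace vanish. -/
theorem IsMASA.eq_zero_of_minimal (h𝒜 : IsMASA M 𝒜) (hτ : IsFaithfulNormalTrace M τ)
    {p : M.toStarSubalgebra} (hp : IsStarProjection p) (hpm : p ∈ 𝒜)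
    (hcon : ∀ q ∈ 𝒜, IsStarProjection q → q * p = q → q ≠ 0 → q = p)
    {x : M.toStarSubalgebra} (hxm : x ∈ 𝒜) (hxsa : IsSelfAdjoint x) (hxp : p * x = x)
    (hτx : (τ x).re = 0) : x = 0 := by
  obtain ⟨u, w, hu, hw, huw, hwu, hdec, hcomm⟩ := exists_posPart_negPart hxsa
  have husa : star u = u := (IsSelfAdjoint.of_nonneg hu).star_eq
  have htr : (τ u).re = (τ w).re := by
    rw [← hdec, map_sub, Complex.sub_re] at hτx
    linarith
  have hz : u = 0 ∨ w = 0 := by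
    -- The support `q` of the positive part lies in `𝒜` below `p`. By minimality it is `0` or `p`,
    -- so one of the two parts vanishes; the zero trace then kills the other.
    obtain ⟨q, hq, hqx, hqz⟩ := exists_range_projection u
    have hqm : q ∈ 𝒜 := h𝒜.range_projection_mem hq hqx hqz fun b hb ↦
      (hcomm b (h𝒜.prop x hxm b hb)).symm
    have hpu : (1 - p) * u = 0 := by
      have h2 : x * u = u * u := by rw [← hdec, sub_mul, hwu, sub_zero]
      have h1 : (1 - p) * u * u = 0 := by
        rw [mul_assoc, ← h2, ← mul_assoc, sub_mul, one_mul, hxp, sub_self, zero_mul]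
      have h3 : star ((1 - p) * u) = u * (1 - p) := by
        rw [star_mul, hp.one_sub.isSelfAdjoint.star_eq, husa]
      rw [← star_eq_zero]
      refine eq_zero_of_star_mul_self ?_
      rw [star_star, h3, ← mul_assoc, h1, zero_mul]
    have hup : u * p = u := by
      have := congrArg star hpu
      rw [star_mul, hp.one_sub.isSelfAdjoint.star_eq, husa, star_zero, mul_sub, mul_one,
        sub_eq_zero] at this
      exact this.symm
    have hpq : p * q = q := by
      have := hqz _ hpu
      rw [sub_mul, one_mul, sub_eq_zero] at this
      exact this.symm
    have hqp : q * p = q := by rw [h𝒜.prop q hqm p hpm, hpq]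
    by_cases hq0 : q = 0
    · left
      rw [← hqx, hq0, zero_mul]
    · right
      have h1 : w * q = 0 := hqz _ hwu
      rw [hcon q hqm hq hqp hq0] at h1
      have h3 : x * p = x := by rw [h𝒜.prop x hxm p hpm, hxp]
      rw [← hdec, sub_mul, hup, h1, sub_zero] at h3
      rw [eq_sub_iff_add_eq] at h3
      simpa using h3
  rcases hz with h | h
  · have h1 : w = 0 := hτ.eq_zero_of_nonneg hw (Complex.ext (by
      rw [← htr, h, map_zero]) (hτ.im_eq_zero hw))
    rw [← hdec, h, h1, sub_zero]
  · have h1 : u = 0 := hτ.eq_zero_of_nonneg hu (Complex.ext (by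
      rw [htr, h, map_zero]) (hτ.im_eq_zero hu))
    rw [← hdec, h, h1, sub_zero]

/-- A MASA of a II₁ factor has no minimal projections. -/
theorem IsMASA.exists_between (h𝒜 : IsMASA M 𝒜) (hM : IsTypeIIOneFactor M)
    (hτ : IsFaithfulNormalTrace M τ) {p : M.toStarSubalgebra} (hp : IsStarProjection p)
    (hpm : p ∈ 𝒜) (hp0 : p ≠ 0) :
    ∃ q ∈ 𝒜, IsStarProjection q ∧ q * p = q ∧ q ≠ 0 ∧ q ≠ p := by
  by_contra! hcon
  have hpp : p * p = p := hp.isIdempotentElem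
  have hτp : (τ p).re ≠ 0 := fun h ↦ hp0 (hτ.eq_zero_of_projection hp h)
  -- Were `p` minimal in `𝒜`, then `𝒜 p` would consist of scalars: subtract from `a p` the multiple
  -- of `p` with the same trace.
  have hscal : ∀ a ∈ 𝒜, IsSelfAdjoint a → ∃ c : ℝ, a * p = c • p := by
    intro a ha hsa
    have hap : a * p = p * a := h𝒜.prop a ha p hpm
    have hapsa : IsSelfAdjoint (a * p) := (isSelfAdjoint_iff.mpr (by
      rw [star_mul, hp.isSelfAdjoint.star_eq, hsa.star_eq, hap]))
    set c : ℝ := (τ (a * p)).re / (τ p).re with hc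
    refine ⟨c, sub_eq_zero.mp (h𝒜.eq_zero_of_minimal hτ hp hpm hcon ?_ ?_ ?_ ?_)⟩
    · refine sub_mem (mul_mem ha hpm) ?_
      have := 𝒜.smul_mem hpm (c : ℂ)
      rwa [Complex.coe_smul] at this
    · exact hapsa.sub ((IsSelfAdjoint.all c).smul hp.isSelfAdjoint)
    · rw [mul_sub, ← mul_assoc, ← hap, mul_assoc, hpp, mul_smul_comm, hpp]
    · rw [map_sub, Complex.sub_re, ← Complex.coe_smul, map_smul]
      simp only [smul_eq_mul, Complex.re_ofReal_mul]
      rw [hc]; field_simp; ring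
  have hscal' : ∀ a ∈ 𝒜, ∃ c : ℂ, a * p = c • p := by
    intro a ha
    have h1 : (realPart a : M.toStarSubalgebra) ∈ 𝒜 := by
      rw [realPart_apply_coe]
      have := 𝒜.smul_mem (add_mem ha (star_mem ha)) (((2 : ℝ)⁻¹ : ℝ) : ℂ)
      rwa [Complex.coe_smul] at this
    have h2 : (imaginaryPart a : M.toStarSubalgebra) ∈ 𝒜 := by
      rw [imaginaryPart_apply_coe]
      refine 𝒜.smul_mem ?_ _
      have := 𝒜.smul_mem (sub_mem ha (star_mem ha)) (((2 : ℝ)⁻¹ : ℝ) : ℂ)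
      rwa [Complex.coe_smul] at this
    obtain ⟨c, hc⟩ := hscal _ h1 (realPart a).2
    obtain ⟨d, hd⟩ := hscal _ h2 (imaginaryPart a).2
    refine ⟨c + Complex.I * d, ?_⟩
    conv_lhs => rw [← realPart_add_I_smul_imaginaryPart a]
    rw [add_mul, smul_mul_assoc, hc, hd, add_smul, mul_smul, Complex.coe_smul, Complex.coe_smul]
  -- Since `𝒜` acts on `p` by scalars, every subprojection of `p` in `M` commutes with `𝒜` and so
  -- lies in `𝒜`. Thus `p` would be minimal in `M` itself.
  refine hM.diffuse p ⟨hp, hp0, fun q hq hqp ↦ ?_⟩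
  have hpq : p * q = q := by
    have := congrArg star hqp
    rwa [star_mul, hp.isSelfAdjoint.star_eq, hq.isSelfAdjoint.star_eq] at this
  have hqm : q ∈ 𝒜 := by
    refine h𝒜.mem_of_commute hq.isSelfAdjoint fun a ha ↦ ?_
    obtain ⟨c, hc⟩ := hscal' a ha
    have hc' : p * a = c • p := by rw [← h𝒜.prop a ha p hpm, hc]
    calc a * q = (a * p) * q := by rw [mul_assoc, hpq]
      _ = q * (p * a) := by rw [hc, hc', smul_mul_assoc, mul_smul_comm, hpq, hqp]
      _ = q * a := by rw [← mul_assoc, hqp]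
  by_cases hq0 : q = 0
  · exact Or.inl hq0
  · exact Or.inr (hcon q hqm hq hqp hq0)

/-- Every chain of projections of a MASA of a II₁ factor extends to a flag: an increasing family of
projections parametrised by the trace. -/
theorem IsMASA.exists_flag (h𝒜 : IsMASA M 𝒜) (hM : IsTypeIIOneFactor M)
    (hτ : IsFaithfulNormalTrace M τ) {c : Set M.toStarSubalgebra} (hchain : IsChain (· ≤ ·) c)
    (hc : ∀ p ∈ c, IsStarProjection p ∧ p ∈ 𝒜) :
    ∃ F : ℝ → M.toStarSubalgebra,
      (∀ s ∈ Set.Icc (0 : ℝ) 1, IsStarProjection (F s) ∧ F s ∈ 𝒜 ∧ (τ (F s)).re = s) ∧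
      (∀ s ∈ Set.Icc (0 : ℝ) 1, ∀ t ∈ Set.Icc (0 : ℝ) 1, s ≤ t → F s ≤ F t) ∧
      ∀ p ∈ c, F (τ p).re = p := by
  let α := {p : M.toStarSubalgebra // IsStarProjection p ∧ p ∈ 𝒜}
  let c' : Set α := {p | p.1 ∈ c}
  have hc' : IsChain (· ≤ ·) c' := fun p hp q hq hpq ↦
    hchain hp hq fun h ↦ hpq (Subtype.ext h)
  -- The flag is a maximal chain `D`. Faithfulness makes the trace injective on it; it remains to
  -- see that all values in `[0, 1]` occur.
  obtain ⟨D, hD, hcD⟩ := hc'.exists_maxChain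
  have hmax : ∀ x : α, (∀ d ∈ D, x ≤ d ∨ d ≤ x) → x ∈ D := fun x hx ↦ by
    have h1 : IsChain (· ≤ ·) (insert x D) := hD.1.insert fun d hd _ ↦ hx d hd
    have h2 := hD.2 h1 (Set.subset_insert x D)
    rw [h2]; exact Set.mem_insert x D
  have htot : ∀ p ∈ D, ∀ q ∈ D, p ≤ q ∨ q ≤ p := fun p hp q hq ↦ hD.1.total hp hq
  have hmono : ∀ p q : α, p ≤ q → (τ p.1).re ≤ (τ q.1).re := fun p q h ↦ hτ.re_mono h
  have heq : ∀ p ∈ D, ∀ q ∈ D, (τ p.1).re = (τ q.1).re → p = q := by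
    intro p hp q hq h
    rcases htot p hp q hq with h1 | h1
    · exact Subtype.ext (hτ.eq_of_le_of_re_eq p.2.1 q.2.1 h1 h)
    · exact Subtype.ext (hτ.eq_of_le_of_re_eq q.2.1 p.2.1 h1 h.symm).symm
  have hle : ∀ p ∈ D, ∀ q ∈ D, (τ p.1).re ≤ (τ q.1).re → p ≤ q := by
    intro p hp q hq h
    rcases htot p hp q hq with h1 | h1
    · exact h1
    · exact (heq p hp q hq (le_antisymm h (hmono _ _ h1))).le
  let Z : α := ⟨0, .zero _, zero_mem _⟩
  let I : α := ⟨1, .one _, one_mem _⟩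
  have hZ : Z ∈ D := hmax Z fun d _ ↦ Or.inl d.2.1.nonneg
  have hI : I ∈ D := hmax I fun d _ ↦ Or.inr d.2.1.le_one
  have hcommD : ∀ a ∈ 𝒜, ∀ p : α, a * p.1 = p.1 * a := fun a ha p ↦ h𝒜.prop a ha _ p.2.2
  have hlow : ∀ s ∈ Set.Icc (0 : ℝ) 1, ∃ P ∈ D, (τ P.1).re ≤ s ∧ ∀ d ∈ D, (τ d.1).re ≤ s → d ≤ P := by
    intro s hs
    let S : Set M.toStarSubalgebra := {p | ∃ d ∈ D, d.1 = p ∧ (τ d.1).re ≤ s}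
    have hS : ∀ p ∈ S, IsStarProjection p := by rintro _ ⟨d, -, rfl, -⟩; exact d.2.1
    have hSc : IsChain (· ≤ ·) S := by
      rintro _ ⟨d, hd, rfl, -⟩ _ ⟨e, he, rfl, -⟩ _
      exact htot d hd e he
    have hSn : S.Nonempty := ⟨0, Z, hZ, rfl, by simpa [Z] using hs.1⟩
    obtain ⟨P, hP, hlub, hcm⟩ := exists_isLUB_projections hS hSc hSn
    have hPm : P ∈ 𝒜 := h𝒜.mem_of_commute hP.isSelfAdjoint fun a ha ↦ hcm a (by
      rintro _ ⟨d, -, rfl, -⟩; exact hcommD a ha d)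
    have hPs : (τ P).re ≤ s := trace_le_of_isLUB hτ hS hSc hSn hlub (by
      rintro _ ⟨d, -, rfl, h⟩; exact h)
    refine ⟨⟨P, hP, hPm⟩, hmax _ fun d hd ↦ ?_, hPs, fun d hd h ↦ hlub.1 ⟨d, hd, rfl, h⟩⟩
    rcases le_total (τ d.1).re s with h | h
    · exact Or.inr (hlub.1 ⟨d, hd, rfl, h⟩)
    · refine Or.inl (hlub.2 ?_)
      rintro _ ⟨e, he, rfl, h'⟩
      exact hle e he d hd (h'.trans h)
  -- The infimum of the members with trace at least `s` is obtained as the complement of the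
  -- supremum of their complements.
  have hupp : ∀ s ∈ Set.Icc (0 : ℝ) 1, ∃ P ∈ D, s ≤ (τ P.1).re ∧ ∀ d ∈ D, s ≤ (τ d.1).re → P ≤ d := by
    intro s hs
    let S : Set M.toStarSubalgebra := {p | ∃ d ∈ D, 1 - d.1 = p ∧ s ≤ (τ d.1).re}
    have hS : ∀ p ∈ S, IsStarProjection p := by rintro _ ⟨d, -, rfl, -⟩; exact d.2.1.one_sub
    have hSc : IsChain (· ≤ ·) S := by
      rintro _ ⟨d, hd, rfl, -⟩ _ ⟨e, he, rfl, -⟩ _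
      rcases htot d hd e he with h | h
      · exact Or.inr (sub_le_sub_left (α := M.toStarSubalgebra) h 1)
      · exact Or.inl (sub_le_sub_left (α := M.toStarSubalgebra) h 1)
    have hSn : S.Nonempty := ⟨1 - 1, I, hI, rfl, by simpa [I, hτ.map_one] using hs.2⟩
    obtain ⟨P, hP, hlub, hcm⟩ := exists_isLUB_projections hS hSc hSn
    have hPm : P ∈ 𝒜 := h𝒜.mem_of_commute hP.isSelfAdjoint fun a ha ↦ hcm a (by
      rintro _ ⟨d, -, rfl, -⟩; rw [mul_sub, sub_mul, hcommD a ha d, mul_one, one_mul])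
    have hPs : (τ P).re ≤ 1 - s := trace_le_of_isLUB hτ hS hSc hSn hlub (by
      rintro _ ⟨d, -, rfl, h⟩
      rw [map_sub, hτ.map_one, Complex.sub_re, Complex.one_re]; linarith)
    have hPd : ∀ d ∈ D, s ≤ (τ d.1).re → 1 - P ≤ d.1 := fun d hd h ↦ by
      have := hlub.1 ⟨d, hd, rfl, h⟩
      exact sub_le_comm.mp this
    refine ⟨⟨1 - P, hP.one_sub, sub_mem (one_mem _) hPm⟩, hmax _ fun d hd ↦ ?_, ?_, hPd⟩
    · rcases le_total s (τ d.1).re with h | h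
      · exact Or.inl (hPd d hd h)
      · refine Or.inr (le_sub_comm.mp (hlub.2 ?_))
        rintro _ ⟨e, he, rfl, h'⟩
        exact sub_le_sub_left (α := M.toStarSubalgebra) (hle d hd e he (h.trans h')) 1
    · simp only [map_sub, hτ.map_one, Complex.sub_re, Complex.one_re]; linarith
  -- A missing value `s` leaves adjacent members `P < Q` of the chain. A proper nonzero
  -- subprojection of `Q - P` in `𝒜` gives `R` strictly between them, comparable with all of `D`,
  -- contradicting maximality.
  have hval : ∀ s ∈ Set.Icc (0 : ℝ) 1, ∃ d ∈ D, (τ d.1).re = s := by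
    intro s hs
    by_contra! hcon
    obtain ⟨P, hP, hPs, hPd⟩ := hlow s hs
    obtain ⟨Q, hQ, hQs, hQd⟩ := hupp s hs
    have hPQ : P ≤ Q := hle P hP Q hQ (hPs.trans hQs)
    have hpr : IsStarProjection (Q.1 - P.1) :=
      ((IsStarProjection.le_tfae P.2.1 Q.2.1).out 0 3).mp hPQ
    have hne : Q.1 - P.1 ≠ 0 := fun h ↦ by
      have h1 : Q = P := Subtype.ext (sub_eq_zero.mp h)
      rw [h1] at hQs
      exact hcon P hP (le_antisymm hPs hQs)
    obtain ⟨q, hqm, hq, hqp, hq0, hqne⟩ :=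
      h𝒜.exists_between hM hτ hpr (sub_mem Q.2.2 P.2.2) hne
    have hPQm : Q.1 * P.1 = P.1 := ((IsStarProjection.le_tfae P.2.1 Q.2.1).out 0 1).mp hPQ
    have hqP : q * P.1 = 0 := by
      rw [← hqp, mul_assoc, sub_mul, hPQm, P.2.1.isIdempotentElem, sub_self, mul_zero]
    have hR : IsStarProjection (P.1 + q) := P.2.1.add hq (by rw [h𝒜.prop _ P.2.2 _ hqm, hqP])
    let R : α := ⟨P.1 + q, hR, add_mem P.2.2 hqm⟩
    have hPR : P ≤ R := le_add_of_nonneg_right (α := M.toStarSubalgebra) hq.nonneg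
    have hqle : q ≤ Q.1 - P.1 := ((IsStarProjection.le_tfae hq hpr).out 0 2).mpr hqp
    have hRQ : R ≤ Q := by
      change P.1 + q ≤ Q.1
      rw [add_comm]; exact le_sub_iff_add_le.mp hqle
    have hRD : R ∈ D := hmax R fun d hd ↦ by
      rcases le_total (τ d.1).re s with h | h
      · exact Or.inr ((hPd d hd h).trans hPR)
      · exact Or.inl (hRQ.trans (hQd d hd h))
    rcases le_total (τ R.1).re s with h | h
    · have h1 : R = P := le_antisymm (hPd R hRD h) hPR
      have h2 : P.1 + q = P.1 := congrArg Subtype.val h1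
      exact hq0 (by simpa using h2)
    · have h1 : R = Q := le_antisymm hRQ (hQd R hRD h)
      have h2 : P.1 + q = Q.1 := congrArg Subtype.val h1
      exact hqne (by rw [← h2]; abel)
  have : Nonempty α := ⟨Z⟩
  choose! F hFD hFs using hval
  refine ⟨fun s ↦ (F s).1, fun s hs ↦ ⟨(F s).2.1, (F s).2.2, hFs s hs⟩, fun s hs t ht h ↦ ?_, fun p hp ↦ ?_⟩
  · exact hle _ (hFD s hs) _ (hFD t ht) (by rw [hFs s hs, hFs t ht]; exact h)
  · have hpr := hc p hp
    have hmem : (τ p).re ∈ Set.Icc (0 : ℝ) 1 := by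
      refine ⟨hτ.re_nonneg hpr.1.nonneg, ?_⟩
      have := hτ.re_mono hpr.1.le_one
      rwa [hτ.map_one, Complex.one_re] at this
    have hpD : (⟨p, hpr⟩ : α) ∈ D := hcD hp
    exact congrArg Subtype.val (heq _ (hFD _ hmem) _ hpD (hFs _ hmem))

theorem mul_of_projection_le {p q : M.toStarSubalgebra} (hp : IsStarProjection p)
    (hq : IsStarProjection q) (h : p ≤ q) : q * p = p ∧ p * q = p :=
  ⟨((IsStarProjection.le_tfae hp hq).out 0 1).mp h, ((IsStarProjection.le_tfae hp hq).out 0 2).mp h⟩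

/-- Differences of an increasing sequence of projections are orthogonal. -/
theorem sub_mul_sub_eq_zero {G : ℕ → M.toStarSubalgebra} {n : ℕ}
    (hG : ∀ i ≤ n, IsStarProjection (G i)) (hmono : ∀ i j, i ≤ j → j ≤ n → G i ≤ G j)
    {i j : ℕ} (hi : i < n) (hj : j < n) (hij : i ≠ j) :
    (G (i + 1) - G i) * (G (j + 1) - G j) = 0 := by
  have hm : ∀ a b, a ≤ b → b ≤ n → G b * G a = G a ∧ G a * G b = G a := fun a b hab hb ↦
    mul_of_projection_le (hG a (hab.trans hb)) (hG b hb) (hmono a b hab hb)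
  rcases lt_or_gt_of_ne hij with h | h
  · simp only [sub_mul, mul_sub]
    rw [(hm (i + 1) (j + 1) (by omega) (by omega)).2, (hm (i + 1) j (by omega) (by omega)).2,
      (hm i (j + 1) (by omega) (by omega)).2, (hm i j (by omega) (by omega)).2]
    abel
  · simp only [sub_mul, mul_sub]
    rw [(hm (j + 1) (i + 1) (by omega) (by omega)).1, (hm (j + 1) i (by omega) (by omega)).1,
      (hm j (i + 1) (by omega) (by omega)).1, (hm j i (by omega) (by omega)).1]
    abel

/-- A projection of a MASA can be divided into `n` projections of equal trace. -/
theorem IsMASA.exists_division (h𝒜 : IsMASA M 𝒜) (hM : IsTypeIIOneFactor M)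
    (hτ : IsFaithfulNormalTrace M τ) {p : M.toStarSubalgebra} (hp : IsStarProjection p)
    (hpm : p ∈ 𝒜) {n : ℕ} (hn : n ≠ 0) :
    ∃ e : Fin n → M.toStarSubalgebra, (∀ i, IsStarProjection (e i)) ∧ (∀ i, e i ∈ 𝒜) ∧
      (∀ i j, i ≠ j → e i * e j = 0) ∧ ∑ i, e i = p ∧ ∀ i, (τ (e i)).re = (τ p).re / n := by
  obtain ⟨F, hF, hmono, hFp⟩ := h𝒜.exists_flag hM hτ (c := {p}) Set.subsingleton_singleton.isChain
    (by rintro _ rfl; exact ⟨hp, hpm⟩)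
  set t := (τ p).re with ht
  have ht0 : 0 ≤ t := hτ.re_nonneg hp.nonneg
  have ht1 : t ≤ 1 := by
    have := hτ.re_mono hp.le_one
    rwa [hτ.map_one, Complex.one_re] at this
  have hn0 : (0 : ℝ) < n := by positivity
  -- A flag through `p` is cut at equal trace intervals up to `τ p`; the last cut is `p` itself
  -- because the flag passes through `p`.
  let G : ℕ → M.toStarSubalgebra := fun i ↦ F (i * t / n)
  have hmem : ∀ i ≤ n, (i * t / n : ℝ) ∈ Set.Icc (0 : ℝ) 1 := fun i hi ↦ by
    have : (i : ℝ) ≤ n := by exact_mod_cast hi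
    refine ⟨by positivity, ?_⟩
    rw [div_le_one hn0]; nlinarith
  have hG : ∀ i ≤ n, IsStarProjection (G i) := fun i hi ↦ (hF _ (hmem i hi)).1
  have hGm : ∀ i j, i ≤ j → j ≤ n → G i ≤ G j := fun i j hij hj ↦ by
    refine hmono _ (hmem i (hij.trans hj)) _ (hmem j hj) ?_
    have : (i : ℝ) ≤ j := by exact_mod_cast hij
    gcongr
  have hG0 : G 0 = 0 := hτ.eq_zero_of_projection (hG 0 (by omega)) (by
    rw [(hF _ (hmem 0 (by omega))).2.2]; simp)
  have hGn : G n = p := by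
    have h1 : (n * t / n : ℝ) = t := by field_simp
    have h2 : G n = F t := congrArg F h1
    rw [h2]; exact hFp p rfl
  refine ⟨fun i ↦ G (i + 1) - G i, fun i ↦ ?_, fun i ↦ ?_, fun i j hij ↦ ?_, ?_, fun i ↦ ?_⟩
  · exact ((IsStarProjection.le_tfae (hG i (by omega)) (hG (i + 1) (by omega))).out 0 3).mp
      (hGm i (i + 1) (by omega) (by omega))
  · exact sub_mem (hF _ (hmem _ (by omega))).2.1 (hF _ (hmem _ (by omega))).2.1
  · exact sub_mul_sub_eq_zero hG hGm i.2 j.2 fun h ↦ hij (Fin.ext h)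
  · rw [← Finset.sum_range (fun i ↦ G (i + 1) - G i), Finset.sum_range_sub, hG0, hGn, sub_zero]
  · rw [map_sub, Complex.sub_re, (hF _ (hmem _ (by omega))).2.2, (hF _ (hmem _ (by omega))).2.2]
    push_cast; field_simp; ring

end Flag

/-! ### Spectral projections and approximation by step functions. -/

section Spectral

open MeasureTheory

variable {H : Type*} [NormedAddCommGroup H] [InnerProductSpace ℂ H] [CompleteSpace H]
variable {M : VonNeumannAlgebra H} {τ : M.toStarSubalgebra →ₗ[ℂ] ℂ}

theorem IsFaithfulNormalTrace.abs_re_le (hτ : IsFaithfulNormalTrace M τ) {y : M.toStarSubalgebra}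
    (hy : IsSelfAdjoint y) : |(τ y).re| ≤ ‖y‖ := by
  have h1 : ∀ r : ℝ, (τ (algebraMap ℝ M.toStarSubalgebra r)).re = r := fun r ↦ by
    rw [Algebra.algebraMap_eq_smul_one, ← Complex.coe_smul, map_smul, hτ.map_one]
    simp
  rw [abs_le]
  constructor
  · have := hτ.re_mono (hy.neg_algebraMap_norm_le_self)
    rw [map_neg, Complex.neg_re, h1] at this
    exact this
  · have := hτ.re_mono (hy.le_algebraMap_norm_self)
    rwa [h1] at this

theorem IsFaithfulNormalTrace.ae_abs_le (hτ : IsFaithfulNormalTrace M τ) {X : M.toStarSubalgebra}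
    (hX : IsSelfAdjoint X) : ∀ᵐ s ∂(spectralDistribution τ X), |s| ≤ ‖X‖ + 1 := by
  have hm := hasMoments_spectralDistribution hτ hX
  have := hm.isProbabilityMeasure
  refine ae_abs_le_of_moments_le (norm_nonneg X) hm.integrable fun n ↦ ?_
  have h1 : (τ (X ^ (2 * n))).re = ∫ s : ℝ, s ^ (2 * n) ∂(spectralDistribution τ X) := by
    rw [← hm.integral_eq, Complex.ofReal_re]
  rw [← h1]
  rcases Nat.eq_zero_or_pos n with rfl | hn
  · simp [hτ.map_one]
  · exact (le_abs_self _).trans ((hτ.abs_re_le (hX.pow _)).trans (norm_pow_le' X (by omega)))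

/-- Integration against the spectral distribution is the trace of the functional calculus. -/
theorem IsFaithfulNormalTrace.integral_eq (hτ : IsFaithfulNormalTrace M τ)
    {X : M.toStarSubalgebra} (hX : IsSelfAdjoint X) {g : ℝ → ℝ} (hg : Continuous g)
    (hgint : Integrable g (spectralDistribution τ X)) :
    ∫ s, g s ∂(spectralDistribution τ X) = (τ (cfc g X)).re := by
  have hm := hasMoments_spectralDistribution hτ hX
  have := hm.isProbabilityMeasure
  have hae := hτ.ae_abs_le hX
  set m := spectralDistribution τ X with hmdef
  have hpint : ∀ p : Polynomial ℝ, Integrable (fun s ↦ p.eval s) m := by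
    intro p
    simp only [Polynomial.eval_eq_sum_range]
    exact integrable_finsetSum _ fun i _ ↦ (hm.integrable i).const_mul _
  have hp : ∀ p : Polynomial ℝ, ∫ s, p.eval s ∂m = (τ (cfc (fun s ↦ p.eval s) X)).re := by
    intro p
    rw [cfc_polynomial p X hX, Polynomial.aeval_eq_sum_range, map_sum, Complex.re_sum]
    simp only [Polynomial.eval_eq_sum_range]
    rw [integral_finsetSum _ fun i _ ↦ (hm.integrable i).const_mul _]
    refine Finset.sum_congr rfl fun i _ ↦ ?_
    rw [integral_const_mul, ← Complex.coe_smul, map_smul, smul_eq_mul, Complex.re_ofReal_mul,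
      ← hm.integral_eq, Complex.ofReal_re]
  -- Weierstrass approximation on an interval that carries both the measure and the spectrum reduces
  -- the claim to polynomials, where it is the definition of the moments.
  refine eq_of_abs_sub_le_all fun ε hε ↦ ?_
  obtain ⟨p, hpε⟩ := exists_polynomial_near_of_continuousOn (-(‖X‖ + 1)) (‖X‖ + 1) g
    hg.continuousOn (ε / 2) (by positivity)
  have h1 : |∫ s, p.eval s ∂m - ∫ s, g s ∂m| ≤ ε / 2 := by
    rw [← integral_sub (hpint p) hgint]
    have := norm_integral_le_of_norm_le_const (μ := m) (f := fun s ↦ p.eval s - g s) (C := ε / 2)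
      (by
        filter_upwards [hae] with s hs
        exact (hpε s (abs_le.mp hs)).le)
    simpa using this
  have h2 : |(τ (cfc (fun s ↦ p.eval s) X)).re - (τ (cfc g X)).re| ≤ ε / 2 := by
    rw [← Complex.sub_re, ← map_sub, ← cfc_sub _ _ X (by fun_prop) hg.continuousOn]
    refine (hτ.abs_re_le (cfc_predicate _ X)).trans (norm_cfc_le (by positivity) fun t ht ↦ ?_)
    have h3 : ‖t‖ ≤ ‖X‖ * ‖(1 : M.toStarSubalgebra)‖ := spectrum.norm_le_norm_mul_of_mem ht
    have h4 : ‖(1 : M.toStarSubalgebra)‖ ≤ 1 := norm_le_one_of_mem_unitary (one_mem _)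
    have h5 : |t| ≤ ‖X‖ + 1 := by
      rw [← Real.norm_eq_abs]
      nlinarith [norm_nonneg X]
    exact (hpε t (abs_le.mp h5)).le
  rw [hp p] at h1
  rw [abs_le] at h1 h2 ⊢
  constructor <;> linarith [h1.1, h1.2, h2.1, h2.2]

/-- The continuous function which is `0` up to `c`, `1` from `c + ε` on, and linear in between. -/
def stepFn (c ε : ℝ) (t : ℝ) : ℝ := min (max (t - c) 0) ε / ε

theorem continuous_stepFn (c ε : ℝ) : Continuous (stepFn c ε) := by
  unfold stepFn; fun_prop

theorem stepFn_nonneg {c ε : ℝ} (hε : 0 < ε) (t : ℝ) : 0 ≤ stepFn c ε t :=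
  div_nonneg (le_min (le_max_right _ _) hε.le) hε.le

theorem stepFn_le_one {c ε : ℝ} (hε : 0 < ε) (t : ℝ) : stepFn c ε t ≤ 1 :=
  (div_le_one hε).mpr (min_le_right _ _)

theorem stepFn_eq_zero {c ε t : ℝ} (hε : 0 < ε) (ht : t ≤ c) : stepFn c ε t = 0 := by
  rw [stepFn, max_eq_right (by linarith), min_eq_left hε.le, zero_div]

theorem stepFn_eq_one {c ε t : ℝ} (hε : 0 < ε) (ht : c + ε ≤ t) : stepFn c ε t = 1 := by
  rw [stepFn, max_eq_left (by linarith), min_eq_right (by linarith), div_self hε.ne']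

theorem IsFaithfulNormalTrace.integrable_stepFn (hτ : IsFaithfulNormalTrace M τ)
    {X : M.toStarSubalgebra} (hX : IsSelfAdjoint X) (c : ℝ) {ε : ℝ} (hε : 0 < ε) :
    Integrable (stepFn c ε) (spectralDistribution τ X) := by
  have := (hasMoments_spectralDistribution hτ hX).isProbabilityMeasure
  refine Integrable.of_bound (continuous_stepFn c ε).aestronglyMeasurable 1
    (Filter.Eventually.of_forall fun t ↦ ?_)
  rw [Real.norm_eq_abs, abs_of_nonneg (stepFn_nonneg hε t)]
  exact stepFn_le_one hε t

/-- `stepFn c ε` lies between the indicators of `(c + ε, ∞)` and `(c, ∞)`. The continuous functional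
calculus does not reach the indicators, so distribution functions are compared with traces up to a
shift by `ε`. -/
theorem IsFaithfulNormalTrace.trace_stepFn_le (hτ : IsFaithfulNormalTrace M τ)
    {X : M.toStarSubalgebra} (hX : IsSelfAdjoint X) (c : ℝ) {ε : ℝ} (hε : 0 < ε) :
    (τ (cfc (stepFn c ε) X)).re ≤ (spectralDistribution τ X).real (Set.Ioi c) := by
  have := (hasMoments_spectralDistribution hτ hX).isProbabilityMeasure
  rw [← hτ.integral_eq hX (continuous_stepFn c ε) (hτ.integrable_stepFn hX c hε),
    ← integral_indicator_one measurableSet_Ioi]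
  refine integral_mono (hτ.integrable_stepFn hX c hε)
    ((integrable_indicator_iff measurableSet_Ioi).mpr (integrable_const (1 : ℝ)).integrableOn)
    fun t ↦ ?_
  by_cases ht : t ∈ Set.Ioi c
  · rw [Set.indicator_of_mem ht]; exact stepFn_le_one hε t
  · rw [Set.indicator_of_notMem ht]; exact (stepFn_eq_zero hε (not_lt.mp ht)).le

theorem IsFaithfulNormalTrace.le_trace_stepFn (hτ : IsFaithfulNormalTrace M τ)
    {X : M.toStarSubalgebra} (hX : IsSelfAdjoint X) (c : ℝ) {ε : ℝ} (hε : 0 < ε) :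
    (spectralDistribution τ X).real (Set.Ioi (c + ε)) ≤ (τ (cfc (stepFn c ε) X)).re := by
  have := (hasMoments_spectralDistribution hτ hX).isProbabilityMeasure
  rw [← hτ.integral_eq hX (continuous_stepFn c ε) (hτ.integrable_stepFn hX c hε),
    ← integral_indicator_one measurableSet_Ioi]
  refine integral_mono
    ((integrable_indicator_iff measurableSet_Ioi).mpr (integrable_const (1 : ℝ)).integrableOn)
    (hτ.integrable_stepFn hX c hε) fun t ↦ ?_
  by_cases ht : t ∈ Set.Ioi (c + ε)
  · rw [Set.indicator_of_mem ht]; exact (stepFn_eq_one hε (le_of_lt ht)).ge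
  · rw [Set.indicator_of_notMem ht]; exact stepFn_nonneg hε t

theorem cfc_stepFn_nonneg {X : M.toStarSubalgebra} (c : ℝ) {ε : ℝ} (hε : 0 < ε) :
    0 ≤ cfc (stepFn c ε) X := cfc_nonneg fun t _ ↦ stepFn_nonneg hε t

theorem cfc_stepFn_le_one {X : M.toStarSubalgebra} (c : ℝ) {ε : ℝ} (hε : 0 < ε) :
    cfc (stepFn c ε) X ≤ 1 := cfc_le_one _ X fun t _ ↦ stepFn_le_one hε t

/-- The spectral projection of `X` for the interval `(c, ∞)`. -/
def spectralProj (X : M.toStarSubalgebra) (c : ℝ) : M.toStarSubalgebra :=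
  (exists_range_projection (cfc (fun t : ℝ ↦ max (t - c) 0) X)).choose

theorem isStarProjection_spectralProj (X : M.toStarSubalgebra) (c : ℝ) :
    IsStarProjection (spectralProj X c) :=
  (exists_range_projection (cfc (fun t : ℝ ↦ max (t - c) 0) X)).choose_spec.1

theorem spectralProj_mul (X : M.toStarSubalgebra) (c : ℝ) :
    spectralProj X c * cfc (fun t : ℝ ↦ max (t - c) 0) X = cfc (fun t : ℝ ↦ max (t - c) 0) X :=
  (exists_range_projection (cfc (fun t : ℝ ↦ max (t - c) 0) X)).choose_spec.2.1

theorem mul_spectralProj_eq_zero {X : M.toStarSubalgebra} {c : ℝ} {z : M.toStarSubalgebra}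
    (h : z * cfc (fun t : ℝ ↦ max (t - c) 0) X = 0) : z * spectralProj X c = 0 :=
  (exists_range_projection (cfc (fun t : ℝ ↦ max (t - c) 0) X)).choose_spec.2.2 z h

theorem IsMASA.spectralProj_mem {𝒜 : StarSubalgebra ℂ M.toStarSubalgebra} (h𝒜 : IsMASA M 𝒜)
    {X : M.toStarSubalgebra} (hX : X ∈ 𝒜) (c : ℝ) : spectralProj X c ∈ 𝒜 := by
  refine h𝒜.range_projection_mem (isStarProjection_spectralProj X c) (spectralProj_mul X c)
    (fun w hw ↦ mul_spectralProj_eq_zero hw) fun a ha ↦ ?_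
  have h1 : Commute X a := h𝒜.prop X hX a ha
  exact (h1.cfc_real _).eq.symm

/-- The step function equals `1` above `c + ε`, so `y q = q = q y` and `y - q = (1 - q) y (1 - q)`
is positive. -/
theorem spectralProj_le {X : M.toStarSubalgebra} (hX : IsSelfAdjoint X) (c : ℝ) {ε : ℝ}
    (hε : 0 < ε) : spectralProj X (c + ε) ≤ cfc (stepFn c ε) X := by
  set q := spectralProj X (c + ε) with hq
  obtain ⟨y, hy⟩ : ∃ y, y = cfc (stepFn c ε) X := ⟨_, rfl⟩
  have hy0 : 0 ≤ y := hy ▸ cfc_stepFn_nonneg (X := X) c hε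
  rw [← hy]
  have hqp : IsStarProjection q := isStarProjection_spectralProj X (c + ε)
  have hysa : star y = y := (IsSelfAdjoint.of_nonneg hy0).star_eq
  have h1 : (1 - y) * q = 0 := by
    refine mul_spectralProj_eq_zero ?_
    have hcont : Continuous fun t : ℝ ↦ 1 - stepFn c ε t :=
      continuous_const.sub (continuous_stepFn c ε)
    have h0 : (1 : M.toStarSubalgebra) = cfc (fun _ : ℝ ↦ (1 : ℝ)) X := (cfc_const_one ℝ X).symm
    rw [hy, h0, ← cfc_sub _ _ X continuousOn_const (continuous_stepFn c ε).continuousOn,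
      ← cfc_mul _ _ X hcont.continuousOn (by fun_prop),
      ← cfc_const_zero ℝ X]
    congr 1
    funext t
    rcases le_total t (c + ε) with ht | ht
    · rw [max_eq_right (by linarith : t - (c + ε) ≤ 0), mul_zero]
    · rw [stepFn_eq_one hε ht]; simp
  have h2 : y * q = q := by
    rw [sub_mul, one_mul, sub_eq_zero] at h1; exact h1.symm
  have h3 : q * y = q := by
    have := congrArg star h2
    rwa [star_mul, hysa, hqp.isSelfAdjoint.star_eq] at this
  have h4 : 0 ≤ star (1 - q) * y * (1 - q) :=
    star_left_conjugate_nonneg hy0 _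
  have h5 : star (1 - q) * y * (1 - q) = y - q := by
    rw [hqp.one_sub.isSelfAdjoint.star_eq, sub_mul, one_mul, h3, mul_sub, mul_one, sub_mul, h2,
      hqp.isIdempotentElem, sub_self, sub_zero]
  rw [h5] at h4
  exact sub_nonneg.mp h4

/-- The step function is a multiple of `(t - c)⁺`, so `q y = y = y q`, and `q - y = q (1 - y) q` is
positive because `y ≤ 1`. -/
theorem le_spectralProj {X : M.toStarSubalgebra} (c : ℝ) {ε : ℝ}
    (hε : 0 < ε) : cfc (stepFn c ε) X ≤ spectralProj X c := by
  set q := spectralProj X c with hq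
  obtain ⟨y, hy⟩ : ∃ y, y = cfc (stepFn c ε) X := ⟨_, rfl⟩
  have hy0 : 0 ≤ y := hy ▸ cfc_stepFn_nonneg (X := X) c hε
  have hy1 : y ≤ 1 := hy ▸ cfc_stepFn_le_one (X := X) c hε
  rw [← hy]
  have hqp : IsStarProjection q := isStarProjection_spectralProj X c
  have hysa : star y = y := (IsSelfAdjoint.of_nonneg hy0).star_eq
  have hcont : Continuous fun t : ℝ ↦ (max (t - c) ε)⁻¹ :=
    Continuous.inv₀ (by fun_prop) fun t ↦ (hε.trans_le (le_max_right _ _)).ne'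
  have h1 : y = cfc (fun t : ℝ ↦ max (t - c) 0) X * cfc (fun t : ℝ ↦ (max (t - c) ε)⁻¹) X := by
    rw [← cfc_mul _ _ X (by fun_prop) hcont.continuousOn, hy]
    congr 1
    funext t
    rcases le_total t c with ht | ht
    · rw [stepFn_eq_zero hε ht, max_eq_right (by linarith : t - c ≤ 0), zero_mul]
    · rw [stepFn, max_eq_left (by linarith : 0 ≤ t - c)]
      rcases le_total (t - c) ε with h | h
      · rw [min_eq_left h, max_eq_right h, div_eq_mul_inv]
      · have : t - c ≠ 0 := by linarith
        rw [min_eq_right h, max_eq_left h, div_self hε.ne', mul_inv_cancel₀ this]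
  have h2 : q * y = y := by rw [h1, ← mul_assoc, spectralProj_mul]
  have h3 : y * q = y := by
    have := congrArg star h2
    rwa [star_mul, hysa, hqp.isSelfAdjoint.star_eq] at this
  have h4 : 0 ≤ star q * (1 - y) * q :=
    star_left_conjugate_nonneg (sub_nonneg.mpr hy1) _
  have h5 : star q * (1 - y) * q = q - y := by
    rw [hqp.isSelfAdjoint.star_eq, mul_sub, mul_one, h2, sub_mul, hqp.isIdempotentElem, h3]
  rw [h5] at h4
  exact sub_nonneg.mp h4

theorem spectralProj_antitone {X : M.toStarSubalgebra} (hX : IsSelfAdjoint X) :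
    Antitone (spectralProj X) := by
  intro c d hcd
  rcases hcd.eq_or_lt with rfl | h
  · exact le_rfl
  · have h1 := (spectralProj_le hX c (sub_pos.mpr h)).trans (le_spectralProj c (sub_pos.mpr h))
    rwa [add_sub_cancel] at h1

theorem spectrum_subset_Icc {X : M.toStarSubalgebra} (hX : 0 ≤ X) {t : ℝ} (ht : t ∈ spectrum ℝ X) :
    0 ≤ t ∧ t ≤ ‖X‖ := by
  refine ⟨spectrum_nonneg_of_nonneg hX ht, ?_⟩
  have h3 : ‖t‖ ≤ ‖X‖ * ‖(1 : M.toStarSubalgebra)‖ := spectrum.norm_le_norm_mul_of_mem ht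
  have h4 : ‖(1 : M.toStarSubalgebra)‖ ≤ 1 := norm_le_one_of_mem_unitary (one_mem _)
  have h5 := le_abs_self t
  rw [← Real.norm_eq_abs] at h5
  nlinarith [norm_nonneg X]

theorem spectralProj_eq_zero {X : M.toStarSubalgebra} (hX : 0 ≤ X) {c : ℝ} (hc : ‖X‖ ≤ c) :
    spectralProj X c = 0 := by
  have h1 : cfc (fun t : ℝ ↦ max (t - c) 0) X = 0 := by
    rw [← cfc_const_zero ℝ X]
    refine cfc_congr fun t ht ↦ ?_
    have := (spectrum_subset_Icc hX ht).2
    exact max_eq_right (by linarith)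
  have h2 : 1 * spectralProj X c = 0 := mul_spectralProj_eq_zero (by rw [h1, mul_zero])
  rwa [one_mul] at h2

/-- The decreasing chain of spectral projections of `X` at multiples of `ε`, starting with `1`. -/
def spectralChain (X : M.toStarSubalgebra) (ε : ℝ) (j : ℕ) : M.toStarSubalgebra :=
  if j = 0 then 1 else spectralProj X (j * ε)

theorem isStarProjection_spectralChain (X : M.toStarSubalgebra) (ε : ℝ) (j : ℕ) :
    IsStarProjection (spectralChain X ε j) := by
  unfold spectralChain
  split_ifs
  · exact .one _
  · exact isStarProjection_spectralProj _ _

theorem spectralProj_le_spectralChain (X : M.toStarSubalgebra) (ε : ℝ) (j : ℕ) :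
    spectralProj X (j * ε) ≤ spectralChain X ε j := by
  unfold spectralChain
  split_ifs
  · exact (isStarProjection_spectralProj _ _).le_one
  · exact le_rfl

theorem spectralChain_antitone {X : M.toStarSubalgebra} (hX : IsSelfAdjoint X) {ε : ℝ}
    (hε : 0 < ε) : Antitone (spectralChain X ε) := by
  intro i j hij
  rcases Nat.eq_zero_or_pos i with rfl | hi
  · exact (isStarProjection_spectralChain X ε j).le_one
  · rw [spectralChain, spectralChain, if_neg (by omega), if_neg (by omega)]
    refine spectralProj_antitone hX ?_
    have : (i : ℝ) ≤ j := by exact_mod_cast hij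
    gcongr

theorem spectralChain_eq_zero {X : M.toStarSubalgebra} (hX : 0 ≤ X) {ε : ℝ} {J : ℕ} (hJ : J ≠ 0)
    (hXJ : ‖X‖ ≤ J * ε) : spectralChain X ε J = 0 := by
  rw [spectralChain, if_neg hJ, spectralProj_eq_zero hX hXJ]

/-- A discrete layer-cake formula: each slab of height `ε` contributes the part of `t` inside it. -/
theorem sum_stepFn {ε t : ℝ} (hε : 0 < ε) (ht : 0 ≤ t) (J : ℕ) :
    ∑ j ∈ Finset.range J, ε * stepFn (j * ε) ε t = min t (J * ε) := by
  induction J with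
  | zero => simp [ht]
  | succ J ih =>
    rw [Finset.sum_range_succ, ih]
    push_cast
    rcases le_total t (J * ε) with h | h
    · rw [stepFn_eq_zero hε h, min_eq_left h, min_eq_left (by linarith)]; simp
    · rw [min_eq_right h, stepFn, max_eq_left (by linarith), mul_div_cancel₀ _ hε.ne']
      rcases le_total (t - J * ε) ε with h2 | h2
      · rw [min_eq_left h2, min_eq_left (by linarith)]; ring
      · rw [min_eq_right h2, min_eq_right (by linarith)]; ring

/-- Abel summation, which turns a step function written by its levels into a sum of projections. -/
theorem sum_mul_sub_succ (ε : ℝ) (G : ℕ → M.toStarSubalgebra) (J : ℕ) :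
    ∑ i ∈ Finset.range J, (i * ε) • (G i - G (i + 1)) + (J * ε) • G J =
      ∑ i ∈ Finset.range J, ε • G (i + 1) := by
  induction J with
  | zero => simp
  | succ J ih =>
    rw [Finset.sum_range_succ, Finset.sum_range_succ, ← ih]
    push_cast
    module

/-- A positive element is approximated by a step function of itself. -/
theorem norm_sub_sum_spectralChain_le {X : M.toStarSubalgebra} (hX : 0 ≤ X) {ε : ℝ} (hε : 0 < ε)
    {J : ℕ} (hJ : J ≠ 0) (hXJ : ‖X‖ ≤ J * ε) :
    ‖X - ∑ i ∈ Finset.range J, (i * ε) • (spectralChain X ε i - spectralChain X ε (i + 1))‖ ≤ ε := by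
  have hXsa : IsSelfAdjoint X := .of_nonneg hX
  set G := spectralChain X ε with hG
  have hGJ : G J = 0 := spectralChain_eq_zero hX hJ hXJ
  have hsum := sum_mul_sub_succ ε G J
  rw [hGJ, smul_zero, add_zero] at hsum
  rw [hsum]
  have hXeq : X = ∑ j ∈ Finset.range J, ε • cfc (stepFn (j * ε) ε) X := by
    have h1 : ∀ j ∈ Finset.range J, ε • cfc (stepFn (j * ε) ε) X =
        cfc (fun t ↦ ε * stepFn (j * ε) ε t) X := fun j _ ↦ by
      rw [cfc_const_mul ε _ X (continuous_stepFn _ _).continuousOn]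
    have hcont : ∀ j : ℕ, Continuous fun t ↦ ε * stepFn (j * ε) ε t := fun j ↦
      continuous_const.mul (continuous_stepFn _ _)
    rw [Finset.sum_congr rfl h1, ← cfc_sum (fun (j : ℕ) t ↦ ε * stepFn (j * ε) ε t) X _
      (fun j _ ↦ (hcont j).continuousOn)]
    conv_lhs => rw [← cfc_id' ℝ X]
    refine cfc_congr fun t ht ↦ ?_
    obtain ⟨h2, h3⟩ := spectrum_subset_Icc hX ht
    rw [Finset.sum_apply, sum_stepFn hε h2, min_eq_left (h3.trans hXJ)]
  have hlow : ∑ j ∈ Finset.range J, ε • G (j + 1) ≤ X := by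
    conv_rhs => rw [hXeq]
    refine Finset.sum_le_sum fun j _ ↦ smul_le_smul_of_nonneg_left ?_ hε.le
    have h1 := spectralProj_le hXsa (j * ε) hε
    rw [hG, spectralChain, if_neg (by omega)]
    have h2 : ((j + 1 : ℕ) : ℝ) * ε = j * ε + ε := by push_cast; ring
    rwa [h2]
  have hupp : X ≤ ∑ j ∈ Finset.range J, ε • G j := by
    conv_lhs => rw [hXeq]
    exact Finset.sum_le_sum fun j _ ↦ smul_le_smul_of_nonneg_left
      ((le_spectralProj _ hε).trans (spectralProj_le_spectralChain X ε j)) hε.le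
  -- The lower and upper sums around `X` telescope to a difference of exactly `ε`.
  have hdiff : ∑ j ∈ Finset.range J, ε • G j - ∑ j ∈ Finset.range J, ε • G (j + 1) =
      algebraMap ℝ M.toStarSubalgebra ε := by
    rw [← Finset.sum_sub_distrib]
    simp only [← smul_sub]
    rw [← Finset.smul_sum, Finset.sum_range_sub', hGJ, sub_zero, Algebra.algebraMap_eq_smul_one,
      hG, spectralChain, if_pos rfl]
  rw [CStarAlgebra.norm_le_iff_le_algebraMap _ hε.le (sub_nonneg.mpr hlow), ← hdiff]
  exact sub_le_sub_right (α := M.toStarSubalgebra) hupp _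

end Spectral

/-! ### From singular values to traces of spectral projections. -/

section Distribution

open MeasureTheory

variable {H : Type*} [NormedAddCommGroup H] [InnerProductSpace ℂ H] [CompleteSpace H]
variable {M : VonNeumannAlgebra H} {τ : M.toStarSubalgebra →ₗ[ℂ] ℂ}

theorem absValue_eq_self {X : M.toStarSubalgebra} (hX : 0 ≤ X) : absValue X = X := by
  have hXsa : IsSelfAdjoint X := .of_nonneg hX
  have h1 : X * X = cfc (fun t : ℝ ↦ t * t) X := by
    rw [cfc_mul _ _ X (by fun_prop) (by fun_prop), cfc_id' ℝ X]
  rw [absValue, hXsa.star_eq, h1, ← cfc_comp' Real.sqrt (fun t ↦ t * t) X (by fun_prop) (by fun_prop)]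
  conv_rhs => rw [← cfc_id' ℝ X]
  exact cfc_congr fun t ht ↦ Real.sqrt_mul_self (spectrum_nonneg_of_nonneg hX ht)

theorem IsFaithfulNormalTrace.measureReal_Ioi_eq_zero (hτ : IsFaithfulNormalTrace M τ)
    {X : M.toStarSubalgebra} (hX : IsSelfAdjoint X) {t : ℝ} (ht : ‖X‖ + 1 ≤ t) :
    (spectralDistribution τ X).real (Set.Ioi t) = 0 := by
  have := (hasMoments_spectralDistribution hτ hX).isProbabilityMeasure
  rw [measureReal_eq_zero_iff]
  refine measure_mono_null (fun s hs ↦ ?_) (ae_iff.mp (hτ.ae_abs_le hX))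
  have h1 : t < s := hs
  have h2 := le_abs_self s
  simp only [Set.mem_ofPred_eq, not_le]
  linarith

theorem IsFaithfulNormalTrace.measureReal_Ioi_eq_one (hτ : IsFaithfulNormalTrace M τ)
    {X : M.toStarSubalgebra} (hX : IsSelfAdjoint X) {t : ℝ} (ht : t < -(‖X‖ + 1)) :
    (spectralDistribution τ X).real (Set.Ioi t) = 1 := by
  have := (hasMoments_spectralDistribution hτ hX).isProbabilityMeasure
  have h1 : (spectralDistribution τ X) (Set.Ioi t) = 1 := by
    rw [← mem_ae_iff_prob_eq_one measurableSet_Ioi]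
    filter_upwards [hτ.ae_abs_le hX] with s hs
    exact ht.trans_le (abs_le.mp hs).1
  rw [measureReal_def, h1, ENNReal.toReal_one]

/-- If the inequality failed at `t`, take `s = m_T((t + δ', ∞))`, which is then below `1`. The
infimum defining `μ_s(T)` is at most `t + δ'` and that of `μ_s(A)` at least `t`, contradicting the
gap `δ > δ'`. -/
theorem IsFaithfulNormalTrace.measureReal_Ioi_le (hτ : IsFaithfulNormalTrace M τ)
    {A T : M.toStarSubalgebra} (hA : 0 ≤ A) (hT : 0 ≤ T) {δ : ℝ}
    (h : ∀ s ∈ Set.Ico (0 : ℝ) 1, singularValueFunction τ A s + δ ≤ singularValueFunction τ T s)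
    (t : ℝ) {δ' : ℝ} (hδ : δ' < δ) :
    (spectralDistribution τ A).real (Set.Ioi t) ≤
      (spectralDistribution τ T).real (Set.Ioi (t + δ')) := by
  have hAsa : IsSelfAdjoint A := .of_nonneg hA
  have hTsa : IsSelfAdjoint T := .of_nonneg hT
  have := (hasMoments_spectralDistribution hτ hAsa).isProbabilityMeasure
  have := (hasMoments_spectralDistribution hτ hTsa).isProbabilityMeasure
  by_contra! hlt
  have h1 : (spectralDistribution τ A).real (Set.Ioi t) ≤ 1 := measureReal_le_one
  have hs := h _ ⟨measureReal_nonneg, hlt.trans_le h1⟩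
  rw [singularValueFunction, singularValueFunction, absValue_eq_self hA, absValue_eq_self hT,
    eigenvalueFunction, eigenvalueFunction] at hs
  have hT1 : sInf {r : ℝ | (spectralDistribution τ T).real (Set.Ioi r) ≤
      (spectralDistribution τ T).real (Set.Ioi (t + δ'))} ≤ t + δ' := by
    refine csInf_le ⟨-(‖T‖ + 1), fun r hr ↦ ?_⟩ (by rw [Set.mem_ofPred_eq])
    by_contra! hr1
    rw [Set.mem_ofPred_eq, hτ.measureReal_Ioi_eq_one hTsa hr1] at hr
    linarith
  have hA1 : t ≤ sInf {r : ℝ | (spectralDistribution τ A).real (Set.Ioi r) ≤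
      (spectralDistribution τ T).real (Set.Ioi (t + δ'))} := by
    refine le_csInf ⟨‖A‖ + 1, ?_⟩ fun r hr ↦ ?_
    · rw [Set.mem_ofPred_eq, hτ.measureReal_Ioi_eq_zero hAsa le_rfl]
      exact measureReal_nonneg
    · by_contra! hr1
      have h2 : (spectralDistribution τ A).real (Set.Ioi t) ≤
          (spectralDistribution τ A).real (Set.Ioi r) :=
        measureReal_mono (Set.Ioi_subset_Ioi hr1.le)
      exact absurd (h2.trans hr) (not_le.mpr hlt)
  linarith

/-- Passing between spectral projections and distribution functions costs one `ε` for `A` and one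
for `T`; a gap of `m + 2` meshes thus yields a shift by `m`. -/
theorem IsFaithfulNormalTrace.trace_spectralChain_le (hτ : IsFaithfulNormalTrace M τ)
    {A T : M.toStarSubalgebra} (hA : 0 ≤ A) (hT : 0 ≤ T) {δ : ℝ}
    (h : ∀ s ∈ Set.Ico (0 : ℝ) 1, singularValueFunction τ A s + δ ≤ singularValueFunction τ T s)
    {ε : ℝ} (hε : 0 < ε) {m : ℕ} (hmδ : (m + 2) * ε < δ) (i : ℕ) :
    (τ (spectralChain A ε i)).re ≤ (τ (spectralChain T ε (i + m))).re := by
  have hAsa : IsSelfAdjoint A := .of_nonneg hA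
  have hTsa : IsSelfAdjoint T := .of_nonneg hT
  have h1 : (τ (spectralChain A ε i)).re ≤
      (spectralDistribution τ A).real (Set.Ioi (i * ε - ε)) := by
    refine (hτ.re_mono ?_).trans (hτ.trace_stepFn_le hAsa (i * ε - ε) hε)
    unfold spectralChain
    split_ifs with hi
    -- At index `0` the chain entry is `1`, not a spectral projection; the step function starting at
    -- `-ε` is already `1` on the spectrum of `A`.
    · rw [← cfc_const_one ℝ A]
      refine cfc_mono ?_ continuousOn_const (continuous_stepFn _ _).continuousOn
      intro t ht
      have := spectrum_nonneg_of_nonneg hA ht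
      exact (stepFn_eq_one hε (by simpa [hi] using this)).ge
    · have := spectralProj_le hAsa (i * ε - ε) hε
      rwa [sub_add_cancel] at this
  have h2 := hτ.measureReal_Ioi_le hA hT h (i * ε - ε) hmδ
  have h3 : (spectralDistribution τ T).real (Set.Ioi (i * ε - ε + (m + 2) * ε)) ≤
      (τ (spectralChain T ε (i + m))).re := by
    have h4 := hτ.le_trace_stepFn hTsa ((i + m : ℕ) * ε) hε
    have h5 : ((i + m : ℕ) : ℝ) * ε + ε = i * ε - ε + (m + 2) * ε := by push_cast; ring
    rw [h5] at h4
    exact h4.trans (hτ.re_mono ((le_spectralProj _ hε).trans (spectralProj_le_spectralChain _ _ _)))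
  exact h1.trans (h2.trans h3)

end Distribution

/-! ### Finite partitions of unity and their cyclic refinements. -/

section Partition

variable {H : Type*} [NormedAddCommGroup H] [InnerProductSpace ℂ H] [CompleteSpace H]
variable {M : VonNeumannAlgebra H} {τ : M.toStarSubalgebra →ₗ[ℂ] ℂ}
variable {𝒜 : StarSubalgebra ℂ M.toStarSubalgebra} {ι κ : Type*} [Fintype ι] [Fintype κ]

/-- A finite family of pairwise orthogonal projections with sum `1`. -/
structure IsPartition (p : ι → M.toStarSubalgebra) : Prop where
  proj : ∀ i, IsStarProjection (p i)
  orth : ∀ i j, i ≠ j → p i * p j = 0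
  sum_eq_one : ∑ i, p i = 1

theorem IsPartition.of_antitone {G : ℕ → M.toStarSubalgebra} {J : ℕ}
    (hG : ∀ i, IsStarProjection (G i)) (hanti : Antitone G) (h0 : G 0 = 1) (hJ : G J = 0) :
    IsPartition fun i : Fin J ↦ G i - G (i + 1) := by
  have hm : ∀ a b, a ≤ b → G a * G b = G b ∧ G b * G a = G b := fun a b hab ↦
    mul_of_projection_le (hG b) (hG a) (hanti hab)
  refine ⟨fun i ↦ (hG _).sub_of_mul_eq_left (hG _) (hm _ _ (by omega)).2, fun i j hij ↦ ?_, ?_⟩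
  · have hij' : (i : ℕ) ≠ j := fun h ↦ hij (Fin.ext h)
    rcases lt_or_gt_of_ne hij' with h | h
    · simp only [sub_mul, mul_sub]
      rw [(hm (i + 1) (j + 1) (by omega)).1, (hm (i + 1) j (by omega)).1,
        (hm i (j + 1) (by omega)).1, (hm i j (by omega)).1]
      abel
    · simp only [sub_mul, mul_sub]
      rw [(hm (j + 1) (i + 1) (by omega)).2, (hm (j + 1) i (by omega)).2,
        (hm j (i + 1) (by omega)).2, (hm j i (by omega)).2]
      abel
  · rw [Fin.sum_univ_eq_sum_range (fun i ↦ G i - G (i + 1)) J, Finset.sum_range_sub', h0, hJ,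
      sub_zero]

theorem IsPartition.prod {u : ι → M.toStarSubalgebra} {v : κ → M.toStarSubalgebra}
    (hu : IsPartition u) (hv : IsPartition v) (hc : ∀ i j, Commute (u i) (v j)) :
    IsPartition fun k : ι × κ ↦ u k.1 * v k.2 := by
  refine ⟨fun k ↦ (hu.proj _).mul (hv.proj _) (hc _ _), fun k l hkl ↦ ?_, ?_⟩
  · have h1 : u k.1 * v k.2 * (u l.1 * v l.2) = (u k.1 * u l.1) * (v k.2 * v l.2) := by
      rw [mul_assoc, ← mul_assoc (v k.2), ← (hc l.1 k.2).eq, mul_assoc, mul_assoc]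
    rw [h1]
    by_cases h : k.1 = l.1
    · rw [hv.orth k.2 l.2 fun h2 ↦ hkl (Prod.ext h h2), mul_zero]
    · rw [hu.orth _ _ h, zero_mul]
  · rw [Fintype.sum_prod_type]
    simp only [← Finset.mul_sum, hv.sum_eq_one, mul_one, hu.sum_eq_one]

/-- The linear combination of the projections `p i` with real coefficients `f i`. -/
def combo (p : ι → M.toStarSubalgebra) (f : ι → ℝ) : M.toStarSubalgebra := ∑ i, f i • p i

theorem combo_mem {p : ι → M.toStarSubalgebra} (hp : ∀ i, p i ∈ 𝒜) (f : ι → ℝ) :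
    combo p f ∈ 𝒜 := by
  refine sum_mem fun i _ ↦ ?_
  rw [← Complex.coe_smul]
  exact 𝒜.smul_mem (hp i) _

theorem combo_commute {p : ι → M.toStarSubalgebra} {x : M.toStarSubalgebra}
    (hp : ∀ i, Commute (p i) x) (f : ι → ℝ) : Commute (combo p f) x :=
  Commute.sum_left _ _ _ fun i _ ↦ (hp i).smul_left _

theorem combo_congr {p : ι → M.toStarSubalgebra} {f g : ι → ℝ} (h : ∀ i, p i = 0 ∨ f i = g i) :
    combo p f = combo p g := by
  refine Finset.sum_congr rfl fun i _ ↦ ?_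
  rcases h i with h | h <;> simp [h]

namespace IsPartition

variable {p : ι → M.toStarSubalgebra}

theorem isSelfAdjoint_combo (hp : IsPartition p) (f : ι → ℝ) : IsSelfAdjoint (combo p f) :=
  isSelfAdjoint_sum _ fun i _ ↦ (IsSelfAdjoint.all (f i)).smul (hp.proj i).isSelfAdjoint

theorem combo_one (hp : IsPartition p) : combo p (fun _ ↦ 1) = 1 := by
  simp [combo, hp.sum_eq_one]

theorem combo_mul (hp : IsPartition p) (f g : ι → ℝ) :
    combo p f * combo p g = combo p fun i ↦ f i * g i := by
  classical
  unfold combo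
  rw [Finset.sum_mul]
  refine Finset.sum_congr rfl fun i _ ↦ ?_
  rw [Finset.mul_sum, Finset.sum_eq_single i]
  · rw [smul_mul_smul_comm, (hp.proj i).isIdempotentElem]
  · intro j _ hj
    rw [smul_mul_smul_comm, hp.orth i j hj.symm, smul_zero]
  · simp

theorem norm_combo_le (hp : IsPartition p) {f : ι → ℝ} {K : ℝ} (hK : 0 ≤ K)
    (h : ∀ i, p i = 0 ∨ |f i| ≤ K) : ‖combo p f‖ ≤ K := by
  have h1 : combo p f * combo p f ≤ algebraMap ℝ M.toStarSubalgebra (K ^ 2) := by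
    rw [hp.combo_mul, Algebra.algebraMap_eq_smul_one, ← hp.combo_one, combo, combo,
      Finset.smul_sum]
    refine Finset.sum_le_sum fun i _ ↦ ?_
    rcases h i with h | h
    · simp [h]
    · rw [one_smul]
      refine smul_le_smul_of_nonneg_right ?_ (hp.proj i).nonneg
      rw [← sq, ← sq_abs]
      exact pow_le_pow_left₀ (abs_nonneg _) h 2
  have h2 : 0 ≤ combo p f * combo p f := (hp.isSelfAdjoint_combo f).mul_self_nonneg
  rw [← CStarAlgebra.norm_le_iff_le_algebraMap _ (by positivity) h2,
    (hp.isSelfAdjoint_combo f).norm_mul_self] at h1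
  exact (sq_le_sq₀ (norm_nonneg _) hK).mp h1

end IsPartition

theorem combo_prod_left {u : ι → M.toStarSubalgebra} {v : κ → M.toStarSubalgebra}
    (hv : IsPartition v) (f : ι → ℝ) :
    combo (fun k : ι × κ ↦ u k.1 * v k.2) (fun k ↦ f k.1) = combo u f := by
  unfold combo
  rw [Fintype.sum_prod_type]
  refine Finset.sum_congr rfl fun i _ ↦ ?_
  simp only
  rw [← Finset.smul_sum, ← Finset.mul_sum, hv.sum_eq_one, mul_one]

theorem combo_prod_right {u : ι → M.toStarSubalgebra} {v : κ → M.toStarSubalgebra}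
    (hu : IsPartition u) (f : κ → ℝ) :
    combo (fun k : ι × κ ↦ u k.1 * v k.2) (fun k ↦ f k.2) = combo v f := by
  unfold combo
  rw [Fintype.sum_prod_type_right]
  refine Finset.sum_congr rfl fun i _ ↦ ?_
  simp only
  rw [← Finset.smul_sum, ← Finset.sum_mul, hu.sum_eq_one, one_mul]

/-- A partition in a MASA is refined to `N + 2` parts which are permuted cyclically by a unitary
commuting with the partition. -/
theorem IsMASA.exists_shift (h𝒜 : IsMASA M 𝒜) (hM : IsTypeIIOneFactor M)
    (hτ : IsFaithfulNormalTrace M τ) {p : ι → M.toStarSubalgebra} (hp : IsPartition p)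
    (hpm : ∀ i, p i ∈ 𝒜) (N : ℕ) :
    ∃ e : ZMod (N + 2) → M.toStarSubalgebra, IsPartition e ∧ (∀ l, e l ∈ 𝒜) ∧
      ∃ σ ∈ unitary M.toStarSubalgebra, (∀ l, σ * e l = e (l + 1) * σ) ∧
        ∀ i, Commute (p i) σ := by
  have h1 : ∀ i, ∃ e : ZMod (N + 2) → M.toStarSubalgebra, (∀ i, IsStarProjection (e i)) ∧
      (∀ i, e i ∈ 𝒜) ∧ (∀ i j, i ≠ j → e i * e j = 0) ∧ ∑ l, e l = p i ∧
      ∀ l, (τ (e l)).re = (τ (p i)).re / (N + 2 : ℕ) := fun i ↦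
    h𝒜.exists_division hM hτ (hp.proj i) (hpm i) (n := N + 2) (by omega)
  choose f hf hfm hfo hfs hft using h1
  have hfp : ∀ i l, f i l * p i = f i l := by
    intro i l
    rw [← hfs i, Finset.mul_sum, Finset.sum_eq_single l (fun j _ hj ↦ hfo i l j hj.symm) (by simp),
      (hf i l).isIdempotentElem]
  have hpf : ∀ i l, p i * f i l = f i l := fun i l ↦ by
    rw [h𝒜.prop _ (hpm i) _ (hfm i l), hfp]
  have hx : IsPartition fun k : ι × ZMod (N + 2) ↦ f k.1 k.2 := by
    refine ⟨fun k ↦ hf _ _, fun k l hkl ↦ ?_, ?_⟩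
    · by_cases h : k.1 = l.1
      · rw [h]
        exact hfo _ _ _ fun h2 ↦ hkl (Prod.ext h h2)
      · rw [← hfp k.1, ← hpf l.1, mul_assoc, ← mul_assoc (p k.1), hp.orth _ _ h, zero_mul, mul_zero]
    · rw [Fintype.sum_prod_type]
      simp only [hfs, hp.sum_eq_one]
  -- The pieces of each `p i` have equal trace, so one unitary can rotate all of them within their
  -- own `p i`; staying within `p i` gives commutation with the partition.
  obtain ⟨σ, hσ, hσf⟩ := exists_unitary_intertwining hM.toIsFactor hτ
    (x := fun k : ι × ZMod (N + 2) ↦ f k.1 k.2) (y := fun k ↦ f k.1 (k.2 + 1)) hx.proj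
    (fun k ↦ hf _ _) hx.orth
    (fun k l hkl ↦ hx.orth (k.1, k.2 + 1) (l.1, l.2 + 1) fun h ↦ hkl <| by
      rw [Prod.mk.injEq, add_left_inj] at h
      exact Prod.ext h.1 h.2) hx.sum_eq_one
    (by
      rw [Fintype.sum_prod_type, ← hp.sum_eq_one]
      refine Finset.sum_congr rfl fun i _ ↦ ?_
      rw [← hfs i]
      exact Equiv.sum_comp (Equiv.addRight (1 : ZMod (N + 2))) (f i))
    fun k ↦ by rw [hft, hft]
  refine ⟨fun l ↦ ∑ i, f i l, ⟨fun l ↦ ?_, fun l l' hl ↦ ?_, ?_⟩, fun l ↦ sum_mem fun i _ ↦ hfm i l,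
    σ, hσ, fun l ↦ ?_, fun i ↦ ?_⟩
  · refine ⟨?_, isSelfAdjoint_sum _ fun i _ ↦ (hf i l).isSelfAdjoint⟩
    rw [IsIdempotentElem, Finset.sum_mul]
    refine Finset.sum_congr rfl fun i _ ↦ ?_
    rw [Finset.mul_sum, Finset.sum_eq_single i
      (fun j _ hj ↦ hx.orth (i, l) (j, l) fun h ↦ hj (congrArg Prod.fst h).symm) (by simp),
      (hf i l).isIdempotentElem]
  · rw [Finset.sum_mul]
    refine Finset.sum_eq_zero fun i _ ↦ ?_
    rw [Finset.mul_sum]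
    exact Finset.sum_eq_zero fun j _ ↦ hx.orth (i, l) (j, l') fun h ↦ hl (congrArg Prod.snd h)
  · rw [Finset.sum_comm]
    simp only [hfs, hp.sum_eq_one]
  · rw [Finset.mul_sum, Finset.sum_mul]
    exact Finset.sum_congr rfl fun i _ ↦ hσf (i, l)
  · have h2 : σ * p i = p i * σ := by
      rw [← hfs i, Finset.mul_sum, Finset.sum_mul,
        ← Equiv.sum_comp (Equiv.addRight (1 : ZMod (N + 2))) (fun l ↦ f i l * σ)]
      exact Finset.sum_congr rfl fun l _ ↦ hσf (i, l)
    exact h2.symm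

/-- `r² - z² = (r - z)(r + z)` is a product of commuting positive elements, so `z² ≤ r²`. -/
theorem norm_le_of_neg_le_of_le {z : M.toStarSubalgebra} (hz : IsSelfAdjoint z) {r : ℝ}
    (hr : 0 ≤ r) (h1 : -algebraMap ℝ M.toStarSubalgebra r ≤ z)
    (h2 : z ≤ algebraMap ℝ M.toStarSubalgebra r) : ‖z‖ ≤ r := by
  have h3 : 0 ≤ (algebraMap ℝ M.toStarSubalgebra r - z) * (algebraMap ℝ M.toStarSubalgebra r + z) :=
    Commute.mul_nonneg (sub_nonneg.mpr h2) (neg_le_iff_add_nonneg'.mp h1) (by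
      have := Algebra.commutes r z
      rw [commute_iff_eq, sub_mul, mul_add, mul_add, add_mul, mul_sub, mul_sub, this]
      abel)
  have h4 : (algebraMap ℝ M.toStarSubalgebra r - z) * (algebraMap ℝ M.toStarSubalgebra r + z) =
      algebraMap ℝ M.toStarSubalgebra (r ^ 2) - z * z := by
    rw [sub_mul, mul_add, mul_add, Algebra.commutes r z, sq, map_mul]
    abel
  rw [h4, sub_nonneg, ← CStarAlgebra.norm_le_iff_le_algebraMap _ (by positivity)
    hz.mul_self_nonneg, hz.norm_mul_self] at h3
  exact (sq_le_sq₀ (norm_nonneg _) hr).mp h3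

/-- Positivity and unitality make `E` contractive on self-adjoint elements. Splitting into real and
imaginary parts costs the factor `2`, which is harmless for the iteration. -/
theorem IsNormalCondExp.isAbelianExpectation {E : M.toStarSubalgebra →ₗ[ℂ] 𝒜}
    (hE : IsNormalCondExp M 𝒜 E) (h𝒜 : IsMASA M 𝒜) :
    IsAbelianExpectation 𝒜 (𝒜.subtype.toAlgHom.toLinearMap ∘ₗ E) where
  mem x := (E x).2
  bimodule a ha b hb x := congrArg Subtype.val (hE.bimodule ⟨a, ha⟩ ⟨b, hb⟩ x)
  apply_of_mem a ha := congrArg Subtype.val (hE.apply_coe ⟨a, ha⟩)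
  norm_le x := by
    have hmono : ∀ x y : M.toStarSubalgebra, x ≤ y → (E x : M.toStarSubalgebra) ≤ E y := by
      intro x y hxy
      have h1 := hE.nonneg (y - x) (sub_nonneg.mpr hxy)
      rw [map_sub] at h1
      have h2 : (0 : M.toStarSubalgebra) ≤ (E y : M.toStarSubalgebra) - E x := h1
      exact sub_nonneg.mp h2
    have halg : ∀ r : ℝ, (E (algebraMap ℝ M.toStarSubalgebra r) : M.toStarSubalgebra) =
        algebraMap ℝ M.toStarSubalgebra r := fun r ↦ by
      have h1 : algebraMap ℝ M.toStarSubalgebra r ∈ 𝒜 := by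
        rw [IsScalarTower.algebraMap_apply ℝ ℂ M.toStarSubalgebra]
        exact 𝒜.algebraMap_mem _
      exact congrArg Subtype.val (hE.apply_coe ⟨_, h1⟩)
    have hsa : ∀ y : M.toStarSubalgebra, IsSelfAdjoint y →
        ‖(E y : M.toStarSubalgebra)‖ ≤ ‖y‖ := by
      intro y hy
      have h1 := hmono _ _ hy.le_algebraMap_norm_self
      have h2 := hmono _ _ hy.neg_algebraMap_norm_le_self
      rw [map_neg] at h2
      rw [halg] at h1
      have h3 : (-E (algebraMap ℝ M.toStarSubalgebra ‖y‖) : M.toStarSubalgebra) =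
        -algebraMap ℝ M.toStarSubalgebra ‖y‖ := by rw [halg]
      refine norm_le_of_neg_le_of_le ?_ (norm_nonneg y) (h3 ▸ h2) h1
      have h4 := (IsSelfAdjoint.of_nonneg (sub_nonneg.mpr h1))
      have h5 := (IsSelfAdjoint.algebraMap M.toStarSubalgebra (IsSelfAdjoint.all ‖y‖)).sub h4
      rwa [sub_sub_cancel] at h5
    have hx : x = (realPart x : M.toStarSubalgebra) + Complex.I • (imaginaryPart x) :=
      (realPart_add_I_smul_imaginaryPart x).symm
    calc ‖(E x : M.toStarSubalgebra)‖
        = ‖(E (realPart x : M.toStarSubalgebra) : M.toStarSubalgebra) +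
            Complex.I • (E (imaginaryPart x : M.toStarSubalgebra) : M.toStarSubalgebra)‖ := by
          conv_lhs => rw [hx, map_add, map_smul]
          rfl
      _ ≤ ‖x‖ + ‖x‖ := by
          refine (norm_add_le _ _).trans (add_le_add ?_ ?_)
          · exact (hsa _ (realPart x).2).trans (realPart.norm_le x)
          · rw [norm_smul, Complex.norm_I, one_mul]
            exact (hsa _ (imaginaryPart x).2).trans (imaginaryPart.norm_le x)
      _ = 2 * ‖x‖ := by ring
  comm a ha b hb := h𝒜.prop a ha b hb

end Partition

/-! ### Discretization of `A` and `T`, and choice of the parameters. -/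

section Main

variable {H : Type*} [NormedAddCommGroup H] [InnerProductSpace ℂ H] [CompleteSpace H]
variable {M : VonNeumannAlgebra H} {τ : M.toStarSubalgebra →ₗ[ℂ] ℂ}
variable {𝒜 : StarSubalgebra ℂ M.toStarSubalgebra}

theorem IsFaithfulNormalTrace.re_mem_Icc (hτ : IsFaithfulNormalTrace M τ)
    {p : M.toStarSubalgebra} (hp : IsStarProjection p) : (τ p).re ∈ Set.Icc (0 : ℝ) 1 := by
  refine ⟨hτ.re_nonneg hp.nonneg, ?_⟩
  have := hτ.re_mono hp.le_one
  rwa [hτ.map_one] at this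

theorem combo_fin (G : ℕ → M.toStarSubalgebra) (ε : ℝ) (J : ℕ) :
    combo (fun i : Fin J ↦ G i - G (i + 1)) (fun i ↦ i * ε) =
      ∑ i ∈ Finset.range J, (i * ε) • (G i - G (i + 1)) :=
  Fin.sum_univ_eq_sum_range (fun i ↦ ((i : ℝ) * ε) • (G i - G (i + 1))) J

/-- Discretization: `A` and a unitary conjugate of `T` are uniformly close to step functions of two
flags of projections in the MASA, such that the flag of `T` dominates a shift of the flag
of `A`. -/
theorem IsMASA.exists_flags (h𝒜 : IsMASA M 𝒜) (hM : IsTypeIIOneFactor M)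
    (hτ : IsFaithfulNormalTrace M τ) {A T : M.toStarSubalgebra} (hA : 0 ≤ A) (hAm : A ∈ 𝒜)
    (hT : 0 ≤ T) {δ : ℝ}
    (h : ∀ s ∈ Set.Ico (0 : ℝ) 1, singularValueFunction τ A s + δ ≤ singularValueFunction τ T s)
    {ε : ℝ} (hε : 0 < ε) {m : ℕ} (hmδ : (m + 2) * ε < δ) {J : ℕ} (hJ : J ≠ 0)
    (hAJ : ‖A‖ ≤ J * ε) (hTJ : ‖T‖ ≤ J * ε) :
    ∃ P Q : ℕ → M.toStarSubalgebra, (∀ i, IsStarProjection (P i)) ∧ (∀ i, IsStarProjection (Q i)) ∧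
      (∀ i, P i ∈ 𝒜) ∧ (∀ i, Q i ∈ 𝒜) ∧ Antitone P ∧ Antitone Q ∧ P 0 = 1 ∧ Q 0 = 1 ∧ P J = 0 ∧
      Q J = 0 ∧ (∀ i, P i ≤ Q (i + m)) ∧
      ‖A - combo (fun i : Fin J ↦ P i - P (i + 1)) (fun i ↦ i * ε)‖ ≤ ε ∧
      ∃ V ∈ unitary M.toStarSubalgebra,
        ‖V * T * star V - combo (fun i : Fin J ↦ Q i - Q (i + 1)) (fun i ↦ i * ε)‖ ≤ ε := by
  have hAsa : IsSelfAdjoint A := .of_nonneg hA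
  have hTsa : IsSelfAdjoint T := .of_nonneg hT
  set P := spectralChain A ε with hP
  set S := spectralChain T ε with hS
  have hPp : ∀ i, IsStarProjection (P i) := isStarProjection_spectralChain A ε
  have hSp : ∀ i, IsStarProjection (S i) := isStarProjection_spectralChain T ε
  have hPm : ∀ i, P i ∈ 𝒜 := fun i ↦ by
    rw [hP, spectralChain]
    split_ifs
    · exact one_mem _
    · exact h𝒜.spectralProj_mem hAm _
  have hPanti : Antitone P := spectralChain_antitone hAsa hε
  have hSanti : Antitone S := spectralChain_antitone hTsa hε
  have hP0 : P 0 = 1 := if_pos rfl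
  have hS0 : S 0 = 1 := if_pos rfl
  have hPJ : P J = 0 := spectralChain_eq_zero hA hJ hAJ
  have hSJ : S J = 0 := spectralChain_eq_zero hT hJ hTJ
  obtain ⟨F, hF, hFmono, hFP⟩ := h𝒜.exists_flag hM hτ (c := Set.range P) hPanti.isChain_range
    (by rintro _ ⟨i, rfl⟩; exact ⟨hPp i, hPm i⟩)
  have hτP := fun i ↦ hτ.re_mem_Icc (hPp i)
  have hτS := fun i ↦ hτ.re_mem_Icc (hSp i)
  have hFP' : ∀ i, F (τ (P i)).re = P i := fun i ↦ hFP _ ⟨i, rfl⟩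
  -- `Q j` is the flag member with the trace of the spectral projection `S j` of `T`. The flag also
  -- contains every `P i`, so trace inequalities become inclusions, while equality of traces
  -- provides the conjugating unitary `V`.
  set Q : ℕ → M.toStarSubalgebra := fun j ↦ F (τ (S j)).re with hQ
  have hQp : ∀ i, IsStarProjection (Q i) := fun i ↦ (hF _ (hτS i)).1
  have hQτ : ∀ i, (τ (Q i)).re = (τ (S i)).re := fun i ↦ (hF _ (hτS i)).2.2
  have hQanti : Antitone Q := fun i j hij ↦
    hFmono _ (hτS j) _ (hτS i) (hτ.re_mono (hSanti hij))
  have hQ0 : Q 0 = 1 := by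
    rw [← hP0, ← hFP' 0, hQ]
    simp only [hS0, hP0]
  have hQJ : Q J = 0 := by
    rw [← hPJ, ← hFP' J, hQ]
    simp only [hSJ, hPJ]
  have hPQ : ∀ i, P i ≤ Q (i + m) := fun i ↦ by
    rw [← hFP' i]
    exact hFmono _ (hτP i) _ (hτS _) (hτ.trace_spectralChain_le hA hT h hε hmδ i)
  refine ⟨P, Q, hPp, hQp, hPm, fun i ↦ (hF _ (hτS i)).2.1, hPanti, hQanti, hP0, hQ0, hPJ, hQJ, hPQ,
    ?_, ?_⟩
  · rw [combo_fin]
    exact norm_sub_sum_spectralChain_le hA hε hJ hAJ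
  · have hSpart := IsPartition.of_antitone hSp hSanti hS0 hSJ
    have hQpart := IsPartition.of_antitone hQp hQanti hQ0 hQJ
    obtain ⟨V, hV, hVS⟩ := exists_unitary_intertwining hM.toIsFactor hτ hSpart.proj hQpart.proj
      hSpart.orth hQpart.orth hSpart.sum_eq_one hQpart.sum_eq_one fun i ↦ by
        simp only [map_sub, Complex.sub_re, hQτ]
    refine ⟨V, hV, ?_⟩
    have h1 : V * combo (fun i : Fin J ↦ S i - S (i + 1)) (fun i ↦ i * ε) =
        combo (fun i : Fin J ↦ Q i - Q (i + 1)) (fun i ↦ i * ε) * V := by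
      simp only [combo, Finset.mul_sum, Finset.sum_mul, mul_smul_comm, smul_mul_assoc, hVS]
    have h2 : V * T * star V - combo (fun i : Fin J ↦ Q i - Q (i + 1)) (fun i ↦ i * ε) =
        V * (T - combo (fun i : Fin J ↦ S i - S (i + 1)) (fun i ↦ i * ε)) * star V := by
      rw [mul_sub, sub_mul, h1, mul_assoc (combo _ _), Unitary.mul_star_self_of_mem hV, mul_one]
    rw [h2, CStarRing.norm_mul_mem_unitary _ (Unitary.star_mem hV),
      CStarRing.norm_mem_unitary_mul _ hV, combo_fin]
    exact norm_sub_sum_spectralChain_le hT hε hJ hTJ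

/-- For `j < i + m` both `Q j` and `Q (j + 1)` dominate `P i`, so the four products cancel. The
meaning: where `A` has level `i`, `T` has level at least `i + m`. -/
theorem sub_mul_sub_eq_zero_of_le {P Q : ℕ → M.toStarSubalgebra} {m : ℕ}
    (hP : ∀ i, IsStarProjection (P i)) (hQ : ∀ i, IsStarProjection (Q i)) (hPa : Antitone P)
    (hQa : Antitone Q) (hPQ : ∀ i, P i ≤ Q (i + m)) {i j : ℕ} (hij : j < i + m) :
    (P i - P (i + 1)) * (Q j - Q (j + 1)) = 0 := by
  have h1 : ∀ a b, i ≤ a → b ≤ i + m → P a * Q b = P a := fun a b ha hb ↦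
    (mul_of_projection_le (hP a) (hQ b) ((hPa ha).trans ((hPQ i).trans (hQa hb)))).2
  simp only [sub_mul, mul_sub]
  rw [h1 i j le_rfl (by omega), h1 i (j + 1) le_rfl (by omega), h1 (i + 1) j (by omega) (by omega),
    h1 (i + 1) (j + 1) (by omega) (by omega)]
  abel

/-- The construction for a fixed mesh `ε`, a fixed gap `m * ε` and a fixed length `N + 2` of the
cyclic shift. -/
theorem IsMASA.exists_unitary_of_mesh (h𝒜 : IsMASA M 𝒜) (hM : IsTypeIIOneFactor M)
    (hτ : IsFaithfulNormalTrace M τ) {E : M.toStarSubalgebra →ₗ[ℂ] M.toStarSubalgebra}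
    (hE : IsAbelianExpectation 𝒜 E) {A T : M.toStarSubalgebra} (hA : 0 ≤ A) (hAm : A ∈ 𝒜)
    (hT : 0 ≤ T) {δ : ℝ} (hδ : 0 < δ)
    (h : ∀ s ∈ Set.Ico (0 : ℝ) 1, singularValueFunction τ A s + δ ≤ singularValueFunction τ T s)
    {ε : ℝ} (hε : 0 < ε) {m : ℕ} (hm : δ / 2 ≤ m * ε) (hmδ : (m + 2) * ε < δ) {J : ℕ} (hJ : J ≠ 0)
    (hAJ : ‖A‖ ≤ J * ε) (hTJ : ‖T‖ ≤ J * ε) {L : ℝ} (hL : 1 ≤ L) (hJL : (J + m) * ε ≤ L)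
    {κ : ℝ} (hκ : 1 ≤ κ) (hκL : 4 * L / δ ^ 2 ≤ κ) {N : ℕ}
    (hsmall : (ε + 2 * (ε + 2 * (1 - δ / (2 * L)) ^ N / (1 - (1 - δ / (2 * L))) * L)) *
      (512 * κ ^ 2 * L) ≤ 1) :
    ∃ W ∈ unitary M.toStarSubalgebra, ∃ V ∈ unitary M.toStarSubalgebra,
      E (W * (V * T * star V)) = A := by
  obtain ⟨P, Q, hP, hQ, hPm, hQm, hPa, hQa, hP0, hQ0, hPJ, hQJ, hPQ, hAε, V, hV, hTε⟩ :=
    h𝒜.exists_flags hM hτ hA hAm hT h hε hmδ hJ hAJ hTJ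
  have hu := IsPartition.of_antitone hP hPa hP0 hPJ
  have hv := IsPartition.of_antitone hQ hQa hQ0 hQJ
  have hp := hu.prod hv fun i j ↦ h𝒜.prop _ (sub_mem (hPm _) (hPm _)) _ (sub_mem (hQm _) (hQm _))
  set p : Fin J × Fin J → M.toStarSubalgebra :=
    fun k ↦ (P k.1 - P (k.1 + 1)) * (Q k.2 - Q (k.2 + 1)) with hpdef
  have hpm : ∀ k, p k ∈ 𝒜 := fun k ↦
    mul_mem (sub_mem (hPm _) (hPm _)) (sub_mem (hQm _) (hQm _))
  have hp0 : ∀ k : Fin J × Fin J, p k = 0 ∨ (k.1 : ℕ) + m ≤ k.2 := fun k ↦ by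
    rcases lt_or_ge (k.2 : ℕ) (k.1 + m) with h | h
    · exact .inl (sub_mul_sub_eq_zero_of_le hP hQ hPa hQa hPQ h)
    · exact .inr h
  obtain ⟨e, he, hem, σ, hσ, hσe, hσp⟩ := h𝒜.exists_shift hM hτ hp hpm N
  have hm0 : 0 < (m : ℝ) := by
    by_contra! hm0
    nlinarith
  have hL0 : 0 < L := by linarith
  -- On nonzero cells this is the level of `T`. The maximum changes it only on vanishing cells, so
  -- that the bounds below hold for all indices.
  let t : Fin J × Fin J → ℝ := fun k ↦ max (k.2 : ℝ) (k.1 + m)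
  have ht0 : ∀ k, 0 < t k := fun k ↦ lt_max_of_lt_right (by positivity)
  have htm : ∀ k, (k.1 : ℝ) + m ≤ t k := fun k ↦ le_max_right _ _
  have htJ : ∀ k, t k ≤ J + m := fun k ↦ by
    have h1 : (k.1 : ℝ) ≤ J := by exact_mod_cast k.1.2.le
    have h2 : (k.2 : ℝ) ≤ J := by exact_mod_cast k.2.2.le
    exact max_le (by linarith) (by linarith)
  have htk : ∀ k, p k = 0 ∨ t k = k.2 := fun k ↦ (hp0 k).imp_right fun h ↦
    max_eq_left (by exact_mod_cast h)
  have hδε : ∀ k, δ / 2 ≤ t k * ε := fun k ↦ hm.trans <| by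
    have : (m : ℝ) ≤ t k := le_trans (by simp) (htm k)
    gcongr
  have htL : ∀ k, t k * ε ≤ L := fun k ↦ le_trans (by gcongr; exact htJ k) hJL
  -- `C` has as coefficients the quotients of the levels of `A` and `T`. The gap gives `1 - f ≥ m /
  -- t ≥ δ / (2L)`.
  let f : Fin J × Fin J → ℝ := fun k ↦ k.1 / t k
  have hf0 : ∀ k, 0 ≤ f k := fun k ↦ div_nonneg (Nat.cast_nonneg _) (ht0 k).le
  have hf1 : ∀ k, f k ≤ 1 - δ / (2 * L) := fun k ↦ by
    have h1 : f k ≤ 1 - m / t k := by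
      rw [one_sub_div (ht0 k).ne']
      exact div_le_div_of_nonneg_right (by linarith [htm k]) (ht0 k).le
    have h2 : δ / (2 * L) ≤ m / t k := by
      rw [div_le_div_iff₀ (by positivity) (ht0 k)]
      have h3 := mul_le_mul hm (htL k) (by have := ht0 k; positivity) (by positivity)
      have h4 : 0 < ε := hε
      have h5 : δ * t k * ε ≤ m * (2 * L) * ε := by linarith
      exact le_of_mul_le_mul_right h5 h4
    linarith
  have hδL : 0 < δ / (2 * L) := by positivity
  have hden : ∀ k, 0 < 1 - f k ^ 2 := fun k ↦ by nlinarith [hf0 k, hf1 k]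
  -- `D` is the inverse of `(1 - C²) S`. Its factors are at least `δ / (2L)` and `δ / 2`, whence the
  -- bound `4L / δ²` for `κ`.
  let d : Fin J × Fin J → ℝ := fun k ↦ 1 / ((1 - f k ^ 2) * (t k * ε))
  have hd : ∀ k, |d k| ≤ κ := fun k ↦ by
    have h1 : δ / (2 * L) ≤ 1 - f k ^ 2 := by nlinarith [hf0 k, hf1 k]
    have h2 : δ / (2 * L) * (δ / 2) ≤ (1 - f k ^ 2) * (t k * ε) :=
      mul_le_mul h1 (hδε k) (by positivity) (hden k).le
    have h3 : 0 < δ / (2 * L) * (δ / 2) := by positivity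
    rw [abs_of_nonneg (one_div_nonneg.mpr (h3.le.trans h2))]
    refine (one_div_le_one_div_of_le h3 h2).trans (le_trans (le_of_eq ?_) hκL)
    field_simp
    norm_num
  have hC := hp.isSelfAdjoint_combo f
  have hCS : combo p f * combo p (fun k ↦ t k * ε) =
      combo (fun i : Fin J ↦ P i - P (i + 1)) (fun i ↦ i * ε) := by
    rw [hp.combo_mul]
    refine Eq.trans ?_ (combo_prod_left (u := fun i : Fin J ↦ P i - P (i + 1)) hv fun i ↦ i * ε)
    refine congrArg (combo p) (funext fun k ↦ ?_)
    have := (ht0 k).ne'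
    simp only [f]
    field_simp
  have hS : combo p (fun k ↦ t k * ε) =
      combo (fun i : Fin J ↦ Q i - Q (i + 1)) (fun i ↦ i * ε) := by
    refine Eq.trans ?_ (combo_prod_right (v := fun i : Fin J ↦ Q i - Q (i + 1)) hu fun i ↦ i * ε)
    exact combo_congr fun k ↦ (htk k).imp_right fun h ↦ by rw [h]
  have hDS : combo p d * (1 - combo p f ^ 2) * combo p (fun k ↦ t k * ε) = 1 := by
    have h1 : 1 - combo p f ^ 2 = combo p fun k ↦ 1 - f k ^ 2 := by
      rw [sq, hp.combo_mul, ← hp.combo_one, combo, combo, combo, ← Finset.sum_sub_distrib]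
      simp only [← sub_smul, sq]
    rw [h1, hp.combo_mul, hp.combo_mul, ← hp.combo_one]
    refine congrArg (combo p) (funext fun k ↦ ?_)
    have h2 := (hden k).ne'
    have h3 := (ht0 k).ne'
    simp only [d]
    field_simp
  have hc0 : 0 ≤ 1 - δ / (2 * L) := by
    by_contra! hneg
    obtain ⟨k⟩ : Nonempty (Fin J × Fin J) := ⟨⟨0, by omega⟩, ⟨0, by omega⟩⟩
    linarith [hf0 k, hf1 k]
  have hVT : ‖V * T * star V‖ ≤ L := by
    rw [CStarRing.norm_mul_mem_unitary _ (Unitary.star_mem hV),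
      CStarRing.norm_mem_unitary_mul _ hV]
    refine hTJ.trans (le_trans ?_ hJL)
    nlinarith
  obtain ⟨W, hW, hWA⟩ := exists_unitary_apply_mul_eq_of_shift (N := N) (e := e) hE hem he.orth
    (fun i ↦ (he.proj i).isIdempotentElem) (fun i ↦ (he.proj i).isSelfAdjoint.star_eq)
    he.sum_eq_one hσ hσe hC (combo_mem hpm f) (combo_mem hpm fun k ↦ t k * ε) (combo_mem hpm d)
    (combo_commute hσp f) hDS
    (hp.norm_combo_le hc0 fun k ↦ .inr (by rw [abs_of_nonneg (hf0 k)]; exact hf1 k))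
    (by linarith) hκ (hp.norm_combo_le (by linarith) fun k ↦ .inr (hd k)) hL
    (hp.norm_combo_le hL0.le fun k ↦ .inr (by
      rw [abs_of_nonneg (by have := ht0 k; positivity)]; exact htL k))
    hVT (hS ▸ hTε) hAm (le_trans (by rw [hCS]; gcongr) hsmall)
  exact ⟨W, hW, V, hV, hWA⟩

/-- The constants `L`, `κ`, `K` depend only on `δ` and the norms, so `N` and then the mesh `ε` can
be chosen in terms of them to satisfy `hsmall`. -/
theorem IsMASA.exists_unitary_apply_conj_eq (h𝒜 : IsMASA M 𝒜) (hM : IsTypeIIOneFactor M)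
    (hτ : IsFaithfulNormalTrace M τ) {E : M.toStarSubalgebra →ₗ[ℂ] M.toStarSubalgebra}
    (hE : IsAbelianExpectation 𝒜 E) {A T : M.toStarSubalgebra} (hA : 0 ≤ A) (hAm : A ∈ 𝒜)
    (hT : 0 ≤ T) {δ : ℝ} (hδ : 0 < δ)
    (h : ∀ s ∈ Set.Ico (0 : ℝ) 1, singularValueFunction τ A s + δ ≤ singularValueFunction τ T s) :
    ∃ W ∈ unitary M.toStarSubalgebra, ∃ V ∈ unitary M.toStarSubalgebra,
      E (W * (V * T * star V)) = A := by
  set B := ‖A‖ + ‖T‖ + 1 with hB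
  have hA0 := norm_nonneg A
  have hT0 := norm_nonneg T
  set L := B + 2 * δ with hLdef
  have hL : 1 ≤ L := by linarith
  set κ := max 1 (4 * L / δ ^ 2) with hκdef
  have hκ : 1 ≤ κ := le_max_left _ _
  set K := 512 * κ ^ 2 * L with hK
  have hK0 : 0 < K := by positivity
  have hq : 0 < δ / (2 * L) := by positivity
  have hq1 : δ / (2 * L) < 1 := by
    rw [div_lt_one (by positivity)]
    linarith
  -- `N` is chosen so that the tail of the Möbius series, after multiplication by `L`, is at most `1
  -- / (4K)` and uses up half of the allowed error.
  obtain ⟨N, hN⟩ := exists_pow_lt_of_lt_one (y := 1 - δ / (2 * L))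
    (show 0 < δ / (2 * L) / (8 * L * K) by positivity) (by linarith)
  -- With `ε = δ / (m + 3)`, the `3` keeps `(m + 2) ε` strictly below `δ`, `m ≥ 3` gives `m ε ≥ δ /
  -- 2`, and `m ≥ 6Kδ` makes the mesh contribution `3 ε K` at most one half.
  obtain ⟨m, hm⟩ := exists_nat_ge (6 * K * δ + 3)
  have hm3 : (3 : ℝ) ≤ m := le_trans (by nlinarith) hm
  set ε := δ / (m + 3) with hεdef
  have hε : 0 < ε := by positivity
  have hmε : (m + 3) * ε = δ := by rw [hεdef]; field_simp
  have hεK : 6 * K * ε ≤ 1 := by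
    rw [hεdef, mul_div_assoc', div_le_one (by positivity)]
    linarith
  obtain ⟨J, hJ, hJ'⟩ : ∃ J : ℕ, B ≤ J * ε ∧ J * ε ≤ B + ε := by
    refine ⟨⌈B / ε⌉₊, ?_, ?_⟩
    · rw [← div_le_iff₀ hε]
      exact Nat.le_ceil _
    · have h1 := (Nat.ceil_lt_add_one (show 0 ≤ B / ε by positivity)).le
      rwa [div_add_one hε.ne', le_div_iff₀ hε] at h1
  have hsmall : (ε + 2 * (ε + 2 * (1 - δ / (2 * L)) ^ N / (1 - (1 - δ / (2 * L))) * L)) * K ≤ 1 := by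
    have h1 : 2 * (1 - δ / (2 * L)) ^ N / (1 - (1 - δ / (2 * L))) * L ≤ 1 / (4 * K) := by
      rw [sub_sub_cancel]
      calc 2 * (1 - δ / (2 * L)) ^ N / (δ / (2 * L)) * L
          ≤ 2 * (δ / (2 * L) / (8 * L * K)) / (δ / (2 * L)) * L := by gcongr
        _ = 1 / (4 * K) := by
          have : L ≠ 0 := by positivity
          field_simp
          norm_num
    calc _ ≤ (ε + 2 * (ε + 1 / (4 * K))) * K := by gcongr
      _ = 6 * K * ε / 2 + 1 / 2 := by field_simp; ring
      _ ≤ 1 := by linarith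
  refine h𝒜.exists_unitary_of_mesh hM hτ hE hA hAm hT hδ h hε (m := m) ?_ ?_ (J := J) ?_ ?_ ?_ hL ?_
    hκ (le_max_right _ _) (N := N) hsmall
  · nlinarith
  · nlinarith
  · rintro rfl
    simp at hJ
    linarith
  · linarith
  · linarith
  · nlinarith

end Main

end Thompson

end

theorem mainTheorem6 {H : Type*} [NormedAddCommGroup H] [InnerProductSpace ℂ H] [CompleteSpace H]
    (M : VonNeumannAlgebra H) (hM : Thompson.IsTypeIIOneFactor M)
    (τ : M.toStarSubalgebra →ₗ[ℂ] ℂ) (hτ : Thompson.IsFaithfulNormalTrace M τ)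
    (𝒜 : StarSubalgebra ℂ M.toStarSubalgebra) (h𝒜 : Thompson.IsMASA M 𝒜)
    (E : M.toStarSubalgebra →ₗ[ℂ] 𝒜) (hE : Thompson.IsNormalCondExp M 𝒜 E)
    (A : 𝒜) (hA : 0 ≤ A) (T : M.toStarSubalgebra) (hT : 0 ≤ T)
    (δ : ℝ) (hδ : 0 < δ)
    (h : ∀ s ∈ Set.Ico (0 : ℝ) 1,
      Thompson.singularValueFunction τ (A : M.toStarSubalgebra) s + δ ≤
        Thompson.singularValueFunction τ T s) :
    ∃ U V : unitary M.toStarSubalgebra,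
      E ((U : M.toStarSubalgebra) * T * (V : M.toStarSubalgebra)) = A := by
  obtain ⟨W, hW, V, hV, hWV⟩ := h𝒜.exists_unitary_apply_conj_eq hM hτ
    (hE.isAbelianExpectation h𝒜) (A := (A : M.toStarSubalgebra)) hA A.2 hT hδ h
  refine ⟨⟨W * V, mul_mem hW hV⟩, ⟨star V, Unitary.star_mem hV⟩, Subtype.ext ?_⟩
  have h1 : W * V * T * star V = W * (V * T * star V) := by simp only [mul_assoc]
  exact (congrArg (fun x ↦ (E x : M.toStarSubalgebra)) h1).trans hWV
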